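/- Let $(M,\omega)$ be a symplectic manifold of dimension $2m$ and let $(\mathcal L,h,\nabla^{\mathcal L})$ be a prequantum line bundle over it: a smooth Hermitian line bundle with compatible connection of curvature $-i\omega$. Let $\mathcal T$ be a smooth manifold and let $J=(J_\sigma)_{\sigma\in\mathcal T}$ be a smooth family of Kähler structures on $(M,\omega)$, with Kähler metrics $g_\sigma=\omega(\cdot,J_\sigma\cdot)$ and Levi-Civita connections $\tilde\nabla=\tilde\nabla_\sigma$. Let $T\to\mathcal T\times M$ be the bundle with fibre $T_{(\sigma,p)}$ the space of $(1,0)$-vectors of $(T_pM)_{\mathbb C}$ with respect to $J_\sigma$, with projection $\pi^{1,0}_\sigma\colon (T_pM)_{\mathbb C}\to T_{(\sigma,p)}$. Give $T$ the connection $\hat\nabla^T$ that is $\tilde\nabla_\sigma$ in the directions of $M$ and, for $V$ tangent to $\mathcal T$, is $(\hat\nabla^T_VY)_{(\sigma,p)}=\pi^{1,0}_\sigma V[Y_p]_\sigma$, where $Y_p$ is viewed as a function of $\sigma$ with values in the fixed space $(T_pM)_{\mathbb C}$. Let $K=\bigwedge^mT^*\to\mathcal T\times M$ with the induced connection, and let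 $\delta\to\mathcal T\times M$ be a smooth complex line bundle with a smooth isomorphism $\delta\otimes\delta\cong K$ (for instance one induced by a metaplectic structure), with the connection $\hat\nabla^\delta$ induced from that of $K$. Let $\hat{\mathcal L}\to\mathcal T\times M$ be the pullback of $\mathcal L$ with the pullback connection $\hat\nabla^{\mathcal L}$. For $k\in\mathbb N$, let the reference connection be $$\hat\nabla^r=(\hat\nabla^{\mathcal L})^{\otimes k}\otimes\mathrm{Id}+\mathrm{Id}\otimes\hat\nabla^\delta\quad\text{in }\hat{\mathcal L}^k\otimes\delta\to\mathcal T\times M .$$ Write $i_\omega\colon TM\to T^*M$, $i_\omega Z=\omega(Z,\cdot)$. For a vector field $V$ on $\mathcal T$, let $\tilde G(V)_\sigma$ be the section of $TM\otimes TM$ defined by $V[J]_\sigma=(\mathrm{Id}\otimes i_\omega)\,\tilde G(V)_\sigma$. Then for every vector field $V$ on $\mathcal T$, regarded as a vector field on $\mathcal T\times M$, and every vector field $X$ on $\mathcal T\times M$ tangent to $M$, the curvature $R_{\hat\nabla^r}(V,X)=[\hat\nabla^r_V,\hat\nabla^r_X]-\hat\nabla^r_{[V,X]}$ is multiplication by the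 function $$R_{\hat\nabla^r}(V,X)=\frac i4\operatorname{Tr}\tilde\nabla(\tilde G(V))\,\omega X ,$$ where, at $(\sigma,p)$, the right-hand side is $\frac i4$ times the trace of the endomorphism of $T_pM$ that sends $Z$ to the contraction of the second factor of $(\tilde\nabla_\sigma)_Z\,\tilde G(V)_\sigma\in T_pM\otimes T_pM$ with the first entry of $\omega(\cdot,X)$, i.e. $a\otimes b\mapsto\omega(b,X)\,a$. -/

import Mathlib

open Bundle Module
open scoped Manifold ContDiff TensorProduct Topology

namespace HalfForm
noncomputable section

section Riemannian

variable {E : Type*} [NormedAddCommGroup E] [NormedSpace ℝ E]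
  {M : Type*} [TopologicalSpace M] [ChartedSpace E M]

/-- The isomorphism `v ↦ B(v, ·)` from a finite-dimensional vector space to its dual induced by a
nondegenerate bilinear form `B`. -/
def flat {V : Type*} [AddCommGroup V] [Module ℝ V] [TopologicalSpace V] [FiniteDimensional ℝ V]
    (B : V →L[ℝ] V →L[ℝ] ℝ) (hB : ∀ v, (∀ w, B v w = 0) → v = 0) : V ≃ₗ[ℝ] Dual ℝ V :=
  LinearMap.linearEquivOfInjective
    (ContinuousLinearMap.coeLM ℝ ∘ₗ (B : V →ₗ[ℝ] V →L[ℝ] ℝ))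
    ((injective_iff_map_eq_zero _).2 fun v hv => hB v fun w => LinearMap.congr_fun hv w)
    Subspace.dual_finrank_eq.symm

/-- The linear map `A♯` with `B(A♯ v, w) = A(v, w)` for all `w`. -/
def raise {V : Type*} [AddCommGroup V] [Module ℝ V] [TopologicalSpace V] [FiniteDimensional ℝ V]
    (B : V →L[ℝ] V →L[ℝ] ℝ) (hB : ∀ v, (∀ w, B v w = 0) → v = 0) (A : V →L[ℝ] V →L[ℝ] ℝ) :
    V →ₗ[ℝ] V :=
  (flat B hB).symm.toLinearMap ∘ₗ ContinuousLinearMap.coeLM ℝ ∘ₗ (A : V →ₗ[ℝ] V →L[ℝ] ℝ)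

theorem raise_spec {V : Type*} [AddCommGroup V] [Module ℝ V] [TopologicalSpace V]
    [FiniteDimensional ℝ V] (B : V →L[ℝ] V →L[ℝ] ℝ) (hB : ∀ v, (∀ w, B v w = 0) → v = 0)
    (A : V →L[ℝ] V →L[ℝ] ℝ) (v w : V) : B (raise B hB A v) w = A v w :=
  LinearMap.congr_fun ((flat B hB).apply_symm_apply _) w

instance finiteDimensional_tangentSpace [FiniteDimensional ℝ E] (p : M) :
    FiniteDimensional ℝ (TangentSpace 𝓘(ℝ, E) p) :=
  inferInstanceAs (FiniteDimensional ℝ E)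

/-- The right-hand side of the Koszul formula for `g(∇_X Y, W)`. -/
def koszul [IsManifold 𝓘(ℝ, E) ∞ M]
    (g : ContMDiffRiemannianMetric 𝓘(ℝ, E) ∞ E (TangentSpace 𝓘(ℝ, E) : M → Type _))
    (X Y W : Π p : M, TangentSpace 𝓘(ℝ, E) p) (p : M) : ℝ :=
  1 / 2 * (mvfderiv 𝓘(ℝ, E) (fun q => g.inner q (Y q) (W q)) p (X p)
    + mvfderiv 𝓘(ℝ, E) (fun q => g.inner q (X q) (W q)) p (Y p)
    - mvfderiv 𝓘(ℝ, E) (fun q => g.inner q (X q) (Y q)) p (W p)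
    + g.inner p (VectorField.mlieBracket 𝓘(ℝ, E) X Y p) (W p)
    - g.inner p (VectorField.mlieBracket 𝓘(ℝ, E) X W p) (Y p)
    - g.inner p (VectorField.mlieBracket 𝓘(ℝ, E) Y W p) (X p))

variable [FiniteDimensional ℝ E] [IsManifold 𝓘(ℝ, E) ∞ M]
    (g : ContMDiffRiemannianMetric 𝓘(ℝ, E) ∞ E (TangentSpace 𝓘(ℝ, E) : M → Type _))

theorem mdifferentiableAt_inner {X Y : Π p : M, TangentSpace 𝓘(ℝ, E) p} {p : M}
    (hX : MDiffAt (T% X) p) (hY : MDiffAt (T% Y) p) :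
    MDiffAt (fun q => g.inner q (X q) (Y q)) p := by
  have h := MDifferentiableAt.clm_bundle_apply₂ (F₁ := E) (F₂ := E) (F₃ := ℝ)
      (E₁ := (TangentSpace 𝓘(ℝ, E) : M → Type _)) (E₂ := (TangentSpace 𝓘(ℝ, E) : M → Type _))
      (E₃ := Bundle.Trivial M ℝ) (b := fun q : M => q) (ψ := g.inner)
      ((g.contMDiff p).mdifferentiableAt (by simp)) hX hY
  rw [mdifferentiableAt_totalSpace] at h
  simpa using h.2

theorem koszul_tensorial_left {Y W : Π p : M, TangentSpace 𝓘(ℝ, E) p} {p : M}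
    (hY : MDiffAt (T% Y) p) (hW : MDiffAt (T% W) p) :
    TensorialAt 𝓘(ℝ, E) E (koszul g · Y W p) p := by
  have : CompleteSpace E := FiniteDimensional.complete ℝ E
  constructor
  · intro f X hf hX
    have h1 := mvfderiv_mul hf (mdifferentiableAt_inner g hX hW)
    have h2 := mvfderiv_mul hf (mdifferentiableAt_inner g hX hY)
    have e1 : (fun q => g.inner q ((f • X) q) (W q)) = f * fun q => g.inner q (X q) (W q) := by
      ext q; simp
    have e2 : (fun q => g.inner q ((f • X) q) (Y q)) = f * fun q => g.inner q (X q) (Y q) := by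
      ext q; simp
    unfold koszul
    rw [e1, e2, h1, h2, VectorField.mlieBracket_smul_left hf hX,
      VectorField.mlieBracket_smul_left hf hX]
    simp
    ring
  · intro X X' hX hX'
    have h1 := mvfderiv_add (mdifferentiableAt_inner g hX hW) (mdifferentiableAt_inner g hX' hW)
    have h2 := mvfderiv_add (mdifferentiableAt_inner g hX hY) (mdifferentiableAt_inner g hX' hY)
    have e1 : (fun q => g.inner q ((X + X') q) (W q)) =
        (fun q => g.inner q (X q) (W q)) + fun q => g.inner q (X' q) (W q) := by
      ext q; simp
    have e2 : (fun q => g.inner q ((X + X') q) (Y q)) =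
        (fun q => g.inner q (X q) (Y q)) + fun q => g.inner q (X' q) (Y q) := by
      ext q; simp
    unfold koszul
    rw [e1, e2, h1, h2, VectorField.mlieBracket_add_left hX hX',
      VectorField.mlieBracket_add_left hX hX']
    simp
    ring

theorem koszul_tensorial_right {X Y : Π p : M, TangentSpace 𝓘(ℝ, E) p} {p : M}
    (hX : MDiffAt (T% X) p) (hY : MDiffAt (T% Y) p) :
    TensorialAt 𝓘(ℝ, E) E (koszul g X Y · p) p := by
  have : CompleteSpace E := FiniteDimensional.complete ℝ E
  constructor
  · intro f W hf hW
    have h1 := mvfderiv_mul hf (mdifferentiableAt_inner g hY hW)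
    have h2 := mvfderiv_mul hf (mdifferentiableAt_inner g hX hW)
    have e1 : (fun q => g.inner q (Y q) ((f • W) q)) = f * fun q => g.inner q (Y q) (W q) := by
      ext q; simp
    have e2 : (fun q => g.inner q (X q) ((f • W) q)) = f * fun q => g.inner q (X q) (W q) := by
      ext q; simp
    unfold koszul
    rw [e1, e2, h1, h2, VectorField.mlieBracket_smul_right hf hW,
      VectorField.mlieBracket_smul_right hf hW]
    simp [g.symm p (W p) (X p), g.symm p (W p) (Y p)]
    ring
  · intro W W' hW hW'
    have h1 := mvfderiv_add (mdifferentiableAt_inner g hY hW) (mdifferentiableAt_inner g hY hW')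
    have h2 := mvfderiv_add (mdifferentiableAt_inner g hX hW) (mdifferentiableAt_inner g hX hW')
    have e1 : (fun q => g.inner q (Y q) ((W + W') q)) =
        (fun q => g.inner q (Y q) (W q)) + fun q => g.inner q (Y q) (W' q) := by
      ext q; simp
    have e2 : (fun q => g.inner q (X q) ((W + W') q)) =
        (fun q => g.inner q (X q) (W q)) + fun q => g.inner q (X q) (W' q) := by
      ext q; simp
    unfold koszul
    rw [e1, e2, h1, h2, VectorField.mlieBracket_add_right hW hW',
      VectorField.mlieBracket_add_right hW hW']
    simp
    ring

/-- The bilinear form `(v, w) ↦ g(∇_v Y, w)` at `p` given by the Koszul formula. -/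
def koszulForm (Y : Π p : M, TangentSpace 𝓘(ℝ, E) p) (p : M) (hY : MDiffAt (T% Y) p) :
    TangentSpace 𝓘(ℝ, E) p →L[ℝ] TangentSpace 𝓘(ℝ, E) p →L[ℝ] ℝ :=
  TensorialAt.mkHom₂ (fun X W => koszul g X Y W p) p
    (fun _ hW => koszul_tensorial_left g hY hW) (fun _ hX => koszul_tensorial_right g hX hY)

theorem metric_nondegenerate (p : M) (v : TangentSpace 𝓘(ℝ, E) p)
    (h : ∀ w, g.inner p v w = 0) : v = 0 := by
  by_contra hv
  exact (g.pos p v hv).ne' (h v)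

open Classical in
/-- The Levi-Civita derivative `∇Y` at `p`: the vector `∇_v Y` is determined by
`g(∇_v Y, w) = koszul(v, Y, w)` for all `w` (junk value `0` where `Y` is not differentiable). -/
def leviCivitaFun (Y : Π p : M, TangentSpace 𝓘(ℝ, E) p) (p : M) :
    TangentSpace 𝓘(ℝ, E) p →L[ℝ] TangentSpace 𝓘(ℝ, E) p :=
  if hY : MDiffAt (T% Y) p then
    haveI : T2Space (TangentSpace 𝓘(ℝ, E) p) := inferInstanceAs (T2Space E)
    LinearMap.toContinuousLinearMap
      (raise (g.inner p) (metric_nondegenerate g p) (koszulForm g Y p hY))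
  else 0

theorem inner_leviCivitaFun {X Y W : Π p : M, TangentSpace 𝓘(ℝ, E) p} {p : M}
    (hX : MDiffAt (T% X) p) (hY : MDiffAt (T% Y) p) (hW : MDiffAt (T% W) p) :
    g.inner p (leviCivitaFun g Y p (X p)) (W p) = koszul g X Y W p := by
  rw [leviCivitaFun, dif_pos hY]
  refine (raise_spec (g.inner p) (metric_nondegenerate g p) _ _ _).trans ?_
  exact TensorialAt.mkHom₂_apply _ _ hX hW

/-- The Levi-Civita connection of a Riemannian metric. -/
def leviCivita : CovariantDerivative 𝓘(ℝ, E) E (TangentSpace 𝓘(ℝ, E) : M → Type _) where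
  toFun := leviCivitaFun g
  isCovariantDerivativeOnUniv := by
    have : CompleteSpace E := FiniteDimensional.complete ℝ E
    have key : ∀ {p : M} {v v' : TangentSpace 𝓘(ℝ, E) p},
        (∀ w, g.inner p v w = g.inner p v' w) → v = v' := fun {p v v'} h =>
      sub_eq_zero.1 (metric_nondegenerate g p _ fun w => by simp [h w])
    constructor
    · intro Y Y' p hY hY' _
      ext v
      refine key fun w => ?_
      obtain ⟨X, hX, rfl⟩ : ∃ X : Π p : M, TangentSpace 𝓘(ℝ, E) p, MDiffAt (T% X) p ∧ X p = v :=
        ⟨FiberBundle.extend E v, FiberBundle.mdifferentiableAt_extend .., by simp⟩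
      obtain ⟨W, hW, rfl⟩ : ∃ W : Π p : M, TangentSpace 𝓘(ℝ, E) p, MDiffAt (T% W) p ∧ W p = w :=
        ⟨FiberBundle.extend E w, FiberBundle.mdifferentiableAt_extend .., by simp⟩
      have hs : MDiffAt (T% (Y + Y')) p := mdifferentiableAt_add_section hY hY'
      rw [inner_leviCivitaFun g hX hs hW]
      simp only [add_apply, map_add]
      rw [inner_leviCivitaFun g hX hY hW, inner_leviCivitaFun g hX hY' hW]
      have h1 := mvfderiv_add (mdifferentiableAt_inner g hY hW) (mdifferentiableAt_inner g hY' hW)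
      have h2 := mvfderiv_add (mdifferentiableAt_inner g hX hY) (mdifferentiableAt_inner g hX hY')
      have e1 : (fun q => g.inner q ((Y + Y') q) (W q)) =
          (fun q => g.inner q (Y q) (W q)) + fun q => g.inner q (Y' q) (W q) := by
        ext q; simp
      have e2 : (fun q => g.inner q (X q) ((Y + Y') q)) =
          (fun q => g.inner q (X q) (Y q)) + fun q => g.inner q (X q) (Y' q) := by
        ext q; simp
      unfold koszul
      rw [e1, e2, h1, h2, VectorField.mlieBracket_add_right hY hY',
        VectorField.mlieBracket_add_left hY hY']
      simp
      ring
    · intro Y f p hY hf _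
      ext v
      refine key fun w => ?_
      obtain ⟨X, hX, rfl⟩ : ∃ X : Π p : M, TangentSpace 𝓘(ℝ, E) p, MDiffAt (T% X) p ∧ X p = v :=
        ⟨FiberBundle.extend E v, FiberBundle.mdifferentiableAt_extend .., by simp⟩
      obtain ⟨W, hW, rfl⟩ : ∃ W : Π p : M, TangentSpace 𝓘(ℝ, E) p, MDiffAt (T% W) p ∧ W p = w :=
        ⟨FiberBundle.extend E w, FiberBundle.mdifferentiableAt_extend .., by simp⟩
      have hs : MDiffAt (T% (f • Y)) p := hf.smul_section hY
      rw [inner_leviCivitaFun g hX hs hW]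
      simp only [add_apply, map_add, smul_apply, map_smul,
        ContinuousLinearMap.smulRight_apply]
      rw [inner_leviCivitaFun g hX hY hW]
      have h1 := mvfderiv_mul hf (mdifferentiableAt_inner g hY hW)
      have h2 := mvfderiv_mul hf (mdifferentiableAt_inner g hX hY)
      have e1 : (fun q => g.inner q ((f • Y) q) (W q)) = f * fun q => g.inner q (Y q) (W q) := by
        ext q; simp
      have e2 : (fun q => g.inner q (X q) ((f • Y) q)) = f * fun q => g.inner q (X q) (Y q) := by
        ext q; simp
      unfold koszul
      rw [e1, e2, h1, h2, VectorField.mlieBracket_smul_right hf hY,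
        VectorField.mlieBracket_smul_left hf hY]
      simp [g.symm p (Y p) (X p)]
      ring

end Riemannian
section Kahler

/-- A symplectic form on `M`: a smooth, closed, nondegenerate two-form. -/
structure SymplecticForm (E : Type*) [NormedAddCommGroup E] [NormedSpace ℝ E]
    (M : Type*) [TopologicalSpace M] [ChartedSpace E M] [IsManifold 𝓘(ℝ, E) ∞ M] where
  /-- The bilinear form on each tangent space. -/
  form (p : M) : TangentSpace 𝓘(ℝ, E) p →L[ℝ] TangentSpace 𝓘(ℝ, E) p →L[ℝ] ℝ
  contMDiff : ContMDiff 𝓘(ℝ, E) (𝓘(ℝ, E).prod 𝓘(ℝ, E →L[ℝ] E →L[ℝ] ℝ)) ∞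
    (fun p => TotalSpace.mk' (E →L[ℝ] E →L[ℝ] ℝ)
      (E := fun p : M => TangentSpace 𝓘(ℝ, E) p →L[ℝ] TangentSpace 𝓘(ℝ, E) p →L[ℝ] ℝ) p (form p))
  alternating (p : M) (v : TangentSpace 𝓘(ℝ, E) p) : form p v v = 0
  nondegenerate (p : M) (v : TangentSpace 𝓘(ℝ, E) p) : (∀ w, form p v w = 0) → v = 0
  /-- `dΩ = 0`, through the invariant formula for the exterior derivative of a two-form. -/
  closed (p : M) (X Y Z : Π q : M, TangentSpace 𝓘(ℝ, E) q) :
    CMDiffAt ∞ (T% X) p → CMDiffAt ∞ (T% Y) p → CMDiffAt ∞ (T% Z) p →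
    mvfderiv 𝓘(ℝ, E) (fun q => form q (Y q) (Z q)) p (X p)
      - mvfderiv 𝓘(ℝ, E) (fun q => form q (X q) (Z q)) p (Y p)
      + mvfderiv 𝓘(ℝ, E) (fun q => form q (X q) (Y q)) p (Z p)
      - form p (VectorField.mlieBracket 𝓘(ℝ, E) X Y p) (Z p)
      + form p (VectorField.mlieBracket 𝓘(ℝ, E) X Z p) (Y p)
      - form p (VectorField.mlieBracket 𝓘(ℝ, E) Y Z p) (X p) = 0

variable {E : Type*} [NormedAddCommGroup E] [NormedSpace ℝ E]
  {M : Type*} [TopologicalSpace M] [ChartedSpace E M] [IsManifold 𝓘(ℝ, E) ∞ M]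
  {ES : Type*} [NormedAddCommGroup ES] [NormedSpace ℝ ES]
  {S : Type*} [TopologicalSpace S] [ChartedSpace ES S]

/-- A family, smoothly parametrized by `S`, of almost complex structures on `M` compatible with
`Ω`: a smooth section `J` of the pullback of `End(TM)` to `S × M` with `J² = -1`, such that
`Ω(·, J·)` is symmetric and positive definite. -/
structure CompatibleFamily (Ω : SymplecticForm E M) (ES : Type*) [NormedAddCommGroup ES]
    [NormedSpace ℝ ES] (S : Type*) [TopologicalSpace S] [ChartedSpace ES S] where
  /-- The almost complex structure `J_σ` at `p`, for `x = (σ, p)`. -/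
  J (x : S × M) : TangentSpace 𝓘(ℝ, E) x.2 →L[ℝ] TangentSpace 𝓘(ℝ, E) x.2
  contMDiff : ContMDiff (𝓘(ℝ, ES).prod 𝓘(ℝ, E)) (𝓘(ℝ, E).prod 𝓘(ℝ, E →L[ℝ] E)) ∞
    (fun x : S × M => TotalSpace.mk' (E →L[ℝ] E)
      (E := fun p : M => TangentSpace 𝓘(ℝ, E) p →L[ℝ] TangentSpace 𝓘(ℝ, E) p) x.2 (J x))
  sq (x : S × M) (v : TangentSpace 𝓘(ℝ, E) x.2) : J x (J x v) = -v
  symm (x : S × M) (v w : TangentSpace 𝓘(ℝ, E) x.2) :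
    Ω.form x.2 v (J x w) = Ω.form x.2 w (J x v)
  pos (x : S × M) (v : TangentSpace 𝓘(ℝ, E) x.2) : v ≠ 0 → 0 < Ω.form x.2 v (J x v)

theorem isVonNBounded_of_pos {V : Type*} [NormedAddCommGroup V] [NormedSpace ℝ V]
    [FiniteDimensional ℝ V] (B : V →L[ℝ] V →L[ℝ] ℝ) (hB : ∀ v, v ≠ 0 → 0 < B v v) :
    Bornology.IsVonNBounded ℝ {v : V | B v v < 1} := by
  have hc : Continuous fun v : V => B v v := by fun_prop
  rw [NormedSpace.isVonNBounded_iff]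
  rcases subsingleton_or_nontrivial V with hV | hV
  · exact (Set.toFinite _).isBounded
  obtain ⟨u, hu, hmin⟩ := (isCompact_sphere (0 : V) 1).exists_isMinOn
    (NormedSpace.sphere_nonempty.2 zero_le_one) hc.continuousOn
  have hu0 : u ≠ 0 := by
    rintro rfl
    simp at hu
  have hcpos := hB u hu0
  refine (Metric.isBounded_closedBall (x := (0 : V)) (r := 1 + 1 / B u u)).subset fun v hv => ?_
  rw [mem_closedBall_zero_iff]
  by_contra! hlt
  have hv0 : 0 < ‖v‖ := lt_trans (by positivity) hlt
  have h1 : B u u ≤ B (‖v‖⁻¹ • v) (‖v‖⁻¹ • v) := hmin (by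
    simp [norm_smul, hv0.ne'])
  simp only [map_smul, smul_apply, smul_eq_mul] at h1
  have h2 : B u u * ‖v‖ ^ 2 ≤ B v v := by
    have := mul_le_mul_of_nonneg_right h1 (sq_nonneg ‖v‖)
    field_simp at this
    linarith
  have h3 : (1 : ℝ) < ‖v‖ := lt_trans (by linarith [one_div_pos.2 hcpos]) hlt
  have h4 : 1 < B u u * ‖v‖ := by
    have : 1 / B u u < ‖v‖ := by linarith
    rwa [div_lt_iff₀ hcpos, mul_comm] at this
  have h5 : B v v < 1 := hv
  nlinarith

variable {Ω : SymplecticForm E M}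

/-- The bilinear form `Ω(·, J_σ ·)`. -/
def CompatibleFamily.metricForm (F : CompatibleFamily Ω ES S) (σ : S) (p : M) :
    TangentSpace 𝓘(ℝ, E) p →L[ℝ] TangentSpace 𝓘(ℝ, E) p →L[ℝ] ℝ :=
  ContinuousLinearMap.bilinearComp (E := E) (F := E) (G := ℝ) (E' := E) (F' := E)
    (Ω.form p) (ContinuousLinearMap.id ℝ E) (F.J (σ, p))

theorem CompatibleFamily.metricForm_apply (F : CompatibleFamily Ω ES S) (σ : S) (p : M)
    (v w : TangentSpace 𝓘(ℝ, E) p) : F.metricForm σ p v w = Ω.form p v (F.J (σ, p) w) := rfl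

theorem CompatibleFamily.contMDiff_metricForm (F : CompatibleFamily Ω ES S) (σ : S) :
    ContMDiff 𝓘(ℝ, E) (𝓘(ℝ, E).prod 𝓘(ℝ, E →L[ℝ] E →L[ℝ] ℝ)) ∞
      (fun p => TotalSpace.mk' (E →L[ℝ] E →L[ℝ] ℝ)
        (E := fun p : M => TangentSpace 𝓘(ℝ, E) p →L[ℝ] TangentSpace 𝓘(ℝ, E) p →L[ℝ] ℝ) p
        (F.metricForm σ p)) := by
  intro p₀
  have h1 := (contMDiffAt_hom_bundle _).1 (Ω.contMDiff p₀)
  have hJ : ContMDiff 𝓘(ℝ, E) (𝓘(ℝ, E).prod 𝓘(ℝ, E →L[ℝ] E)) ∞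
      (fun p : M => TotalSpace.mk' (E →L[ℝ] E)
        (E := fun p : M => TangentSpace 𝓘(ℝ, E) p →L[ℝ] TangentSpace 𝓘(ℝ, E) p) p
        (F.J (σ, p))) :=
    F.contMDiff.comp (contMDiff_const.prodMk contMDiff_id)
  have h2 := (contMDiffAt_hom_bundle _).1 (hJ p₀)
  refine (contMDiffAt_hom_bundle _).2 ⟨contMDiffAt_id, ?_⟩
  have h3 := (((ContinuousLinearMap.compL ℝ E E ℝ).flip.contMDiff (n := ∞)).contMDiffAt.comp p₀
    h2.2).clm_comp h1.2
  refine h3.congr_of_eventuallyEq ?_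
  filter_upwards [(trivializationAt E (TangentSpace 𝓘(ℝ, E)) p₀).open_baseSet.mem_nhds
    (FiberBundle.mem_baseSet_trivializationAt' p₀)] with p hp
  ext v w
  simp only [Function.comp_apply, ContinuousLinearMap.comp_apply, ContinuousLinearMap.flip_apply,
    ContinuousLinearMap.compL_apply]
  rw [inCoordinates_apply_eq₂ hp hp (by simp), inCoordinates_apply_eq₂ hp hp (by simp),
    ContinuousLinearMap.inCoordinates_eq hp hp]
  simp only [CompatibleFamily.metricForm_apply, Trivialization.linearMapAt_apply]
  simp [hp]
  congr 1
  exact (Trivialization.symm_apply_apply_mk _ hp _).symm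

variable [FiniteDimensional ℝ E]

/-- The Riemannian metric `g_σ(X, Y) = Ω(X, J_σ Y)`. -/
def CompatibleFamily.metric (F : CompatibleFamily Ω ES S) (σ : S) :
    ContMDiffRiemannianMetric 𝓘(ℝ, E) ∞ E (TangentSpace 𝓘(ℝ, E) : M → Type _) where
  inner := F.metricForm σ
  symm p v w := F.symm (σ, p) v w
  pos p v hv := F.pos (σ, p) v hv
  isVonNBounded p := isVonNBounded_of_pos (V := E) (F.metricForm σ p) (F.pos (σ, p))
  contMDiff := F.contMDiff_metricForm σ

/-- A smooth family of Kähler structures on `(M, Ω)`: a smooth family of compatible almost complex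
structures `J_σ`, each parallel for the Levi-Civita connection of `g_σ = Ω(·, J_σ ·)`. -/
structure KahlerFamily (Ω : SymplecticForm E M) (ES : Type*) [NormedAddCommGroup ES]
    [NormedSpace ℝ ES] (S : Type*) [TopologicalSpace S] [ChartedSpace ES S]
    extends CompatibleFamily Ω ES S where
  parallel (σ : S) (p : M) (Y : Π q : M, TangentSpace 𝓘(ℝ, E) q) (v : TangentSpace 𝓘(ℝ, E) p) :
    CMDiffAt ∞ (T% Y) p →
    leviCivita (toCompatibleFamily.metric σ) (fun q => J (σ, q) (Y q)) p v =
      J (σ, p) (leviCivita (toCompatibleFamily.metric σ) Y p v)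

end Kahler
section ComplexTangent

variable {V : Type*} [AddCommGroup V] [Module ℝ V]

/-- The real part of a vector in the complexification `V_ℂ = ℂ ⊗ V`. -/
def rePart : ℂ ⊗[ℝ] V →ₗ[ℝ] V := (TensorProduct.lid ℝ V).toLinearMap ∘ₗ Complex.reLm.rTensor V

/-- The imaginary part of a vector in the complexification `V_ℂ = ℂ ⊗ V`. -/
def imPart : ℂ ⊗[ℝ] V →ₗ[ℝ] V := (TensorProduct.lid ℝ V).toLinearMap ∘ₗ Complex.imLm.rTensor V

/-- The map `w ↦ a w + i b w` into the complexification. -/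
def ofReIm {W : Type*} [AddCommGroup W] [Module ℝ W] (a b : W →ₗ[ℝ] V) : W →ₗ[ℝ] ℂ ⊗[ℝ] V :=
  TensorProduct.mk ℝ ℂ V 1 ∘ₗ a + TensorProduct.mk ℝ ℂ V Complex.I ∘ₗ b

theorem ofReIm_re_im : ofReIm (rePart (V := V)) imPart = LinearMap.id := by
  ext z v
  simp only [ofReIm, rePart, imPart, TensorProduct.AlgebraTensorModule.curry_apply,
    TensorProduct.curry_apply, LinearMap.add_apply, LinearMap.comp_apply,
    LinearMap.rTensor_tmul, LinearEquiv.coe_coe, TensorProduct.lid_tmul, TensorProduct.mk_apply,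
    LinearMap.restrictScalars_self, LinearMap.id_apply, TensorProduct.tmul_smul,
    TensorProduct.smul_tmul', ← TensorProduct.add_tmul]
  congr 1
  apply Complex.ext <;> simp

/-- The projection `π^{1,0} = (1 - iJ) / 2` of the complexification. -/
def projHol (J : V →ₗ[ℝ] V) : ℂ ⊗[ℝ] V →ₗ[ℂ] ℂ ⊗[ℝ] V :=
  (1 / 2 : ℂ) • (LinearMap.id - Complex.I • J.baseChange ℂ)

/-- The image `T_J = im π^{1,0}`. -/
def holSubspace (J : V →ₗ[ℝ] V) : Submodule ℂ (ℂ ⊗[ℝ] V) := LinearMap.range (projHol J)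

theorem finrank_holSubspace [FiniteDimensional ℝ V] (J : V →ₗ[ℝ] V) (hJ : ∀ v, J (J v) = -v)
    {m : ℕ} (hm : finrank ℝ V = 2 * m) : finrank ℂ (holSubspace J) = m := by
  have hJ2 : J.baseChange ℂ ∘ₗ J.baseChange ℂ = -LinearMap.id := by
    rw [← LinearMap.baseChange_comp]
    have : J ∘ₗ J = -LinearMap.id := by ext v; simp [hJ]
    rw [this]
    simp
  have hproj : projHol J ∘ₗ projHol J = projHol J := by
    have h2 : ∀ z, J.baseChange ℂ (J.baseChange ℂ z) = -z := fun z => LinearMap.congr_fun hJ2 z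
    refine LinearMap.ext fun z => ?_
    simp only [projHol, LinearMap.comp_apply, LinearMap.smul_apply, LinearMap.sub_apply,
      LinearMap.id_apply, map_smul, map_sub, h2, smul_sub, smul_neg, smul_smul]
    have hI : Complex.I * Complex.I = -1 := Complex.I_mul_I
    match_scalars <;> first | ring1 | linear_combination (1 / 4) * hI | linear_combination (-1 / 4) * hI
  have hP : LinearMap.IsProj (holSubspace J) (projHol J) := by
    refine ⟨fun z => ⟨z, rfl⟩, ?_⟩
    rintro _ ⟨z, rfl⟩
    exact LinearMap.congr_fun hproj z
  have h1 := hP.trace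
  have h2 : LinearMap.trace ℂ (ℂ ⊗[ℝ] V) (projHol J) =
      (1 / 2 : ℂ) * ((2 * m : ℕ) - Complex.I * ((LinearMap.trace ℝ V J : ℝ) : ℂ)) := by
    rw [projHol, map_smul, map_sub, map_smul, LinearMap.trace_baseChange, LinearMap.trace_id,
      Module.finrank_baseChange, hm]
    simp
  rw [h2] at h1
  have h3 := congrArg Complex.re h1
  simp at h3
  exact_mod_cast h3.symm

end ComplexTangent

section Bundles

/-- The curvature `R(X, Y) s = ∇_X ∇_Y s - ∇_Y ∇_X s - ∇_{[X, Y]} s` at `x` of a covariant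
derivative `∇`, where `D s x v` stands for `(∇_v s)(x)`. -/
def curvature {B : Type*} {EB : Type*} [NormedAddCommGroup EB] [NormedSpace ℝ EB]
    {HB : Type*} [TopologicalSpace HB] (IB : ModelWithCorners ℝ EB HB) [TopologicalSpace B]
    [ChartedSpace HB B] {W : B → Type*} [∀ x, AddCommGroup (W x)]
    (D : (Π x, W x) → Π x : B, TangentSpace IB x → W x)
    (X Y : Π x : B, TangentSpace IB x) (s : Π x, W x) (x : B) : W x :=
  D (fun y => D s y (Y y)) x (X x) - D (fun y => D s y (X y)) x (Y x)
    - D s x (VectorField.mlieBracket IB X Y x)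

/-- The local frame `e` of a complex line bundle on the domain of the preferred trivialization
around `x₀`. -/
def lineFrame {B : Type*} [TopologicalSpace B] (L : B → Type*) [∀ x, AddCommGroup (L x)]
    [∀ x, Module ℂ (L x)] [∀ x, TopologicalSpace (L x)] [TopologicalSpace (TotalSpace ℂ L)]
    [FiberBundle ℂ L] [VectorBundle ℂ ℂ L] (x₀ x : B) : L x :=
  (trivializationAt ℂ L x₀).symm x 1

/-- The coordinate with respect to `lineFrame`. -/
def lineCoord {B : Type*} [TopologicalSpace B] (L : B → Type*) [∀ x, AddCommGroup (L x)]
    [∀ x, Module ℂ (L x)] [∀ x, TopologicalSpace (L x)] [TopologicalSpace (TotalSpace ℂ L)]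
    [FiberBundle ℂ L] [VectorBundle ℂ ℂ L] (x₀ x : B) : L x →ₗ[ℂ] ℂ :=
  (trivializationAt ℂ L x₀).linearMapAt ℂ x

variable {E : Type*} [NormedAddCommGroup E] [NormedSpace ℝ E] [FiniteDimensional ℝ E]
  {M : Type*} [TopologicalSpace M] [ChartedSpace E M] [IsManifold 𝓘(ℝ, E) ∞ M]
  {ES : Type*} [NormedAddCommGroup ES] [NormedSpace ℝ ES] [FiniteDimensional ℝ ES]
  {S : Type*} [TopologicalSpace S] [ChartedSpace ES S]
  {Ω : SymplecticForm E M}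
  {L : M → Type*} [∀ p, AddCommGroup (L p)] [∀ p, Module ℂ (L p)] [∀ p, TopologicalSpace (L p)]
  [∀ p, IsTopologicalAddGroup (L p)] [∀ p, ContinuousSMul ℝ (L p)]
  [TopologicalSpace (TotalSpace ℂ L)] [FiberBundle ℂ L] [VectorBundle ℂ ℂ L] [VectorBundle ℝ ℂ L]
  [ContMDiffVectorBundle ∞ ℂ L 𝓘(ℝ, E)]
  {δ : S × M → Type*} [∀ x, AddCommGroup (δ x)] [∀ x, Module ℂ (δ x)]
  [∀ x, TopologicalSpace (δ x)] [∀ x, IsTopologicalAddGroup (δ x)] [∀ x, ContinuousSMul ℝ (δ x)]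
  [TopologicalSpace (TotalSpace ℂ δ)] [FiberBundle ℂ δ] [VectorBundle ℂ ℂ δ] [VectorBundle ℝ ℂ δ]
  [ContMDiffVectorBundle ∞ ℂ δ (𝓘(ℝ, ES).prod 𝓘(ℝ, E))]

/-- The structure of a prequantum line bundle over `(M, Ω)` on the smooth complex line bundle `L`:
a Hermitian metric and a compatible smooth connection with curvature `-iΩ`. -/
structure PrequantumStructure (Ω : SymplecticForm E M)
    (L : M → Type*) [∀ p, AddCommGroup (L p)] [∀ p, Module ℂ (L p)] [∀ p, TopologicalSpace (L p)]
    [∀ p, IsTopologicalAddGroup (L p)] [∀ p, ContinuousSMul ℝ (L p)]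
    [TopologicalSpace (TotalSpace ℂ L)] [FiberBundle ℂ L] [VectorBundle ℂ ℂ L]
    [VectorBundle ℝ ℂ L] [ContMDiffVectorBundle ∞ ℂ L 𝓘(ℝ, E)] where
  /-- The Hermitian metric, complex linear in the first argument. -/
  herm (p : M) : L p →ₗ[ℂ] L p →ₗ⋆[ℂ] ℂ
  herm_symm (p : M) (s t : L p) : herm p t s = starRingEnd ℂ (herm p s t)
  herm_pos (p : M) (s : L p) : s ≠ 0 → 0 < (herm p s s).re
  herm_contMDiff (p : M) (s t : Π q, L q) :
    ContMDiffAt 𝓘(ℝ, E) (𝓘(ℝ, E).prod 𝓘(ℝ, ℂ)) ∞ (fun q => TotalSpace.mk' ℂ q (s q)) p →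
    ContMDiffAt 𝓘(ℝ, E) (𝓘(ℝ, E).prod 𝓘(ℝ, ℂ)) ∞ (fun q => TotalSpace.mk' ℂ q (t q)) p →
    ContMDiffAt 𝓘(ℝ, E) 𝓘(ℝ, ℂ) ∞ (fun q => herm q (s q) (t q)) p
  /-- The connection. -/
  conn : CovariantDerivative 𝓘(ℝ, E) ℂ L
  conn_I_smul (p : M) (s : Π q, L q) (v : TangentSpace 𝓘(ℝ, E) p) :
    ContMDiffAt 𝓘(ℝ, E) (𝓘(ℝ, E).prod 𝓘(ℝ, ℂ)) ∞ (fun q => TotalSpace.mk' ℂ q (s q)) p →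
    conn (fun q => Complex.I • s q) p v = Complex.I • conn s p v
  conn_contMDiff (p : M) (s : Π q, L q) (X : Π q : M, TangentSpace 𝓘(ℝ, E) q) :
    ContMDiffAt 𝓘(ℝ, E) (𝓘(ℝ, E).prod 𝓘(ℝ, ℂ)) ∞ (fun q => TotalSpace.mk' ℂ q (s q)) p →
    CMDiffAt ∞ (T% X) p →
    ContMDiffAt 𝓘(ℝ, E) (𝓘(ℝ, E).prod 𝓘(ℝ, ℂ)) ∞
      (fun q => TotalSpace.mk' ℂ q (conn s q (X q))) p
  compatible (p : M) (s t : Π q, L q) (v : TangentSpace 𝓘(ℝ, E) p) :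
    ContMDiffAt 𝓘(ℝ, E) (𝓘(ℝ, E).prod 𝓘(ℝ, ℂ)) ∞ (fun q => TotalSpace.mk' ℂ q (s q)) p →
    ContMDiffAt 𝓘(ℝ, E) (𝓘(ℝ, E).prod 𝓘(ℝ, ℂ)) ∞ (fun q => TotalSpace.mk' ℂ q (t q)) p →
    mvfderiv 𝓘(ℝ, E) (fun q => herm q (s q) (t q)) p v =
      herm p (conn s p v) (t p) + herm p (s p) (conn t p v)
  curvature_eq (p : M) (X Y : Π q : M, TangentSpace 𝓘(ℝ, E) q) (s : Π q, L q) :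
    CMDiffAt ∞ (T% X) p → CMDiffAt ∞ (T% Y) p →
    ContMDiffAt 𝓘(ℝ, E) (𝓘(ℝ, E).prod 𝓘(ℝ, ℂ)) ∞ (fun q => TotalSpace.mk' ℂ q (s q)) p →
    curvature 𝓘(ℝ, E) (fun s q v => conn s q v) X Y s p =
      (-Complex.I * (Ω.form p (X p) (Y p) : ℂ)) • s p

/-! ### The bundle `T → S × M` and its connection -/

/-- The fibre at `x = (σ, p)` of the bundle `T → S × M` of `(1,0)`-vectors for `J_σ`. -/
abbrev CompatibleFamily.T (F : CompatibleFamily Ω ES S) (x : S × M) :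
    Submodule ℂ (ℂ ⊗[ℝ] TangentSpace 𝓘(ℝ, E) x.2) :=
  holSubspace (F.J x : TangentSpace 𝓘(ℝ, E) x.2 →ₗ[ℝ] TangentSpace 𝓘(ℝ, E) x.2)

/-- The projection `π^{1,0}_σ` from the complexified tangent space of `M` onto `T`. -/
def CompatibleFamily.proj (F : CompatibleFamily Ω ES S) (x : S × M) :
    ℂ ⊗[ℝ] TangentSpace 𝓘(ℝ, E) x.2 →ₗ[ℂ] F.T x :=
  (projHol (F.J x : TangentSpace 𝓘(ℝ, E) x.2 →ₗ[ℝ] TangentSpace 𝓘(ℝ, E) x.2)).rangeRestrict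

/-- Smoothness at `x` of a section of `T`, as a section of the pullback of the complexified tangent
bundle of `M`: its real and imaginary parts are smooth. -/
def CompatibleFamily.SmoothAt (F : CompatibleFamily Ω ES S) (Y : Π x, F.T x) (x : S × M) : Prop :=
  ContMDiffAt (𝓘(ℝ, ES).prod 𝓘(ℝ, E)) (𝓘(ℝ, E).prod 𝓘(ℝ, E)) ∞
      (fun y : S × M => TotalSpace.mk' E (E := (TangentSpace 𝓘(ℝ, E) : M → Type _)) y.2
        (rePart (Y y : ℂ ⊗[ℝ] TangentSpace 𝓘(ℝ, E) y.2))) x ∧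
    ContMDiffAt (𝓘(ℝ, ES).prod 𝓘(ℝ, E)) (𝓘(ℝ, E).prod 𝓘(ℝ, E)) ∞
      (fun y : S × M => TotalSpace.mk' E (E := (TangentSpace 𝓘(ℝ, E) : M → Type _)) y.2
        (imPart (Y y : ℂ ⊗[ℝ] TangentSpace 𝓘(ℝ, E) y.2))) x

/-- The complex linear extension of a covariant derivative on `TM` to `TM_ℂ`. -/
def complexifiedConn (D : CovariantDerivative 𝓘(ℝ, E) E (TangentSpace 𝓘(ℝ, E) : M → Type _))
    (Y : Π p : M, ℂ ⊗[ℝ] TangentSpace 𝓘(ℝ, E) p) (p : M) :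
    TangentSpace 𝓘(ℝ, E) p →ₗ[ℝ] ℂ ⊗[ℝ] TangentSpace 𝓘(ℝ, E) p :=
  ofReIm (D (fun q => rePart (Y q)) p : TangentSpace 𝓘(ℝ, E) p →ₗ[ℝ] TangentSpace 𝓘(ℝ, E) p)
    (D (fun q => imPart (Y q)) p : TangentSpace 𝓘(ℝ, E) p →ₗ[ℝ] TangentSpace 𝓘(ℝ, E) p)

/-- The derivative `V[Z]_σ` at `σ` of a curve `σ ↦ Z_σ` of vectors in the fixed complexified
tangent space of `M` at `p`. -/
def paramDeriv (p : M) (Z : S → ℂ ⊗[ℝ] TangentSpace 𝓘(ℝ, E) p) (σ : S) :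
    TangentSpace 𝓘(ℝ, ES) σ →ₗ[ℝ] ℂ ⊗[ℝ] TangentSpace 𝓘(ℝ, E) p :=
  ofReIm (V := TangentSpace 𝓘(ℝ, E) p)
    (mvfderiv 𝓘(ℝ, ES) (fun τ => (rePart (Z τ) : E)) σ : TangentSpace 𝓘(ℝ, ES) σ →ₗ[ℝ] E)
    (mvfderiv 𝓘(ℝ, ES) (fun τ => (imPart (Z τ) : E)) σ : TangentSpace 𝓘(ℝ, ES) σ →ₗ[ℝ] E)

/-- The connection `∇̂^T` in `T → S × M`: along `M` it is the Levi-Civita connection of `g_σ`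
(which preserves `T_σ` in the Kähler case, so that the projection has no effect there), and along
`S` it is `π^{1,0} V[Y_p]`. -/
def CompatibleFamily.holConn (F : CompatibleFamily Ω ES S) (Y : Π x, F.T x) (x : S × M) :
    TangentSpace (𝓘(ℝ, ES).prod 𝓘(ℝ, E)) x →ₗ[ℝ] F.T x :=
  (F.proj x).restrictScalars ℝ ∘ₗ
    (complexifiedConn (leviCivita (F.metric x.1)) (fun p => (Y (x.1, p)).1) x.2 ∘ₗ
        (mfderiv (𝓘(ℝ, ES).prod 𝓘(ℝ, E)) 𝓘(ℝ, E) Prod.snd x :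
          TangentSpace (𝓘(ℝ, ES).prod 𝓘(ℝ, E)) x →ₗ[ℝ] TangentSpace 𝓘(ℝ, E) x.2) +
      paramDeriv x.2 (fun σ => (Y (σ, x.2)).1) x.1 ∘ₗ
        (mfderiv (𝓘(ℝ, ES).prod 𝓘(ℝ, E)) 𝓘(ℝ, ES) Prod.fst x :
          TangentSpace (𝓘(ℝ, ES).prod 𝓘(ℝ, E)) x →ₗ[ℝ] TangentSpace 𝓘(ℝ, ES) x.1))

/-! ### The canonical bundle `K = ⋀^m T^*` and the half-form bundle -/

/-- The fibre at `x` of the canonical bundle `K = ⋀^m T^*`, for `dim M = 2m`. -/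
abbrev CompatibleFamily.K (F : CompatibleFamily Ω ES S) (m : ℕ) (x : S × M) : Type _ :=
  F.T x [⋀^Fin m]→ₗ[ℂ] ℂ

/-- A smooth local extension to a section of `T` of a vector at `x`. -/
def CompatibleFamily.holExtend (F : CompatibleFamily Ω ES S) (x : S × M) (z : F.T x) :
    Π y, F.T y := fun y =>
  F.proj y ((1 : ℂ) ⊗ₜ[ℝ] FiberBundle.extend E (rePart z.1) y.2 +
    Complex.I ⊗ₜ[ℝ] FiberBundle.extend E (imPart z.1) y.2)

/-- A basis of `T` at `x`. -/
def CompatibleFamily.holBasis (F : CompatibleFamily Ω ES S) {m : ℕ} (hm : finrank ℝ E = 2 * m)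
    (x : S × M) : Basis (Fin m) ℂ (F.T x) :=
  haveI : Module.Finite ℂ (ℂ ⊗[ℝ] TangentSpace 𝓘(ℝ, E) x.2) := inferInstance
  Module.finBasisOfFinrankEq ℂ (F.T x) (finrank_holSubspace _ (F.sq x) hm)

/-- The connection `∇̂^K` in `K = ⋀^m T^*` induced by `∇̂^T`: the form `∇_v κ` has the value
`v[κ(Y₁, …, Y_m)] - ∑ᵢ κ(Y₁, …, ∇_v Yᵢ, …, Y_m)` on a frame `Y₁, …, Y_m` of `T` around `x`. -/
def CompatibleFamily.canonicalConn (F : CompatibleFamily Ω ES S) {m : ℕ}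
    (hm : finrank ℝ E = 2 * m) (κ : Π x, F.K m x) (x : S × M) :
    TangentSpace (𝓘(ℝ, ES).prod 𝓘(ℝ, E)) x →ₗ[ℝ] F.K m x :=
  (LinearMap.toSpanSingleton ℂ (F.K m x) (F.holBasis hm x).det).restrictScalars ℝ ∘ₗ
    ((mvfderiv (𝓘(ℝ, ES).prod 𝓘(ℝ, E))
        (fun y => κ y fun i => F.holExtend x (F.holBasis hm x i) y) x :
        TangentSpace (𝓘(ℝ, ES).prod 𝓘(ℝ, E)) x →ₗ[ℝ] ℂ) -
      ∑ i, ((κ x).toMultilinearMap.toLinearMap (F.holBasis hm x) i).restrictScalars ℝ ∘ₗ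
        F.holConn (F.holExtend x (F.holBasis hm x i)) x)

/-- A smooth square root of the canonical bundle `K → S × M`: a smooth isomorphism `δ ⊗ δ ≅ K`. -/
structure SquareRoot (F : CompatibleFamily Ω ES S) (m : ℕ)
    (δ : S × M → Type*) [∀ x, AddCommGroup (δ x)] [∀ x, Module ℂ (δ x)]
    [∀ x, TopologicalSpace (δ x)] [TopologicalSpace (TotalSpace ℂ δ)]
    [FiberBundle ℂ δ] [VectorBundle ℂ ℂ δ] [VectorBundle ℝ ℂ δ]
    [ContMDiffVectorBundle ∞ ℂ δ (𝓘(ℝ, ES).prod 𝓘(ℝ, E))] where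
  /-- The isomorphism on fibres. -/
  iso (x : S × M) : δ x ⊗[ℂ] δ x ≃ₗ[ℂ] F.K m x
  contMDiff (x : S × M) (s t : Π y, δ y) (Y : Fin m → Π y, F.T y) :
    ContMDiffAt (𝓘(ℝ, ES).prod 𝓘(ℝ, E)) ((𝓘(ℝ, ES).prod 𝓘(ℝ, E)).prod 𝓘(ℝ, ℂ)) ∞
      (fun y => TotalSpace.mk' ℂ y (s y)) x →
    ContMDiffAt (𝓘(ℝ, ES).prod 𝓘(ℝ, E)) ((𝓘(ℝ, ES).prod 𝓘(ℝ, E)).prod 𝓘(ℝ, ℂ)) ∞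
      (fun y => TotalSpace.mk' ℂ y (t y)) x →
    (∀ i, F.SmoothAt (Y i) x) →
    ContMDiffAt (𝓘(ℝ, ES).prod 𝓘(ℝ, E)) 𝓘(ℝ, ℂ) ∞
      (fun y => iso y (s y ⊗ₜ[ℂ] t y) fun i => Y i y) x

variable {F : CompatibleFamily Ω ES S} {m : ℕ}

/-- The one-form `θ` at `x` with `∇̂^δ e = θ e` for the local frame `e` of `δ` around `x`. As
`∇̂^K (e ⊗ e) = 2 θ (e ⊗ e)`, it is half the coordinate of `∇̂^K (e ⊗ e)` in the frame `e ⊗ e`. -/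
def SquareRoot.connForm (Q : SquareRoot F m δ) (hm : finrank ℝ E = 2 * m) (x : S × M) :
    TangentSpace (𝓘(ℝ, ES).prod 𝓘(ℝ, E)) x →ₗ[ℝ] ℂ :=
  (1 / 2 : ℝ) • ((TensorProduct.lift
      ((LinearMap.mul ℂ ℂ).compl₁₂ (lineCoord δ x x) (lineCoord δ x x)) ∘ₗ
        (Q.iso x).symm.toLinearMap).restrictScalars ℝ ∘ₗ
    F.canonicalConn hm (fun y => Q.iso y (lineFrame δ x y ⊗ₜ[ℂ] lineFrame δ x y)) x)

theorem mdifferentiableAt_lineCoord {s : Π x, δ x} {x : S × M}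
    (hs : MDifferentiableAt (𝓘(ℝ, ES).prod 𝓘(ℝ, E)) ((𝓘(ℝ, ES).prod 𝓘(ℝ, E)).prod 𝓘(ℝ, ℂ))
      (fun y => TotalSpace.mk' ℂ y (s y)) x) :
    MDifferentiableAt (𝓘(ℝ, ES).prod 𝓘(ℝ, E)) 𝓘(ℝ, ℂ) (fun y => lineCoord δ x y (s y)) x := by
  have h := ((mdifferentiableAt_totalSpace (𝓘(ℝ, ES).prod 𝓘(ℝ, E)) _).1 hs).2
  refine h.congr_of_eventuallyEq ?_
  filter_upwards [(trivializationAt ℂ δ x).open_baseSet.mem_nhds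
    (FiberBundle.mem_baseSet_trivializationAt' x)] with y hy
  simp [lineCoord, Trivialization.linearMapAt_apply, hy]

/-- The connection `∇̂^δ` in `δ` induced by `∇̂^K`: for a section `s = f e`, with `e` a local frame
around `x`, it is `∇̂^δ s = df e + f ∇̂^δ e`. -/
def SquareRoot.conn (Q : SquareRoot F m δ) (hm : finrank ℝ E = 2 * m) :
    CovariantDerivative (𝓘(ℝ, ES).prod 𝓘(ℝ, E)) ℂ δ where
  toFun s x :=
    haveI : FiniteDimensional ℝ (TangentSpace (𝓘(ℝ, ES).prod 𝓘(ℝ, E)) x) :=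
      inferInstanceAs (FiniteDimensional ℝ (ES × E))
    haveI : T2Space (TangentSpace (𝓘(ℝ, ES).prod 𝓘(ℝ, E)) x) := inferInstanceAs (T2Space (ES × E))
    (VectorBundle.continuousLinearEquivAt ℝ ℂ δ x).symm.toContinuousLinearMap ∘L
      (mvfderiv (𝓘(ℝ, ES).prod 𝓘(ℝ, E)) (fun y => lineCoord δ x y (s y)) x +
        lineCoord δ x x (s x) • LinearMap.toContinuousLinearMap (Q.connForm hm x))
  isCovariantDerivativeOnUniv := by
    constructor
    · intro s t x hs ht _
      have h := mvfderiv_add (mdifferentiableAt_lineCoord hs) (mdifferentiableAt_lineCoord ht)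
      have e : (fun y => lineCoord δ x y ((s + t) y)) =
          (fun y => lineCoord δ x y (s y)) + fun y => lineCoord δ x y (t y) := by
        ext y; simp
      rw [e, h, ← ContinuousLinearMap.comp_add]
      congr 1
      ext v
      simp [add_mul]
      ring
    · intro s g x hs hg _
      have h := mvfderiv_smul hg (mdifferentiableAt_lineCoord hs)
      have e : (fun y => lineCoord δ x y ((g • s) y)) =
          g • fun y => lineCoord δ x y (s y) := by
        ext y
        simp [← Complex.coe_smul]
      have e' : s x = (VectorBundle.continuousLinearEquivAt ℝ ℂ δ x).symm
          (lineCoord δ x x (s x)) := by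
        rw [ContinuousLinearEquiv.eq_symm_apply]
        simp [lineCoord, Trivialization.linearMapAt_apply,
          FiberBundle.mem_baseSet_trivializationAt']
      have e'' : lineCoord δ x x ((g • s) x) = g x • lineCoord δ x x (s x) := congrFun e x
      rw [e, h, e'']
      ext v
      nth_rewrite 4 [e']
      simp only [ContinuousLinearMap.comp_apply, add_apply, smul_apply,
        ContinuousLinearMap.smulRight_apply, ContinuousLinearEquiv.coe_coe, ← map_smul, ← map_add]
      congr 1
      simp
      ring

/-! ### The reference connection -/

/-- The pullback connection `∇̂^L` in `L̂ = π_M^* L`: the connection of `L` along `M`, and the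
trivial connection along `S` (where `s_p` takes values in the fixed vector space `L_p`). -/
def pullbackConn (D : CovariantDerivative 𝓘(ℝ, E) ℂ L) (s : Π x : S × M, L x.2) (x : S × M) :
    TangentSpace (𝓘(ℝ, ES).prod 𝓘(ℝ, E)) x →L[ℝ] L x.2 :=
  D (fun p => s (x.1, p)) x.2 ∘L mfderiv (𝓘(ℝ, ES).prod 𝓘(ℝ, E)) 𝓘(ℝ, E) Prod.snd x +
    (VectorBundle.continuousLinearEquivAt ℝ ℂ L x.2).symm.toContinuousLinearMap ∘L
      mvfderiv 𝓘(ℝ, ES) (fun σ => lineCoord L x.2 x.2 (s (σ, x.2))) x.1 ∘L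
        mfderiv (𝓘(ℝ, ES).prod 𝓘(ℝ, E)) 𝓘(ℝ, ES) Prod.fst x

/-- The fibre at `x` of the line bundle `L̂^k ⊗ δ → S × M`. -/
abbrev Twisted (L : M → Type*) [∀ p, AddCommGroup (L p)] [∀ p, Module ℂ (L p)]
    (δ : S × M → Type*) [∀ x, AddCommGroup (δ x)] [∀ x, Module ℂ (δ x)] (k : ℕ) (x : S × M) :
    Type _ :=
  (⨂[ℂ] _ : Fin k, L x.2) ⊗[ℂ] δ x

/-- The coordinate of `L̂^k ⊗ δ` with respect to the frame `(e ⊗ ⋯ ⊗ e) ⊗ f`, where `e` and `f` are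
the local frames of `L` and `δ` around `x₀`. -/
def twistedCoord (L : M → Type*) [∀ p, AddCommGroup (L p)] [∀ p, Module ℂ (L p)]
    [∀ p, TopologicalSpace (L p)] [TopologicalSpace (TotalSpace ℂ L)] [FiberBundle ℂ L]
    [VectorBundle ℂ ℂ L] (δ : S × M → Type*) [∀ x, AddCommGroup (δ x)] [∀ x, Module ℂ (δ x)]
    [∀ x, TopologicalSpace (δ x)] [TopologicalSpace (TotalSpace ℂ δ)]
    [FiberBundle ℂ δ] [VectorBundle ℂ ℂ δ] (k : ℕ) (x₀ x : S × M) : Twisted L δ k x →ₗ[ℂ] ℂ :=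
  TensorProduct.lift ((LinearMap.mul ℂ ℂ).compl₁₂
    (PiTensorProduct.lift ((MultilinearMap.mkPiAlgebra ℂ (Fin k) ℂ).compLinearMap
      fun _ => lineCoord L x₀.2 x.2))
    (lineCoord δ x₀ x))

/-- Smoothness at `x` of a section of `L̂^k ⊗ δ`. -/
def TwistedSmoothAt (ES E : Type*) [NormedAddCommGroup E] [NormedSpace ℝ E]
    [NormedAddCommGroup ES] [NormedSpace ℝ ES]
    {M : Type*} [TopologicalSpace M] [ChartedSpace E M]
    {S : Type*} [TopologicalSpace S] [ChartedSpace ES S]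
    {L : M → Type*} [∀ p, AddCommGroup (L p)] [∀ p, Module ℂ (L p)]
    [∀ p, TopologicalSpace (L p)] [TopologicalSpace (TotalSpace ℂ L)] [FiberBundle ℂ L]
    [VectorBundle ℂ ℂ L] {δ : S × M → Type*} [∀ x, AddCommGroup (δ x)] [∀ x, Module ℂ (δ x)]
    [∀ x, TopologicalSpace (δ x)] [TopologicalSpace (TotalSpace ℂ δ)]
    [FiberBundle ℂ δ] [VectorBundle ℂ ℂ δ] {k : ℕ}
    (s : Π x, Twisted L δ k x) (x : S × M) : Prop :=
  ContMDiffAt (𝓘(ℝ, ES).prod 𝓘(ℝ, E)) 𝓘(ℝ, ℂ) ∞ (fun y => twistedCoord L δ k x y (s y)) x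

/-- The reference connection `∇̂^r = (∇̂^L)^{⊗ k} ⊗ 1 + 1 ⊗ ∇̂^δ` in `L̂^k ⊗ δ`. A section is
written as `s = h (e ⊗ ⋯ ⊗ e) ⊗ f` with local frames `e` of `L` and `f` of `δ` around `x`, and
`∇̂^r_v s` is computed by the Leibniz rule. -/
def referenceConn (P : PrequantumStructure Ω L) (Q : SquareRoot F m δ) (hm : finrank ℝ E = 2 * m)
    (k : ℕ) (s : Π x, Twisted L δ k x) (x : S × M)
    (v : TangentSpace (𝓘(ℝ, ES).prod 𝓘(ℝ, E)) x) : Twisted L δ k x :=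
  let e : Π y : S × M, L y.2 := fun y => lineFrame L x.2 y.2
  let f : Π y, δ y := lineFrame δ x
  mvfderiv (𝓘(ℝ, ES).prod 𝓘(ℝ, E)) (fun y => twistedCoord L δ k x y (s y)) x v •
      ((⨂ₜ[ℂ] _ : Fin k, e x) ⊗ₜ[ℂ] f x) +
    twistedCoord L δ k x x (s x) •
      ((∑ j : Fin k, PiTensorProduct.tprod ℂ
          (Function.update (fun _ => e x) j (pullbackConn P.conn e x v))) ⊗ₜ[ℂ] f x +
        (⨂ₜ[ℂ] _ : Fin k, e x) ⊗ₜ[ℂ] Q.conn hm f x v)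

/-! ### The variation of the complex structure -/

/-- The isomorphism `(Id ⊗ i_B) : V ⊗ V ≃ V ⊗ V^* = End V`, where `i_B(b) = B(b, ·)`. It sends
`a ⊗ b` to the endomorphism `v ↦ B(b, v) a`. -/
def contractRight {V : Type*} [AddCommGroup V] [Module ℝ V] [TopologicalSpace V]
    [FiniteDimensional ℝ V] (B : V →L[ℝ] V →L[ℝ] ℝ) (hB : ∀ v, (∀ w, B v w = 0) → v = 0) :
    V ⊗[ℝ] V ≃ₗ[ℝ] V →ₗ[ℝ] V :=
  TensorProduct.comm ℝ V V ≪≫ₗ TensorProduct.congr (flat B hB) (LinearEquiv.refl ℝ V) ≪≫ₗ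
    dualTensorHomEquiv ℝ V V

theorem contractRight_tmul {V : Type*} [AddCommGroup V] [Module ℝ V] [TopologicalSpace V]
    [FiniteDimensional ℝ V] (B : V →L[ℝ] V →L[ℝ] ℝ) (hB : ∀ v, (∀ w, B v w = 0) → v = 0)
    (a b v : V) : contractRight B hB (a ⊗ₜ b) v = B b v • a := by
  simp [contractRight, flat]

/-- The derivative `V[J]` of the family `J` at `x = (σ, p)` along `v ∈ T_σ S`, an endomorphism of
`T_p M`. -/
def CompatibleFamily.variation (F : CompatibleFamily Ω ES S) (x : S × M)
    (v : TangentSpace 𝓘(ℝ, ES) x.1) :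
    TangentSpace 𝓘(ℝ, E) x.2 →L[ℝ] TangentSpace 𝓘(ℝ, E) x.2 :=
  mvfderiv 𝓘(ℝ, ES) (F := E →L[ℝ] E) (fun σ => F.J (σ, x.2)) x.1 v

/-- The bivector `G̃(V)` at `x`, defined by `V[J] = (Id ⊗ i_Ω) G̃(V)`. -/
def CompatibleFamily.bivector (F : CompatibleFamily Ω ES S) (x : S × M)
    (v : TangentSpace 𝓘(ℝ, ES) x.1) :
    TangentSpace 𝓘(ℝ, E) x.2 ⊗[ℝ] TangentSpace 𝓘(ℝ, E) x.2 :=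
  (contractRight (Ω.form x.2) (Ω.nondegenerate x.2)).symm
    (F.variation x v : TangentSpace 𝓘(ℝ, E) x.2 →ₗ[ℝ] TangentSpace 𝓘(ℝ, E) x.2)

/-- The connection in `TM ⊗ TM` induced by a connection in `TM`: for `G = ∑ Gⁱʲ eᵢ ⊗ eⱼ` with a
local frame `(eᵢ)` around `p`, it is `∑ dGⁱʲ eᵢ ⊗ eⱼ + Gⁱʲ (∇eᵢ ⊗ eⱼ + eᵢ ⊗ ∇eⱼ)`. -/
def bivectorConn (D : CovariantDerivative 𝓘(ℝ, E) E (TangentSpace 𝓘(ℝ, E) : M → Type _))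
    (G : Π p : M, TangentSpace 𝓘(ℝ, E) p ⊗[ℝ] TangentSpace 𝓘(ℝ, E) p) (p : M) :
    TangentSpace 𝓘(ℝ, E) p →ₗ[ℝ] TangentSpace 𝓘(ℝ, E) p ⊗[ℝ] TangentSpace 𝓘(ℝ, E) p :=
  let t := trivializationAt E (TangentSpace 𝓘(ℝ, E) : M → Type _) p
  let b := Module.finBasis ℝ E
  let e : Fin (finrank ℝ E) → Π q : M, TangentSpace 𝓘(ℝ, E) q := fun i q => t.symm q (b i)
  let c : Fin (finrank ℝ E) → Fin (finrank ℝ E) → M → ℝ := fun i j q =>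
    (b.tensorProduct b).repr
      (TensorProduct.map (t.linearMapAt ℝ q) (t.linearMapAt ℝ q) (G q)) (i, j)
  ∑ i, ∑ j,
    ((mvfderiv 𝓘(ℝ, E) (c i j) p : TangentSpace 𝓘(ℝ, E) p →ₗ[ℝ] ℝ).smulRight (e i p ⊗ₜ[ℝ] e j p) +
      c i j p • ((TensorProduct.mk ℝ _ _).flip (e j p) ∘ₗ
          (D (e i) p : TangentSpace 𝓘(ℝ, E) p →ₗ[ℝ] TangentSpace 𝓘(ℝ, E) p) +
        TensorProduct.mk ℝ _ _ (e i p) ∘ₗ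
          (D (e j) p : TangentSpace 𝓘(ℝ, E) p →ₗ[ℝ] TangentSpace 𝓘(ℝ, E) p)))

/-- `Tr ∇̃(G̃(v)) Ω u` at `p` on `M_σ`, for `v ∈ T_σ S` and `u ∈ T_p M`: the trace of the
endomorphism `z ↦ ((Id ⊗ i_Ω) ∇̃_z G̃(v)) u` of `T_p M`. -/
def CompatibleFamily.traceTerm (F : CompatibleFamily Ω ES S) (x : S × M)
    (v : TangentSpace 𝓘(ℝ, ES) x.1) (u : TangentSpace 𝓘(ℝ, E) x.2) : ℝ :=
  LinearMap.trace ℝ (TangentSpace 𝓘(ℝ, E) x.2)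
    (LinearMap.applyₗ u ∘ₗ (contractRight (Ω.form x.2) (Ω.nondegenerate x.2)).toLinearMap ∘ₗ
      bivectorConn (leviCivita (F.metric x.1)) (fun p => F.bivector (x.1, p) v) x.2)

end Bundles
end
end HalfForm

/-! The statement is local, so everything happens in a product chart around `x`. There the reference
connection is `d + Θ` acting on functions, with `Θ = k α + θ`, where `α` is the connection form of
`L` and `θ` that of `δ`; its curvature is `dΘ`. Since `α` is pulled back from `M`, `dα` does not
pair a direction `v` of `S` with a direction `u` of `M`, and only `dθ(v, u)` remains
(`fderiv_chartReferenceForm`).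

Let `Y` be the coordinate matrix of a local frame of `T` and `Z` its dual coframe, so that `Z Y = 1`
and `Y Z = ϖ = (1 - iJ) / 2`. The connection of `T` is `ϖ (∂ + Γ)`, with `Γ` the Christoffel matrix
in the directions of `M` and zero in those of `S`. The trace of its matrix is `τ = tr Z (∂Y + Γ Y)`.
If `c` is the value of the squared frame of `δ` on the frame of `T`, then `θ = (d log c - τ) / 2`,
hence `dθ = -dτ / 2`.

The form `dτ` is computed by matrix algebra (`fderiv_trace_connection`): `dτ(v, u) = tr ϖ[∂_v ϖ, ∂_u
ϖ] + tr (∂_v ϖ) Γ_u + tr ϖ ∂_v Γ_u`. Parallelism of `J` reads `∂_u J = [J, Γ_u]`; as `∂_v J`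
anticommutes with `J`, the first two terms cancel (`trace_variation`). What is left is `tr (∂_v Γ_u)
/ 2 - (i/2) tr (J ∂_v Γ_u)`. The symplectic form is parallel and does not depend on the parameter,
so `∂_v Γ_u` lies in the symplectic Lie algebra and has trace zero. Therefore `dθ(v, u) = (i/4) tr
(J ∂_v Γ_u)`.

On the other side, contraction with the parallel form `Ω` commutes with the Levi-Civita connection,
so the trace term is the trace of `z ↦ (∇_z ∂_v J) u`. Differentiating `∇J = 0` along `v` gives `∇_z
∂_v J = [J, ∂_v Γ_z]` (`KahlerFamily.matDeriv_variation`). The symmetry of the Christoffel symbols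
and `tr ∂_v Γ = 0` turn the trace into `tr (J ∂_v Γ_u)` as well (`sum_commutator_mulVec`,
`KahlerFamily.traceTerm_eq`).

The connections on `K`, `δ` and `L̂^k ⊗ δ` are defined at each point through a frame attached to
that point. Before a second differentiation they have to be rewritten in one frame valid near `x`;
this is the role of `CompatibleFamily.canonicalConn_holFrame`, `SquareRoot.lineCoord_conn_lineFrame`
and `twistedCoord_referenceConn`. -/

namespace HalfForm
noncomputable section

set_option linter.unusedSectionVars false

/-! ### Entrywise differential calculus of matrix-valued functions, without a norm on matrices. -/

section MatrixCalculus

variable {G : Type*} [NormedAddCommGroup G] [NormedSpace ℝ G]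
  {𝕂 : Type*} [NormedField 𝕂] [NormedAlgebra ℝ 𝕂]
  {α β γ : Type*} [Fintype α] [Fintype β] [Fintype γ]

/-- Entrywise differentiability of a matrix-valued function. -/
def MatDiffAt (A : G → Matrix α β 𝕂) (z : G) : Prop :=
  ∀ i j, DifferentiableAt ℝ (fun y => A y i j) z

/-- Entrywise `C^n` regularity of a matrix-valued function. -/
def MatContDiffAt (n : ℕ∞ω) (A : G → Matrix α β 𝕂) (z : G) : Prop :=
  ∀ i j, ContDiffAt ℝ n (fun y => A y i j) z

/-- The entrywise directional derivative of a matrix-valued function. -/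
def matDeriv (A : G → Matrix α β 𝕂) (z w : G) : Matrix α β 𝕂 :=
  Matrix.of fun i j => fderiv ℝ (fun y => A y i j) z w

omit [Fintype α] [Fintype β] in
theorem MatContDiffAt.matDiffAt {n : ℕ∞ω} {A : G → Matrix α β 𝕂} {z : G}
    (h : MatContDiffAt n A z) (hn : n ≠ 0) : MatDiffAt A z :=
  fun i j => (h i j).differentiableAt hn

omit [Fintype α] [Fintype β] in
theorem MatContDiffAt.congr {n : ℕ∞ω} {A B : G → Matrix α β 𝕂} {z : G} (h : MatContDiffAt n A z)
    (hAB : ∀ᶠ y in 𝓝 z, B y = A y) : MatContDiffAt n B z := fun i j =>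
  (h i j).congr_of_eventuallyEq (hAB.mono fun y hy => by simp [hy])

omit [Fintype α] [Fintype β] in
theorem matDeriv_congr {A B : G → Matrix α β 𝕂} {z : G}
    (hAB : ∀ᶠ y in 𝓝 z, A y = B y) (w : G) : matDeriv A z w = matDeriv B z w := by
  ext i j
  simp only [matDeriv, Matrix.of_apply]
  rw [Filter.EventuallyEq.fderiv_eq]
  exact hAB.mono fun y hy => by simp [hy]

omit [Fintype α] [Fintype β] in
@[simp] theorem matDeriv_const (A : Matrix α β 𝕂) (z w : G) : matDeriv (fun _ => A) z w = 0 := by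
  ext i j
  simp [matDeriv]

omit [Fintype α] [Fintype β] in
theorem matDiffAt_const (A : Matrix α β 𝕂) (z : G) : MatDiffAt (fun _ => A) z :=
  fun _ _ => differentiableAt_const _

omit [Fintype α] [Fintype β] in
theorem matContDiffAt_const {n : ℕ∞ω} (A : Matrix α β 𝕂) (z : G) : MatContDiffAt n (fun _ => A) z :=
  fun _ _ => contDiffAt_const

omit [Fintype α] [Fintype β] in
theorem MatDiffAt.add {A B : G → Matrix α β 𝕂} {z : G} (hA : MatDiffAt A z) (hB : MatDiffAt B z) :
    MatDiffAt (fun y => A y + B y) z := fun i j => (hA i j).add (hB i j)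

omit [Fintype α] [Fintype β] in
theorem matDeriv_add {A B : G → Matrix α β 𝕂} {z : G} (hA : MatDiffAt A z) (hB : MatDiffAt B z)
    (w : G) : matDeriv (fun y => A y + B y) z w = matDeriv A z w + matDeriv B z w := by
  ext i j
  simp only [matDeriv, Matrix.of_apply, Matrix.add_apply]
  rw [fderiv_fun_add (hA i j) (hB i j)]
  rfl

omit [Fintype α] [Fintype β] in
theorem matDeriv_sub {A B : G → Matrix α β 𝕂} {z : G} (hA : MatDiffAt A z) (hB : MatDiffAt B z)
    (w : G) : matDeriv (fun y => A y - B y) z w = matDeriv A z w - matDeriv B z w := by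
  ext i j
  simp only [matDeriv, Matrix.of_apply, Matrix.sub_apply]
  rw [fderiv_fun_sub (hA i j) (hB i j)]
  rfl

omit [Fintype α] [Fintype β] in
theorem matDeriv_smul {A : G → Matrix α β 𝕂} {z : G} (c : 𝕂) (hA : MatDiffAt A z)
    (w : G) : matDeriv (fun y => c • A y) z w = c • matDeriv A z w := by
  ext i j
  simp only [matDeriv, Matrix.of_apply, Matrix.smul_apply, smul_eq_mul]
  rw [fderiv_const_mul (hA i j)]
  rfl

omit [Fintype α] [Fintype β] in
theorem MatDiffAt.const_smul {A : G → Matrix α β 𝕂} {z : G} (c : 𝕂) (hA : MatDiffAt A z) :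
    MatDiffAt (fun y => c • A y) z := fun i j => (hA i j).const_mul c

omit [Fintype α] [Fintype β] in
theorem MatDiffAt.transpose {A : G → Matrix α β 𝕂} {z : G} (hA : MatDiffAt A z) :
    MatDiffAt (fun y => (A y).transpose) z := fun i j => hA j i

omit [Fintype α] [Fintype β] in
theorem matDeriv_transpose {A : G → Matrix α β 𝕂} {z w : G} :
    matDeriv (fun y => (A y).transpose) z w = (matDeriv A z w).transpose := rfl

omit [Fintype α] [Fintype γ] in
theorem MatDiffAt.mul {A : G → Matrix α β 𝕂} {B : G → Matrix β γ 𝕂} {z : G}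
    (hA : MatDiffAt A z) (hB : MatDiffAt B z) : MatDiffAt (fun y => A y * B y) z := fun i j => by
  simp only [Matrix.mul_apply]
  exact DifferentiableAt.fun_sum fun k _ => (hA i k).mul (hB k j)

omit [Fintype α] [Fintype γ] in
theorem MatContDiffAt.mul {n : ℕ∞ω} {A : G → Matrix α β 𝕂} {B : G → Matrix β γ 𝕂} {z : G}
    (hA : MatContDiffAt n A z) (hB : MatContDiffAt n B z) :
    MatContDiffAt n (fun y => A y * B y) z := fun i j => by
  simp only [Matrix.mul_apply]
  exact ContDiffAt.sum fun k _ => (hA i k).mul (hB k j)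

omit [Fintype α] [Fintype γ] in
theorem matDeriv_mul {A : G → Matrix α β 𝕂} {B : G → Matrix β γ 𝕂} {z : G}
    (hA : MatDiffAt A z) (hB : MatDiffAt B z) (w : G) :
    matDeriv (fun y => A y * B y) z w = matDeriv A z w * B z + A z * matDeriv B z w := by
  ext i j
  simp only [matDeriv, Matrix.of_apply, Matrix.mul_apply, Matrix.add_apply]
  rw [fderiv_fun_sum (A := fun k y => A y i k * B y k j) fun k _ => (hA i k).mul (hB k j),
    _root_.sum_apply, ← Finset.sum_add_distrib]
  refine Finset.sum_congr rfl fun k _ => ?_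
  rw [fderiv_fun_mul (hA i k) (hB k j)]
  simp only [add_apply, smul_apply, smul_eq_mul]
  ring

omit [Fintype α] [Fintype β] in
theorem MatContDiffAt.matDeriv {m n : ℕ∞ω} {A : G → Matrix α β 𝕂} {z : G}
    (hA : MatContDiffAt n A z) (hmn : m + 1 ≤ n) (w : G) :
    MatContDiffAt m (fun y => matDeriv A y w) z := fun i j =>
  ((hA i j).fderiv_right hmn).clm_apply contDiffAt_const

omit [Fintype α] [Fintype β] in
-- Symmetry of the second derivative of each entry.
theorem matDeriv_comm {A : G → Matrix α β 𝕂} {z : G} (hA : MatContDiffAt 2 A z) (v u : G) :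
    matDeriv (fun y => matDeriv A y u) z v = matDeriv (fun y => matDeriv A y v) z u := by
  have hf : ∀ i j, DifferentiableAt ℝ (fderiv ℝ fun y => A y i j) z := fun i j =>
    ((hA i j).fderiv_right (m := 1) (by norm_num)).differentiableAt one_ne_zero
  ext i j
  simp only [HalfForm.matDeriv, Matrix.of_apply]
  rw [fderiv_clm_apply (hf i j) (differentiableAt_const _),
    fderiv_clm_apply (hf i j) (differentiableAt_const _)]
  simpa using (hA i j).isSymmSndFDerivAt (by simp) v u

theorem differentiableAt_trace {A : G → Matrix α α 𝕂} {z : G} (hA : MatDiffAt A z) :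
    DifferentiableAt ℝ (fun y => (A y).trace) z := by
  simp only [Matrix.trace, Matrix.diag_apply]
  exact DifferentiableAt.fun_sum fun k _ => hA k k

theorem fderiv_trace {A : G → Matrix α α 𝕂} {z : G} (hA : MatDiffAt A z) (w : G) :
    fderiv ℝ (fun y => (A y).trace) z w = (matDeriv A z w).trace := by
  simp only [Matrix.trace, Matrix.diag_apply, matDeriv, Matrix.of_apply]
  rw [fderiv_fun_sum fun k _ => hA k k, _root_.sum_apply]

variable [DecidableEq α]

theorem contDiffAt_det {n : ℕ∞ω} {A : G → Matrix α α 𝕂} {z : G} (hA : MatContDiffAt n A z) :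
    ContDiffAt ℝ n (fun y => (A y).det) z := by
  simp only [Matrix.det_apply']
  exact ContDiffAt.sum fun σ _ => contDiffAt_const.mul (contDiffAt_prod fun i _ => hA _ _)

theorem MatContDiffAt.adjugate {n : ℕ∞ω} {A : G → Matrix α α 𝕂} {z : G}
    (hA : MatContDiffAt n A z) : MatContDiffAt n (fun y => (A y).adjugate) z := fun i j => by
  simp only [Matrix.adjugate_apply]
  refine contDiffAt_det fun k l => ?_
  simp only [Matrix.updateRow_apply]
  split_ifs
  exacts [contDiffAt_const, hA k l]

theorem MatContDiffAt.inv [CompleteSpace 𝕂] {n : ℕ∞ω} {A : G → Matrix α α 𝕂} {z : G}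
    (hA : MatContDiffAt n A z) (h : (A z).det ≠ 0) : MatContDiffAt n (fun y => (A y)⁻¹) z :=
  fun i j => by
    simp only [Matrix.inv_def, Ring.inverse_eq_inv', Matrix.smul_apply, smul_eq_mul]
    exact ((contDiffAt_det hA).inv h).mul (hA.adjugate i j)

/-- Jacobi's formula, from the Leibniz expansion. Differentiating the `i`-th factor of every product
gives the determinant with the `i`-th column replaced by its derivative, which Cramer's rule
identifies with a diagonal entry of the adjugate times the derivative. No invertibility is needed.
-/
theorem hasFDerivAt_det {A : G → Matrix α α 𝕂} {z : G} (hA : MatDiffAt A z) :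
    DifferentiableAt ℝ (fun y => (A y).det) z ∧
      ∀ w, fderiv ℝ (fun y => (A y).det) z w = ((A z).adjugate * matDeriv A z w).trace := by
  have h : HasFDerivAt (fun y => (A y).det)
      (∑ σ : Equiv.Perm α, ((σ.sign : ℤ) : 𝕂) • ∑ i, (∏ j ∈ Finset.univ.erase i, A z (σ j) j) •
        fderiv ℝ (fun y => A y (σ i) i) z) z := by
    simp only [Matrix.det_apply']
    refine HasFDerivAt.fun_sum fun σ _ => HasFDerivAt.const_mul ?_ _
    exact HasFDerivAt.finsetProd fun i _ => (hA (σ i) i).hasFDerivAt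
  refine ⟨h.differentiableAt, fun w => ?_⟩
  rw [h.fderiv]
  have e : ∀ i, ((A z).adjugate * matDeriv A z w) i i =
      ((A z).updateCol i fun k => matDeriv A z w k i).det := fun i => by
    rw [← Matrix.cramer_apply, Matrix.cramer_eq_adjugate_mulVec]
    rfl
  simp only [Matrix.trace, Matrix.diag_apply, e, Matrix.det_apply']
  rw [Finset.sum_comm, _root_.sum_apply]
  refine Finset.sum_congr rfl fun σ _ => ?_
  simp only [smul_apply, _root_.sum_apply, smul_eq_mul,
    Finset.mul_sum]
  refine Finset.sum_congr rfl fun i _ => ?_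
  congr 1
  rw [← Finset.prod_erase_mul _ _ (Finset.mem_univ i)]
  congr 1
  · refine Finset.prod_congr rfl fun j hj => ?_
    simp [Finset.ne_of_mem_erase hj]
  · simp [matDeriv]

end MatrixCalculus

/-! ### Top forms and idempotent matrices. -/

section LinearAlgebra

/-- The derivation induced by an endomorphism acts on top forms by the trace. -/
theorem sum_update_eq_trace_mul {R N : Type*} [CommRing R] [AddCommGroup N] [Module R N] {α : Type*}
    [Fintype α] [DecidableEq α] (g : N [⋀^α]→ₗ[R] R) (v : α → N) (C : Matrix α α R) :
    ∑ i, g (Function.update v i (∑ j, C j i • v j)) = C.trace * g v := by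
  rw [Matrix.trace, Finset.sum_mul]
  refine Finset.sum_congr rfl fun i _ => ?_
  -- Only the diagonal coefficient survives: for `j ≠ i` the vector `v j` occurs twice.
  rw [AlternatingMap.map_update_sum, Finset.sum_eq_single i]
  · rw [AlternatingMap.map_update_smul]
    simp
  · intro j _ hj
    rw [AlternatingMap.map_update_smul, AlternatingMap.map_update_self _ _ hj.symm, smul_zero]
  · simp

/-- Pulled back along `e_i ↦ v i`, the form becomes a top form on the standard module, hence a
multiple of the determinant. -/
theorem alternating_sum_smul {R N : Type*} [CommRing R] [AddCommGroup N] [Module R N] {α : Type*}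
    [Fintype α] [DecidableEq α] (g : N [⋀^α]→ₗ[R] R) (v : α → N) (C : Matrix α α R) :
    g (fun i => ∑ j, C j i • v j) = C.det * g v := by
  have h := AlternatingMap.eq_smul_basis_det (Pi.basisFun R α)
    (g.compLinearMap (Fintype.linearCombination R v))
  have hd : (Matrix.of fun i => C.transpose i).det = C.det := C.det_transpose
  have h1 := DFunLike.congr_fun h (fun i => C.transpose i)
  rw [AlternatingMap.smul_apply, smul_eq_mul, Pi.basisFun_det_apply, hd, mul_comm] at h1
  convert! h1 using 2
  simp

/-- In characteristic zero the trace of an idempotent is its rank. -/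
theorem matrix_eq_zero_of_trace_eq_zero {α : Type*} [Fintype α] [DecidableEq α]
    {A : Matrix α α ℂ} (hA : A * A = A) (h : A.trace = 0) : A = 0 := by
  have h1 : IsIdempotentElem (Matrix.toLin' A) := by
    rw [IsIdempotentElem, Module.End.mul_eq_comp, ← Matrix.toLin'_mul, hA]
  have h2 := (LinearMap.IsIdempotentElem.trace_eq_zero_iff h1).1 (by simpa using h)
  simpa using h2

end LinearAlgebra

/-! ### The matrix computation of the curvature of the determinant of `T`. -/

section Core

variable {G : Type*} [NormedAddCommGroup G] [NormedSpace ℝ G]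
  {ι κ : Type*} [Fintype ι] [Fintype κ] [DecidableEq ι] [DecidableEq κ]

omit [DecidableEq ι] in
-- The left side is `d tr (Z dY)` on two directions, once the second derivatives of `Y` have
-- cancelled; the right side is the curvature trace of the connection `ϖ ∂` in the image of `ϖ`,
-- free of the choice of frame. It holds because `tr ϖ ϖu ϖv` is `tr Zu Yv` plus a term symmetric in
-- the two directions.
theorem trace_bracket_projection {Y Yv Yu : Matrix ι κ ℂ} {Z Zv Zu : Matrix κ ι ℂ}
    {ϖ ϖv ϖu : Matrix ι ι ℂ} (hZY : Z * Y = 1) (hYZ : Y * Z = ϖ)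
    (hv : Zv * Y + Z * Yv = 0) (hu : Zu * Y + Z * Yu = 0)
    (hϖv : ϖv = Yv * Z + Y * Zv) (hϖu : ϖu = Yu * Z + Y * Zu) :
    (Zv * Yu).trace - (Zu * Yv).trace = (ϖ * (ϖv * ϖu - ϖu * ϖv)).trace := by
  have key : ∀ {Yv Yu : Matrix ι κ ℂ} {Zv Zu : Matrix κ ι ℂ} {ϖv ϖu : Matrix ι ι ℂ},
      Zv * Y + Z * Yv = 0 → Zu * Y + Z * Yu = 0 → ϖv = Yv * Z + Y * Zv → ϖu = Yu * Z + Y * Zu →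
      (ϖ * (ϖu * ϖv)).trace = (Zu * Yv).trace + (Z * Yu * (Z * Yv)).trace := by
    intro Yv Yu Zv Zu ϖv ϖu hv hu hϖv hϖu
    have e1 : Z * ϖu = Z * Yu * Z + Zu := by
      rw [hϖu, Matrix.mul_add, ← Matrix.mul_assoc, ← Matrix.mul_assoc, hZY, Matrix.one_mul]
    have e2 : ϖv * Y = Yv + Y * (Zv * Y) := by
      rw [hϖv, Matrix.add_mul, Matrix.mul_assoc, hZY, Matrix.mul_one, Matrix.mul_assoc]
    have e3 : Zv * Y = -(Z * Yv) := eq_neg_of_add_eq_zero_left hv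
    have e4 : Zu * Y = -(Z * Yu) := eq_neg_of_add_eq_zero_left hu
    have e5 : (ϖ * (ϖu * ϖv)).trace = (Z * ϖu * (ϖv * Y)).trace := by
      rw [← hYZ, Matrix.mul_assoc, Matrix.trace_mul_comm Y]
      simp only [Matrix.mul_assoc]
    rw [e5, e1, e2, e3]
    -- The expansion is arranged so that its error terms contain `Z Y - 1` or `Zu Y + Z Yu`, both of
    -- which vanish.
    have e6 : (Z * Yu * Z + Zu) * (Yv + Y * -(Z * Yv)) = Zu * Yv + Z * Yu * (Z * Yv)
        - (Z * Yu) * (Z * Y - 1) * (Z * Yv) - (Zu * Y + Z * Yu) * (Z * Yv) := by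
      simp only [Matrix.mul_add, Matrix.add_mul, Matrix.mul_sub, Matrix.sub_mul, Matrix.mul_neg,
        Matrix.mul_assoc, Matrix.mul_one]
      abel
    rw [e6, hZY, hu]
    simp
  rw [Matrix.mul_sub, Matrix.trace_sub, key hv hu hϖv hϖu, key hu hv hϖu hϖv,
    Matrix.trace_mul_comm (Z * Yu) (Z * Yv)]
  ring

/-- The right side is `tr ϖ Γv` alone, so the claim is that the bracket term cancels `tr ϖv Γ`.
Since `Jv` anticommutes with `J` and `Ju = [J, Γ]`, cyclicity gives `tr J Jv Ju = 2 tr Jv Γ`, and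
the opposite sign for the other order. -/
theorem trace_variation {J Jv Ju Γ Γv : Matrix ι ι ℂ} (hJ : J * J = -1)
    (hJv : Jv * J + J * Jv = 0) (hJu : Ju = J * Γ - Γ * J)
    {ϖ ϖv ϖu : Matrix ι ι ℂ} (hϖ : ϖ = (1 / 2 : ℂ) • (1 - Complex.I • J))
    (hϖv : ϖv = (-(Complex.I / 2)) • Jv) (hϖu : ϖu = (-(Complex.I / 2)) • Ju) :
    (ϖ * (ϖv * ϖu - ϖu * ϖv)).trace + (ϖv * Γ).trace + (ϖ * Γv).trace =
      1 / 2 * Γv.trace - Complex.I / 2 * (J * Γv).trace := by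
  have h0 : (Jv * Ju - Ju * Jv).trace = 0 := by
    rw [Matrix.trace_sub, Matrix.trace_mul_comm, sub_self]
  have hJv' : Jv * J = -(J * Jv) := eq_neg_of_add_eq_zero_left hJv
  have hX : (J * Jv * J * Γ).trace = (Jv * Γ).trace := by
    rw [Matrix.mul_assoc J Jv J, hJv', Matrix.mul_neg, ← Matrix.mul_assoc, hJ]
    simp
  have h1 : (J * (Jv * Ju)).trace = 2 * (Jv * Γ).trace := by
    rw [hJu]
    simp only [Matrix.mul_sub, Matrix.trace_sub, ← Matrix.mul_assoc]
    rw [hX, Matrix.trace_mul_comm _ J]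
    simp only [← Matrix.mul_assoc]
    rw [hJ]
    simp
    ring
  have h2 : (J * (Ju * Jv)).trace = -(2 * (Jv * Γ).trace) := by
    rw [← h1, ← Matrix.mul_assoc, Matrix.trace_mul_comm, ← Matrix.mul_assoc, hJv', Matrix.neg_mul,
      Matrix.trace_neg, Matrix.mul_assoc]
  have h3 : ϖ * (ϖv * ϖu - ϖu * ϖv) =
      (-1 / 8 : ℂ) • ((Jv * Ju - Ju * Jv) - Complex.I • (J * (Jv * Ju) - J * (Ju * Jv))) := by
    rw [hϖ, hϖv, hϖu]
    simp only [Matrix.smul_mul, Matrix.mul_smul, smul_smul, ← smul_sub, Matrix.sub_mul,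
      Matrix.one_mul, Matrix.mul_sub]
    congr 1
    · linear_combination (1 / 8) * Complex.I_sq
    · rw [smul_sub]
      abel
  rw [h3, hϖ, hϖv]
  simp only [Matrix.trace_smul, Matrix.trace_sub, smul_eq_mul, h1, h2, Matrix.smul_mul,
    Matrix.sub_mul, Matrix.one_mul] at h0 ⊢
  rw [h0]
  ring

/-- The exterior derivative of the trace of the connection matrix `Z (∂ Y + Γ Y)` of a connection
`ϖ (∂ + Γ)` in the image of `ϖ = (1 - iJ) / 2`, with frame `Y` and coframe `Z`. -/
theorem fderiv_trace_connection {J : G → Matrix ι ι ℂ} {Γ : G → Matrix ι ι ℂ} {Y : G → Matrix ι κ ℂ}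
    {Z : G → Matrix κ ι ℂ} {z v u : G}
    (hJ : ∀ᶠ y in 𝓝 z, J y * J y = -1) (hZY : ∀ᶠ y in 𝓝 z, Z y * Y y = 1)
    (hYZ : ∀ᶠ y in 𝓝 z, Y y * Z y = (1 / 2 : ℂ) • (1 - Complex.I • J y))
    (hJd : MatDiffAt J z) (hΓd : MatDiffAt Γ z) (hZd : MatDiffAt Z z) (hYd : MatContDiffAt 2 Y z)
    (hpar : matDeriv J z u = J z * Γ z - Γ z * J z) :
    fderiv ℝ (fun y => (Z y * (matDeriv Y y u + Γ y * Y y)).trace) z v -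
      fderiv ℝ (fun y => (Z y * matDeriv Y y v).trace) z u =
    1 / 2 * (matDeriv Γ z v).trace - Complex.I / 2 * (J z * matDeriv Γ z v).trace := by
  have hY1 : MatDiffAt Y z := hYd.matDiffAt two_ne_zero
  have hY2 : ∀ w, MatDiffAt (fun y => matDeriv Y y w) z := fun w =>
    (hYd.matDeriv (m := 1) (by norm_num) w).matDiffAt one_ne_zero
  -- The terms with a second derivative of `Y` will cancel between the two sides of the exterior
  -- derivative.
  have hsymm := matDeriv_comm hYd v u
  have hsq : ∀ w, matDeriv J z w * J z + J z * matDeriv J z w = 0 := fun w => by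
    rw [← matDeriv_mul hJd hJd, matDeriv_congr hJ]
    simp
  have h1 : ∀ w, matDeriv Z z w * Y z + Z z * matDeriv Y z w = 0 := fun w => by
    rw [← matDeriv_mul hZd hY1, matDeriv_congr hZY]
    simp
  have h2 : ∀ w, (-(Complex.I / 2)) • matDeriv J z w =
      matDeriv Y z w * Z z + Y z * matDeriv Z z w := fun w => by
    have e : ∀ y, (1 / 2 : ℂ) • ((1 : Matrix ι ι ℂ) - Complex.I • J y) =
        (1 / 2 : ℂ) • 1 - (Complex.I / 2) • J y := fun y => by
      rw [smul_sub, smul_smul]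
      congr 2
      ring
    rw [← matDeriv_mul hY1 hZd, matDeriv_congr hYZ]
    simp only [e]
    rw [matDeriv_sub (matDiffAt_const _ _) (hJd.const_smul _),
      matDeriv_smul _ hJd]
    simp
  have hΓY := hΓd.mul hY1
  rw [fderiv_trace (hZd.mul ((hY2 u).add hΓY)), fderiv_trace (hZd.mul (hY2 v)),
    matDeriv_mul hZd ((hY2 u).add hΓY), matDeriv_mul hZd (hY2 v), matDeriv_add (hY2 u) hΓY,
    matDeriv_mul hΓd hY1, hsymm]
  have hB := trace_bracket_projection hZY.self_of_nhds hYZ.self_of_nhds (h1 v) (h1 u) (h2 v) (h2 u)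
  have hT := trace_variation hJ.self_of_nhds (hsq v) hpar rfl rfl rfl (Γv := matDeriv Γ z v)
  -- Cyclicity moves `Y` to the front, so that the terms containing `Γ` assemble into `(∂_v Y Z + Y
  -- ∂_v Z) Γ = ∂_v ϖ Γ` and those with its derivative into `ϖ ∂_v Γ`.
  have t1 : (matDeriv Z z v * (Γ z * Y z)).trace = (Y z * matDeriv Z z v * Γ z).trace := by
    rw [← Matrix.mul_assoc, Matrix.trace_mul_comm, Matrix.mul_assoc]
  have t2 : (Z z * (matDeriv Γ z v * Y z)).trace = (Y z * Z z * matDeriv Γ z v).trace := by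
    rw [← Matrix.mul_assoc, Matrix.trace_mul_comm, Matrix.mul_assoc]
  have t3 : (Z z * (Γ z * matDeriv Y z v)).trace = (matDeriv Y z v * Z z * Γ z).trace := by
    rw [← Matrix.mul_assoc, Matrix.trace_mul_comm, Matrix.mul_assoc]
  rw [← hT, ← hB, h2 v, ← hYZ.self_of_nhds]
  simp only [Matrix.mul_add, Matrix.add_mul, Matrix.trace_add, t1, t2, t3]
  ring

end Core

/-! ### Vector fields, derivatives and Lie brackets read in a chart. -/

section Chart

variable {E' : Type*} [NormedAddCommGroup E'] [NormedSpace ℝ E'] {H : Type*} [TopologicalSpace H]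
  (I : ModelWithCorners ℝ E' H) {N : Type*} [TopologicalSpace N] [ChartedSpace H N]

/-- The differential at `y` of the preferred chart around `x₀`. -/
def chartDiff (x₀ y : N) : TangentSpace I y →L[ℝ] E' := mfderiv I 𝓘(ℝ, E') (extChartAt I x₀) y

variable [IsManifold I ∞ N]

theorem minSmoothness_two_le_infty : minSmoothness ℝ 2 ≤ ∞ := by
  rw [minSmoothness_of_isRCLikeNormedField]
  exact WithTop.coe_le_coe.2 (le_top : (2 : ℕ∞) ≤ ⊤)

theorem isManifold_minSmoothness : IsManifold I (minSmoothness ℝ 2) N :=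
  IsManifold.of_le (n := ∞) minSmoothness_two_le_infty

/-- The coordinate vector field in the direction `w` of the preferred chart around `x₀`. -/
def chartFrame (x₀ : N) (w : E') (y : N) : TangentSpace I y :=
  (trivializationAt E' (TangentSpace I : N → Type _) x₀).symmₗ ℝ y w

variable {I} {x₀ y : N}

theorem chartDiff_eq_trivialization (hy : y ∈ (extChartAt I x₀).source) (v : TangentSpace I y) :
    chartDiff I x₀ y v =
      (trivializationAt E' (TangentSpace I : N → Type _) x₀).linearMapAt ℝ y v := by
  rw [extChartAt_source] at hy
  rw [chartDiff, ← TangentBundle.continuousLinearMapAt_trivializationAt hy]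
  rfl

theorem mem_baseSet_of_mem_source (hy : y ∈ (extChartAt I x₀).source) :
    y ∈ (trivializationAt E' (TangentSpace I : N → Type _) x₀).baseSet := by
  rwa [extChartAt_source] at hy

theorem chartDiff_eq_snd (hy : y ∈ (extChartAt I x₀).source) (v : TangentSpace I y) :
    chartDiff I x₀ y v =
      (trivializationAt E' (TangentSpace I : N → Type _) x₀ ⟨y, v⟩).2 := by
  rw [chartDiff_eq_trivialization hy, Trivialization.linearMapAt_apply,
    if_pos (mem_baseSet_of_mem_source hy)]

theorem chartDiff_chartFrame (hy : y ∈ (extChartAt I x₀).source) (w : E') :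
    chartDiff I x₀ y (chartFrame I x₀ w y) = w := by
  have hb := mem_baseSet_of_mem_source hy
  rw [chartDiff_eq_trivialization hy, chartFrame, Trivialization.linearMapAt_symmₗ _ hb]

theorem chartFrame_chartDiff (hy : y ∈ (extChartAt I x₀).source) (v : TangentSpace I y) :
    chartFrame I x₀ (chartDiff I x₀ y v) y = v := by
  have hb := mem_baseSet_of_mem_source hy
  rw [chartDiff_eq_trivialization hy, chartFrame, Trivialization.symmₗ_linearMapAt _ hb]

theorem chartFrame_add (w w' : E') :
    chartFrame I x₀ (w + w') y = chartFrame I x₀ w y + chartFrame I x₀ w' y := by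
  simp only [chartFrame, map_add]

theorem chartFrame_smul (c : ℝ) (w : E') :
    chartFrame I x₀ (c • w) y = c • chartFrame I x₀ w y := by
  simp only [chartFrame, map_smul]

theorem chartFrame_sum {ι : Type*} (s : Finset ι) (w : ι → E') :
    chartFrame I x₀ (∑ i ∈ s, w i) y = ∑ i ∈ s, chartFrame I x₀ (w i) y := by
  simp only [chartFrame, map_sum]

theorem chartDiff_inverse (hy : y ∈ (extChartAt I x₀).source) (w : E') :
    (chartDiff I x₀ y).inverse w = chartFrame I x₀ w y := by
  have h : (chartDiff I x₀ y).IsInvertible := isInvertible_mfderiv_extChartAt hy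
  obtain ⟨e, he⟩ := h
  have h1 := chartDiff_chartFrame hy w
  rw [← he] at h1 ⊢
  rw [ContinuousLinearMap.inverse_equiv]
  exact (e.symm_apply_eq).2 h1.symm

theorem contMDiffAt_chartFrame (hy : y ∈ (extChartAt I x₀).source) (w : E') :
    CMDiffAt ∞ (T% (chartFrame I x₀ w)) y := by
  have hb := mem_baseSet_of_mem_source hy
  rw [Trivialization.contMDiffAt_iff (e := trivializationAt E' (TangentSpace I : N → Type _) x₀)
    ((Trivialization.mem_source _).2 hb)]
  refine ⟨contMDiffAt_id, contMDiffAt_const (c := w) |>.congr_of_eventuallyEq ?_⟩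
  filter_upwards [(isOpen_extChartAt_source (I := I) x₀).mem_nhds hy] with q hq
  rw [← chartDiff_eq_snd hq, chartDiff_chartFrame hq]

theorem mdifferentiableAt_chartFrame (hy : y ∈ (extChartAt I x₀).source) (w : E') :
    MDiffAt (T% (chartFrame I x₀ w)) y :=
  (contMDiffAt_chartFrame hy w).mdifferentiableAt (by simp)

variable {F : Type*} [NormedAddCommGroup F] [NormedSpace ℝ F]

omit [IsManifold I ∞ N] in
theorem mem_source_nhds (hy : y ∈ (extChartAt I x₀).source) : ∀ᶠ q in 𝓝 y,
    q ∈ (extChartAt I x₀).source :=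
  (isOpen_extChartAt_source (I := I) x₀).mem_nhds hy

omit [IsManifold I ∞ N] in
theorem eventually_left_inv (hy : y ∈ (extChartAt I x₀).source) :
    ∀ᶠ q in 𝓝 y, (extChartAt I x₀).symm (extChartAt I x₀ q) = q :=
  (mem_source_nhds hy).mono fun _ hq => (extChartAt I x₀).left_inv hq

variable [I.Boundaryless]

omit [IsManifold I ∞ N] in
theorem eventually_target {z : E'} (hz : z ∈ (extChartAt I x₀).target) :
    ∀ᶠ q in 𝓝 z, q ∈ (extChartAt I x₀).target :=
  (isOpen_extChartAt_target (I := I) x₀).mem_nhds hz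

theorem contMDiffAt_symm {z : E'} (hz : z ∈ (extChartAt I x₀).target) :
    ContMDiffAt 𝓘(ℝ, E') I ∞ (extChartAt I x₀).symm z :=
  (contMDiffOn_extChartAt_symm x₀).contMDiffAt (eventually_target hz)

theorem continuousAt_symm {z : E'} (hz : z ∈ (extChartAt I x₀).target) :
    ContinuousAt (extChartAt I x₀).symm z := (contMDiffAt_symm (I := I) hz).continuousAt

theorem contDiffAt_comp_symm {n : ℕ∞ω} (hn : n ≤ ∞) {f : N → F}
    (hy : y ∈ (extChartAt I x₀).source) (hf : ContMDiffAt I 𝓘(ℝ, F) n f y) :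
    ContDiffAt ℝ n (f ∘ (extChartAt I x₀).symm) (extChartAt I x₀ y) := by
  rw [← contMDiffAt_iff_contDiffAt]
  refine ContMDiffAt.comp _ ?_ ((contMDiffAt_symm ((extChartAt I x₀).map_source hy)).of_le hn)
  rwa [(extChartAt I x₀).left_inv hy]

omit [I.Boundaryless] in
theorem contMDiffAt_of_comp_symm {n : ℕ∞ω} (hn : n ≤ ∞) {f : N → F}
    (hy : y ∈ (extChartAt I x₀).source)
    (hf : ContDiffAt ℝ n (f ∘ (extChartAt I x₀).symm) (extChartAt I x₀ y)) :
    ContMDiffAt I 𝓘(ℝ, F) n f y := by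
  have h : ContMDiffAt I 𝓘(ℝ, E') ∞ (extChartAt I x₀) y :=
    contMDiffAt_extChartAt' (by rwa [extChartAt_source] at hy)
  refine ((contMDiffAt_iff_contDiffAt.2 hf).comp y (h.of_le hn)).congr_of_eventuallyEq ?_
  filter_upwards [eventually_left_inv hy] with q hq
  exact (congrArg f hq).symm

theorem differentiableAt_comp_symm {f : N → F}
    (hy : y ∈ (extChartAt I x₀).source) (hf : MDifferentiableAt I 𝓘(ℝ, F) f y) :
    DifferentiableAt ℝ (f ∘ (extChartAt I x₀).symm) (extChartAt I x₀ y) := by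
  rw [← mdifferentiableAt_iff_differentiableAt]
  refine MDifferentiableAt.comp _ ?_ ((contMDiffAt_symm
    ((extChartAt I x₀).map_source hy)).mdifferentiableAt (by simp))
  rwa [(extChartAt I x₀).left_inv hy]

omit [I.Boundaryless] in
-- Differentiability is assumed of the coordinate expression and transported to the manifold. This
-- suits functions that are known only through a formula valid near one point of the chart.
theorem mvfderiv_eq_fderiv_of_differentiableAt {f : N → F} (hy : y ∈ (extChartAt I x₀).source)
    (hf : DifferentiableAt ℝ (f ∘ (extChartAt I x₀).symm) (extChartAt I x₀ y)) :
    MDifferentiableAt I 𝓘(ℝ, F) f y ∧ ∀ v : TangentSpace I y, mvfderiv I f y v =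
      fderiv ℝ (f ∘ (extChartAt I x₀).symm) (extChartAt I x₀ y) (chartDiff I x₀ y v) := by
  have h : MDifferentiableAt I 𝓘(ℝ, E') (extChartAt I x₀) y :=
    mdifferentiableAt_extChartAt (by rwa [extChartAt_source] at hy)
  have h2 := (hf.hasFDerivAt.hasMFDerivAt.comp y h.hasMFDerivAt).congr_of_eventuallyEq
    (f₁ := f) ((eventually_left_inv hy).mono fun q hq => (congrArg f hq).symm)
  refine ⟨h2.mdifferentiableAt, fun v => ?_⟩
  rw [mvfderiv, ContinuousLinearMap.comp_apply, h2.mfderiv]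
  rfl

theorem mvfderiv_eq_fderiv {f : N → F} (hy : y ∈ (extChartAt I x₀).source)
    (hf : MDifferentiableAt I 𝓘(ℝ, F) f y) (v : TangentSpace I y) : mvfderiv I f y v =
      fderiv ℝ (f ∘ (extChartAt I x₀).symm) (extChartAt I x₀ y) (chartDiff I x₀ y v) :=
  (mvfderiv_eq_fderiv_of_differentiableAt hy (differentiableAt_comp_symm hy hf)).2 v

omit [I.Boundaryless] in
-- Near `y` the coordinate fields are pullbacks of constant fields by the chart, and pullback
-- commutes with brackets.
theorem mlieBracket_chartFrame [CompleteSpace E'] (hy : y ∈ (extChartAt I x₀).source) (w w' : E') :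
    VectorField.mlieBracket I (chartFrame I x₀ w) (chartFrame I x₀ w') y = 0 := by
  have := isManifold_minSmoothness (N := N) I
  have e : ∀ w : E', ∀ᶠ q in 𝓝 y, chartFrame I x₀ w q =
      VectorField.mpullback I 𝓘(ℝ, E') (extChartAt I x₀) (fun _ => w) q := fun w => by
    filter_upwards [mem_source_nhds hy] with q hq
    exact (chartDiff_inverse hq w).symm
  rw [Filter.EventuallyEq.mlieBracket_vectorField_eq (e w) (e w')]
  have h : ContMDiffAt I 𝓘(ℝ, E') ∞ (extChartAt I x₀) y :=
    contMDiffAt_extChartAt' (by rwa [extChartAt_source] at hy)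
  have hc : ∀ w : E', MDifferentiableAt 𝓘(ℝ, E') (𝓘(ℝ, E').prod 𝓘(ℝ, E'))
      (fun q : E' => TotalSpace.mk' E' (E := (TangentSpace 𝓘(ℝ, E') : E' → Type _)) q w)
      (extChartAt I x₀ y) := fun w =>
    (contMDiffAt_vectorSpace_iff_contDiffAt (n := 1)).2 contDiffAt_const |>.mdifferentiableAt
      one_ne_zero
  rw [← VectorField.mpullback_mlieBracket (n := ∞) (hc w) (hc w') h minSmoothness_two_le_infty]
  have h0 : VectorField.mlieBracket 𝓘(ℝ, E') (fun _ : E' => w) (fun _ => w') (extChartAt I x₀ y) =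
      (0 : E') := by
    refine (congrFun VectorField.mlieBracketWithin_univ.symm _).trans
      ((congrFun VectorField.mlieBracketWithin_eq_lieBracketWithin _).trans ?_)
    simp [VectorField.lieBracketWithin]
    rfl
  refine (congrArg (mfderiv I 𝓘(ℝ, E') (extChartAt I x₀) y).inverse h0).trans ?_
  exact map_zero (chartDiff I x₀ y).inverse

/-- A vector field read in the preferred chart around `x₀`. -/
def chartField (I : ModelWithCorners ℝ E' H) (x₀ : N) (V : Π y : N, TangentSpace I y) (z : E') :
    E' :=
  chartDiff I x₀ ((extChartAt I x₀).symm z) (V ((extChartAt I x₀).symm z))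

/-- The bracket on a manifold is defined by pulling both fields back along the inverse chart. Near
the image of `x₀` these pullbacks agree with `chartField`, and without boundary the bracket within
the range of the model is the ordinary one. -/
theorem chartDiff_mlieBracket (V W : Π y : N, TangentSpace I y) :
    chartDiff I x₀ x₀ (VectorField.mlieBracket I V W x₀) =
      VectorField.lieBracket ℝ (chartField I x₀ V) (chartField I x₀ W) (extChartAt I x₀ x₀) := by
  have hx := mem_extChartAt_source (I := I) x₀
  have e : ∀ V : Π y : N, TangentSpace I y, ∀ᶠ z in 𝓝 (extChartAt I x₀ x₀),
      VectorField.mpullbackWithin 𝓘(ℝ, E') I (extChartAt I x₀).symm V (Set.range I) z =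
        chartField I x₀ V z := fun V => by
    filter_upwards [eventually_target ((extChartAt I x₀).map_source hx)] with z hz
    rw [VectorField.mpullbackWithin_apply]
    -- The derivative of the inverse chart is invertible, and `chartDiff` is its inverse.
    obtain ⟨e, he⟩ := isInvertible_mfderivWithin_extChartAt_symm (I := I) hz
    rw [← he, ContinuousLinearMap.inverse_equiv]
    have h1 := congrArg (fun l => l (V ((extChartAt I x₀).symm z)))
      (mfderivWithin_extChartAt_symm_comp_mfderiv_extChartAt (I := I) hz)
    rw [← he] at h1
    exact (e.symm_apply_eq).2 h1.symm
  rw [← VectorField.mlieBracketWithin_univ, VectorField.mlieBracketWithin_apply]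
  refine (congrArg (chartDiff I x₀ x₀) (chartDiff_inverse hx _)).trans ?_
  rw [chartDiff_chartFrame hx, I.range_eq_univ, Set.preimage_univ,
    Set.univ_inter]
  refine (congrFun VectorField.lieBracketWithin_univ _).trans ?_
  have e' := e
  simp only [I.range_eq_univ] at e'
  exact Filter.EventuallyEq.lieBracket_vectorField_eq (e' V) (e' W)

theorem differentiableAt_chartField {V : Π y : N, TangentSpace I y}
    (hV : ContMDiffAt I (I.prod 𝓘(ℝ, E')) ∞
      (fun y => TotalSpace.mk' E' (E := (TangentSpace I : N → Type _)) y (V y)) x₀) :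
    DifferentiableAt ℝ (chartField I x₀ V) (extChartAt I x₀ x₀) := by
  have hx := mem_extChartAt_source (I := I) x₀
  have h := (contMDiffAt_totalSpace.1 hV).2
  have h1 := (contDiffAt_comp_symm le_rfl hx h).differentiableAt (by simp)
  refine h1.congr_of_eventuallyEq ?_
  filter_upwards [eventually_target ((extChartAt I x₀).map_source hx)] with z hz
  rw [chartField, chartDiff_eq_snd ((extChartAt I x₀).map_target hz)]
  rfl

end Chart

/-! ### The exterior derivative of a one-form. -/

section OneForm

variable {G F : Type*} [NormedAddCommGroup G] [NormedSpace ℝ G] [NormedAddCommGroup F]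
  [NormedSpace ℝ F]

/-- The invariant formula for the exterior derivative of a one-form. -/
theorem fderiv_oneForm_lieBracket {η : G → G →L[ℝ] F} {V X : G → G} {z : G}
    (hη : DifferentiableAt ℝ η z) (hV : DifferentiableAt ℝ V z) (hX : DifferentiableAt ℝ X z) :
    fderiv ℝ (fun y => η y (X y)) z (V z) - fderiv ℝ (fun y => η y (V y)) z (X z)
      - η z (VectorField.lieBracket ℝ V X z) =
    fderiv ℝ η z (V z) (X z) - fderiv ℝ η z (X z) (V z) := by
  rw [fderiv_clm_apply hη hX, fderiv_clm_apply hη hV, VectorField.lieBracket, map_sub]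
  simp only [add_apply, ContinuousLinearMap.comp_apply, ContinuousLinearMap.flip_apply]
  abel

end OneForm

/-! ### Partial derivatives on the product `S × M`. -/

section Product

variable {E : Type*} [NormedAddCommGroup E] [NormedSpace ℝ E]
  {M : Type*} [TopologicalSpace M] [ChartedSpace E M]
  {ES : Type*} [NormedAddCommGroup ES] [NormedSpace ℝ ES]
  {S : Type*} [TopologicalSpace S] [ChartedSpace ES S] {x y : S × M}
  {F : Type*} [NormedAddCommGroup F] [NormedSpace ℝ F]

theorem mem_source_prod : y ∈ (extChartAt (𝓘(ℝ, ES).prod 𝓘(ℝ, E)) x).source ↔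
    y.1 ∈ (extChartAt 𝓘(ℝ, ES) x.1).source ∧ y.2 ∈ (extChartAt 𝓘(ℝ, E) x.2).source := by
  rw [extChartAt_prod]
  rfl

theorem extChartAt_prod_apply : extChartAt (𝓘(ℝ, ES).prod 𝓘(ℝ, E)) x y =
    (extChartAt 𝓘(ℝ, ES) x.1 y.1, extChartAt 𝓘(ℝ, E) x.2 y.2) := by
  rw [extChartAt_prod]
  rfl

theorem extChartAt_prod_symm_apply (z : ES × E) :
    (extChartAt (𝓘(ℝ, ES).prod 𝓘(ℝ, E)) x).symm z =
      ((extChartAt 𝓘(ℝ, ES) x.1).symm z.1, (extChartAt 𝓘(ℝ, E) x.2).symm z.2) := by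
  rw [extChartAt_prod]
  rfl

section SliceSnd

variable [IsManifold 𝓘(ℝ, E) ∞ M]

/-- The chart of a product is the product of the charts, so in coordinates freezing the first
variable is precomposition with an affine inclusion. Joint differentiability in the chart therefore
yields both the differentiability of the slice and its derivative. -/
theorem slice_snd (hy : y ∈ (extChartAt (𝓘(ℝ, ES).prod 𝓘(ℝ, E)) x).source) {f : S × M → F}
    (hf : DifferentiableAt ℝ (f ∘ (extChartAt (𝓘(ℝ, ES).prod 𝓘(ℝ, E)) x).symm)
      (extChartAt (𝓘(ℝ, ES).prod 𝓘(ℝ, E)) x y)) :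
    MDifferentiableAt 𝓘(ℝ, E) 𝓘(ℝ, F) (fun p => f (y.1, p)) y.2 ∧
    ∀ u : TangentSpace 𝓘(ℝ, E) y.2, mvfderiv 𝓘(ℝ, E) (fun p => f (y.1, p)) y.2 u =
      fderiv ℝ (f ∘ (extChartAt (𝓘(ℝ, ES).prod 𝓘(ℝ, E)) x).symm)
        (extChartAt (𝓘(ℝ, ES).prod 𝓘(ℝ, E)) x y) (0, chartDiff 𝓘(ℝ, E) x.2 y.2 u) := by
  obtain ⟨h1, h2⟩ := mem_source_prod.1 hy
  have e : (fun p => f (y.1, p)) ∘ (extChartAt 𝓘(ℝ, E) x.2).symm =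
      (f ∘ (extChartAt (𝓘(ℝ, ES).prod 𝓘(ℝ, E)) x).symm) ∘
        fun q => (extChartAt 𝓘(ℝ, ES) x.1 y.1, q) := by
    ext q
    simp only [Function.comp_apply, extChartAt_prod_symm_apply, (extChartAt _ x.1).left_inv h1]
  have h3 : HasFDerivAt ((fun p => f (y.1, p)) ∘ (extChartAt 𝓘(ℝ, E) x.2).symm)
      ((fderiv ℝ (f ∘ (extChartAt (𝓘(ℝ, ES).prod 𝓘(ℝ, E)) x).symm)
        (extChartAt (𝓘(ℝ, ES).prod 𝓘(ℝ, E)) x y)) ∘L ContinuousLinearMap.inr ℝ ES E)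
      (extChartAt 𝓘(ℝ, E) x.2 y.2) := by
    rw [e]
    refine HasFDerivAt.comp _ ?_ (hasFDerivAt_prodMk_right _ _)
    rw [← extChartAt_prod_apply]
    exact hf.hasFDerivAt
  have h4 := mvfderiv_eq_fderiv_of_differentiableAt h2 h3.differentiableAt
  refine ⟨h4.1, fun u => (h4.2 u).trans ?_⟩
  rw [h3.fderiv]
  rfl

end SliceSnd

variable [IsManifold 𝓘(ℝ, ES) ∞ S]

theorem slice_fst (hy : y ∈ (extChartAt (𝓘(ℝ, ES).prod 𝓘(ℝ, E)) x).source) {f : S × M → F}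
    (hf : DifferentiableAt ℝ (f ∘ (extChartAt (𝓘(ℝ, ES).prod 𝓘(ℝ, E)) x).symm)
      (extChartAt (𝓘(ℝ, ES).prod 𝓘(ℝ, E)) x y)) :
    MDifferentiableAt 𝓘(ℝ, ES) 𝓘(ℝ, F) (fun σ => f (σ, y.2)) y.1 ∧
    ∀ u : TangentSpace 𝓘(ℝ, ES) y.1, mvfderiv 𝓘(ℝ, ES) (fun σ => f (σ, y.2)) y.1 u =
      fderiv ℝ (f ∘ (extChartAt (𝓘(ℝ, ES).prod 𝓘(ℝ, E)) x).symm)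
        (extChartAt (𝓘(ℝ, ES).prod 𝓘(ℝ, E)) x y) (chartDiff 𝓘(ℝ, ES) x.1 y.1 u, 0) := by
  obtain ⟨h1, h2⟩ := mem_source_prod.1 hy
  have e : (fun σ => f (σ, y.2)) ∘ (extChartAt 𝓘(ℝ, ES) x.1).symm =
      (f ∘ (extChartAt (𝓘(ℝ, ES).prod 𝓘(ℝ, E)) x).symm) ∘
        fun q => (q, extChartAt 𝓘(ℝ, E) x.2 y.2) := by
    ext q
    simp only [Function.comp_apply, extChartAt_prod_symm_apply, (extChartAt _ x.2).left_inv h2]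
  have h3 : HasFDerivAt ((fun σ => f (σ, y.2)) ∘ (extChartAt 𝓘(ℝ, ES) x.1).symm)
      ((fderiv ℝ (f ∘ (extChartAt (𝓘(ℝ, ES).prod 𝓘(ℝ, E)) x).symm)
        (extChartAt (𝓘(ℝ, ES).prod 𝓘(ℝ, E)) x y)) ∘L ContinuousLinearMap.inl ℝ ES E)
      (extChartAt 𝓘(ℝ, ES) x.1 y.1) := by
    rw [e]
    refine HasFDerivAt.comp _ ?_ (hasFDerivAt_prodMk_left _ _)
    rw [← extChartAt_prod_apply]
    exact hf.hasFDerivAt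
  have h4 := mvfderiv_eq_fderiv_of_differentiableAt h1 h3.differentiableAt
  refine ⟨h4.1, fun u => (h4.2 u).trans ?_⟩
  rw [h3.fderiv]
  rfl

variable [IsManifold 𝓘(ℝ, E) ∞ M]

theorem chartDiff_prod (hy : y ∈ (extChartAt (𝓘(ℝ, ES).prod 𝓘(ℝ, E)) x).source)
    (v : TangentSpace (𝓘(ℝ, ES).prod 𝓘(ℝ, E)) y) :
    chartDiff (𝓘(ℝ, ES).prod 𝓘(ℝ, E)) x y v =
      (chartDiff 𝓘(ℝ, ES) x.1 y.1 (mfderiv (𝓘(ℝ, ES).prod 𝓘(ℝ, E)) 𝓘(ℝ, ES) Prod.fst y v),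
        chartDiff 𝓘(ℝ, E) x.2 y.2 (mfderiv (𝓘(ℝ, ES).prod 𝓘(ℝ, E)) 𝓘(ℝ, E) Prod.snd y v)) := by
  obtain ⟨h1, h2⟩ := mem_source_prod.1 hy
  rw [extChartAt_source] at h1 h2
  have e1 := (mdifferentiableAt_extChartAt (I := 𝓘(ℝ, ES)) h1).hasMFDerivAt.comp y
    (mdifferentiableAt_fst (I := 𝓘(ℝ, ES)) (I' := 𝓘(ℝ, E)) (x := y)).hasMFDerivAt
  have e2 := (mdifferentiableAt_extChartAt (I := 𝓘(ℝ, E)) h2).hasMFDerivAt.comp y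
    (mdifferentiableAt_snd (I := 𝓘(ℝ, ES)) (I' := 𝓘(ℝ, E)) (x := y)).hasMFDerivAt
  have e : (extChartAt (𝓘(ℝ, ES).prod 𝓘(ℝ, E)) x : S × M → ES × E) =
      fun y => ((extChartAt 𝓘(ℝ, ES) x.1 ∘ Prod.fst) y, (extChartAt 𝓘(ℝ, E) x.2 ∘ Prod.snd) y) :=
    funext fun y => extChartAt_prod_apply
  have e3 : HasMFDerivAt (𝓘(ℝ, ES).prod 𝓘(ℝ, E)) 𝓘(ℝ, ES × E)
      (fun y : S × M => ((extChartAt 𝓘(ℝ, ES) x.1 ∘ Prod.fst) y,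
        (extChartAt 𝓘(ℝ, E) x.2 ∘ Prod.snd) y)) y (ContinuousLinearMap.prod _ _) :=
    ⟨e1.1.prodMk e2.1, e1.2.prodMk e2.2⟩
  have e4 := e3.mfderiv
  rw [← e] at e4
  exact DFunLike.congr_fun e4 v

end Product

/-! ### Coordinates of tangent vectors and connection matrices. -/

section Coordinates

variable {E : Type*} [NormedAddCommGroup E] [NormedSpace ℝ E] [FiniteDimensional ℝ E]
  {M : Type*} [TopologicalSpace M] [ChartedSpace E M]

/-- The coordinates of a tangent vector at `p` in the preferred chart around `p₀`. -/
def tangentCoord (p₀ p : M) : TangentSpace 𝓘(ℝ, E) p →ₗ[ℝ] (Fin (finrank ℝ E) → ℝ) :=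
  (finBasis ℝ E).equivFun.toLinearMap ∘ₗ
    (chartDiff 𝓘(ℝ, E) p₀ p : TangentSpace 𝓘(ℝ, E) p →ₗ[ℝ] E)

theorem tangentCoord_apply (p₀ p : M) (v : TangentSpace 𝓘(ℝ, E) p) (i : Fin (finrank ℝ E)) :
    tangentCoord p₀ p v i = (finBasis ℝ E).repr (chartDiff 𝓘(ℝ, E) p₀ p v) i := rfl

variable [IsManifold 𝓘(ℝ, E) ∞ M]

/-- The coordinate vector fields of the preferred chart around `p₀`. -/
def coordFrame (p₀ : M) (i : Fin (finrank ℝ E)) (p : M) : TangentSpace 𝓘(ℝ, E) p :=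
  chartFrame 𝓘(ℝ, E) p₀ (finBasis ℝ E i) p

variable {p₀ p : M}

theorem sum_tangentCoord_smul (hp : p ∈ (extChartAt 𝓘(ℝ, E) p₀).source)
    (v : TangentSpace 𝓘(ℝ, E) p) : ∑ i, tangentCoord p₀ p v i • coordFrame p₀ i p = v := by
  conv_rhs => rw [← chartFrame_chartDiff hp v,
    ← (finBasis ℝ E).sum_repr (chartDiff 𝓘(ℝ, E) p₀ p v)]
  rw [chartFrame_sum]
  simp only [chartFrame_smul]
  rfl

theorem tangentCoord_coordFrame (hp : p ∈ (extChartAt 𝓘(ℝ, E) p₀).source)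
    (i : Fin (finrank ℝ E)) : tangentCoord p₀ p (coordFrame p₀ i p) = Pi.single i 1 := by
  ext j
  rw [tangentCoord_apply, coordFrame, chartDiff_chartFrame hp, Basis.repr_self,
    Finsupp.single_eq_pi_single]

theorem tangentCoord_sum_smul (hp : p ∈ (extChartAt 𝓘(ℝ, E) p₀).source)
    (c : Fin (finrank ℝ E) → ℝ) : tangentCoord p₀ p (∑ i, c i • coordFrame p₀ i p) = c := by
  rw [map_sum]
  simp only [map_smul, tangentCoord_coordFrame hp]
  exact (pi_eq_sum_univ' c).symm

theorem tangentCoord_injective (hp : p ∈ (extChartAt 𝓘(ℝ, E) p₀).source) :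
    Function.Injective (tangentCoord (E := E) p₀ p) := fun v w h => by
  rw [← sum_tangentCoord_smul hp v, h, sum_tangentCoord_smul hp]

section Sections

variable {E' : Type*} [NormedAddCommGroup E'] [NormedSpace ℝ E'] {H : Type*} [TopologicalSpace H]
  {I : ModelWithCorners ℝ E' H} {N : Type*} [TopologicalSpace N] [ChartedSpace H N]

/-- Stated for sections along a map `f`, so that with `f = Prod.snd` it covers sections over `S × M`
of the pullback of the tangent bundle of `M`. -/
theorem contMDiffAt_section_iff {f : N → M} {s : Π y : N, TangentSpace 𝓘(ℝ, E) (f y)} {y : N}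
    (hf : ContMDiffAt I 𝓘(ℝ, E) ∞ f y) (hy : f y ∈ (extChartAt 𝓘(ℝ, E) p₀).source) :
    ContMDiffAt I (𝓘(ℝ, E).prod 𝓘(ℝ, E)) ∞
      (fun y => TotalSpace.mk' E (E := (TangentSpace 𝓘(ℝ, E) : M → Type _)) (f y) (s y)) y ↔
    ∀ i, ContMDiffAt I 𝓘(ℝ, ℝ) ∞ (fun y => tangentCoord p₀ (f y) (s y) i) y := by
  rw [Trivialization.contMDiffAt_iff
    (IB := 𝓘(ℝ, E)) (e := trivializationAt E (TangentSpace 𝓘(ℝ, E) : M → Type _) p₀)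
    ((Trivialization.mem_source _).2 (mem_baseSet_of_mem_source hy))]
  have he : ∀ᶠ q in 𝓝 y, chartDiff 𝓘(ℝ, E) p₀ (f q) (s q) =
      (trivializationAt E (TangentSpace 𝓘(ℝ, E) : M → Type _) p₀
        (TotalSpace.mk' E (f q) (s q))).2 := by
    filter_upwards [hf.continuousAt.eventually (mem_source_nhds (I := 𝓘(ℝ, E)) hy)] with q hq
    exact chartDiff_eq_snd hq _
  constructor
  · rintro ⟨-, h⟩ i
    have h1 := h.congr_of_eventuallyEq he
    exact (LinearMap.toContinuousLinearMap ((finBasis ℝ E).coord i)).contMDiff.contMDiffAt.comp y h1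
  · intro h
    refine ⟨hf, ContMDiffAt.congr_of_eventuallyEq (f := fun q =>
      ∑ i, tangentCoord p₀ (f q) (s q) i • finBasis ℝ E i) ?_ ?_⟩
    · have h2 := ContMDiffAt.sum (t := Finset.univ)
        (f := fun i q => tangentCoord p₀ (f q) (s q) i • finBasis ℝ E i) (x₀ := y) (n := ∞)
        (I' := I) fun i _ => (h i).smul (contMDiffAt_const (I' := 𝓘(ℝ, E)))
      exact h2
    · filter_upwards [he] with q hq
      rw [← hq]
      exact ((finBasis ℝ E).sum_repr _).symm

end Sections

theorem mdifferentiableAt_section_of_coord {Y : Π q : M, TangentSpace 𝓘(ℝ, E) q}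
    (hp : p ∈ (extChartAt 𝓘(ℝ, E) p₀).source)
    (hY : ∀ i, MDifferentiableAt 𝓘(ℝ, E) 𝓘(ℝ, ℝ) (fun q => tangentCoord p₀ q (Y q) i) p) :
    MDiffAt (T% Y) p := by
  have h := MDifferentiableAt.sum_section (s := Finset.univ)
    (t := fun i q => ((fun q => tangentCoord p₀ q (Y q) i) • coordFrame p₀ i) q) fun i _ =>
      (hY i).smul_section (mdifferentiableAt_chartFrame hp (finBasis ℝ E i))
  refine h.congr_of_eventuallyEq ?_
  filter_upwards [mem_source_nhds (I := 𝓘(ℝ, E)) hp] with q hq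
  simp only [Pi.smul_apply']
  rw [sum_tangentCoord_smul hq]

/-- The matrix of the connection form of `D` in the direction `w`, in coordinates around `p₀`. -/
def connMatrix (D : CovariantDerivative 𝓘(ℝ, E) E (TangentSpace 𝓘(ℝ, E) : M → Type _)) (p₀ : M)
    (w : E) (p : M) : Matrix (Fin (finrank ℝ E)) (Fin (finrank ℝ E)) ℝ :=
  Matrix.of fun i j => tangentCoord p₀ p (D (coordFrame p₀ j) p (chartFrame 𝓘(ℝ, E) p₀ w p)) i

theorem connMatrix_add (D : CovariantDerivative 𝓘(ℝ, E) E (TangentSpace 𝓘(ℝ, E) : M → Type _))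
    (w w' : E) : connMatrix D p₀ (w + w') p = connMatrix D p₀ w p + connMatrix D p₀ w' p := by
  ext i j
  simp [connMatrix, chartFrame_add]

theorem connMatrix_smul (D : CovariantDerivative 𝓘(ℝ, E) E (TangentSpace 𝓘(ℝ, E) : M → Type _))
    (c : ℝ) (w : E) : connMatrix D p₀ (c • w) p = c • connMatrix D p₀ w p := by
  ext i j
  simp [connMatrix, chartFrame_smul]

omit [FiniteDimensional ℝ E] in
theorem CovariantDerivative.map_sum
    (D : CovariantDerivative 𝓘(ℝ, E) E (TangentSpace 𝓘(ℝ, E) : M → Type _)) {ι : Type*}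
    (s : Finset ι) (Y : ι → Π q : M, TangentSpace 𝓘(ℝ, E) q) (hY : ∀ i, MDiffAt (T% (Y i)) p) :
    D (fun q => ∑ i ∈ s, Y i q) p = ∑ i ∈ s, D (Y i) p := by
  classical
  induction s using Finset.induction_on with
  | empty =>
    simp only [Finset.sum_empty]
    exact congrFun D.zero p
  | insert i s hi ih =>
    rw [Finset.sum_insert hi, ← ih]
    simp only [Finset.sum_insert hi]
    exact D.isCovariantDerivativeOnUniv.add (hY i) (MDifferentiableAt.sum_section fun i _ => hY i)

/-- A covariant derivative in coordinates. -/
theorem tangentCoord_covariantDerivative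
    (D : CovariantDerivative 𝓘(ℝ, E) E (TangentSpace 𝓘(ℝ, E) : M → Type _))
    {Y : Π q : M, TangentSpace 𝓘(ℝ, E) q} (hp : p ∈ (extChartAt 𝓘(ℝ, E) p₀).source)
    (hY : ∀ i, MDifferentiableAt 𝓘(ℝ, E) 𝓘(ℝ, ℝ) (fun q => tangentCoord p₀ q (Y q) i) p)
    (v : TangentSpace 𝓘(ℝ, E) p) :
    tangentCoord p₀ p (D Y p v) =
      (fun i => mvfderiv 𝓘(ℝ, E) (fun q => tangentCoord p₀ q (Y q) i) p v) +
        (connMatrix D p₀ (chartDiff 𝓘(ℝ, E) p₀ p v) p).mulVec (tangentCoord p₀ p (Y p)) := by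
  have hF : ∀ i, MDiffAt (T% (coordFrame p₀ i : Π q : M, TangentSpace 𝓘(ℝ, E) q)) p := fun i =>
    mdifferentiableAt_chartFrame hp (finBasis ℝ E i)
  have hi : ∀ i, MDiffAt (T% ((fun q => tangentCoord p₀ q (Y q) i) • coordFrame p₀ i)) p :=
    fun i => (hY i).smul_section (hF i)
  -- A covariant derivative is local, so `Y` may be replaced by its expansion in the coordinate
  -- frame, to which the Leibniz rule applies term by term.
  have h : D Y p = D (fun q => ∑ i, ((fun q => tangentCoord p₀ q (Y q) i) • coordFrame p₀ i) q) p :=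
    D.isCovariantDerivativeOnUniv.congr_of_eventuallyEq (mdifferentiableAt_section_of_coord hp hY)
      (MDifferentiableAt.sum_section fun i _ => hi i) Filter.univ_mem <| by
        filter_upwards [mem_source_nhds (I := 𝓘(ℝ, E)) hp] with q hq
        simp only [Pi.smul_apply']
        rw [sum_tangentCoord_smul hq]
  rw [h, CovariantDerivative.map_sum D Finset.univ _ hi]
  have h2 : ∀ i, D ((fun q => tangentCoord p₀ q (Y q) i) • coordFrame p₀ i) p = _ := fun i =>
    D.isCovariantDerivativeOnUniv.leibniz (hF i) (hY i)
  simp only [h2]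
  rw [_root_.sum_apply, map_sum]
  simp only [add_apply, map_add, smul_apply, map_smul, ContinuousLinearMap.smulRight_apply,
    tangentCoord_coordFrame hp]
  rw [Finset.sum_add_distrib, add_comm]
  congr 1
  · exact (pi_eq_sum_univ' _).symm
  · ext i
    simp only [Finset.sum_apply, Pi.smul_apply, smul_eq_mul, Matrix.mulVec, dotProduct, connMatrix,
      Matrix.of_apply]
    rw [chartFrame_chartDiff hp]
    exact Finset.sum_congr rfl fun j _ => mul_comm _ _

end Coordinates

/-! ### The matrices of the symplectic form, the complex structures and the metrics; the Koszul
formula. -/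

section KahlerCoordinates

variable {E : Type*} [NormedAddCommGroup E] [NormedSpace ℝ E] [FiniteDimensional ℝ E]
  {M : Type*} [TopologicalSpace M] [ChartedSpace E M] [IsManifold 𝓘(ℝ, E) ∞ M]
  {ES : Type*} [NormedAddCommGroup ES] [NormedSpace ℝ ES]
  {S : Type*} [TopologicalSpace S] [ChartedSpace ES S]
  {Ω : SymplecticForm E M}

local notation "𝓙" => ModelWithCorners.prod 𝓘(ℝ, ES) 𝓘(ℝ, E)

/-- The matrix of the symplectic form in coordinates around `p₀`. -/
def SymplecticForm.matrix (Ω : SymplecticForm E M) (p₀ p : M) :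
    Matrix (Fin (finrank ℝ E)) (Fin (finrank ℝ E)) ℝ :=
  Matrix.of fun i j => Ω.form p (coordFrame p₀ i p) (coordFrame p₀ j p)

/-- The matrix of the complex structure in coordinates around `p₀`. -/
def CompatibleFamily.jMatrix (F : CompatibleFamily Ω ES S) (p₀ : M) (y : S × M) :
    Matrix (Fin (finrank ℝ E)) (Fin (finrank ℝ E)) ℝ :=
  Matrix.of fun i j => tangentCoord p₀ y.2 (F.J y (coordFrame p₀ j y.2)) i

/-- The matrix of the metric in coordinates around `p₀`. -/
def CompatibleFamily.metricMatrix (F : CompatibleFamily Ω ES S) (p₀ : M) (y : S × M) :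
    Matrix (Fin (finrank ℝ E)) (Fin (finrank ℝ E)) ℝ :=
  Matrix.of fun i j => (F.metric y.1).inner y.2 (coordFrame p₀ i y.2) (coordFrame p₀ j y.2)

/-- The matrix of the Levi-Civita connection form in the direction `w`, in coordinates around
`p₀`. -/
def CompatibleFamily.christoffel (F : CompatibleFamily Ω ES S) (p₀ : M) (w : E) (y : S × M) :
    Matrix (Fin (finrank ℝ E)) (Fin (finrank ℝ E)) ℝ :=
  connMatrix (leviCivita (F.metric y.1)) p₀ w y.2

variable {p₀ : M} {y : S × M} (F : CompatibleFamily Ω ES S)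

theorem SymplecticForm.form_eq_dotProduct {p : M} (hp : p ∈ (extChartAt 𝓘(ℝ, E) p₀).source)
    (v w : TangentSpace 𝓘(ℝ, E) p) : Ω.form p v w =
      tangentCoord p₀ p v ⬝ᵥ (Ω.matrix p₀ p).mulVec (tangentCoord p₀ p w) := by
  conv_lhs => rw [← sum_tangentCoord_smul hp v, ← sum_tangentCoord_smul hp w]
  simp only [map_sum, map_smul, _root_.sum_apply, smul_apply, smul_eq_mul, dotProduct,
    Matrix.mulVec, SymplecticForm.matrix, Matrix.of_apply, Finset.mul_sum]
  rw [Finset.sum_comm]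
  refine Finset.sum_congr rfl fun i _ => Finset.sum_congr rfl fun j _ => by ring

theorem CompatibleFamily.tangentCoord_J (hy : y.2 ∈ (extChartAt 𝓘(ℝ, E) p₀).source)
    (v : TangentSpace 𝓘(ℝ, E) y.2) :
    tangentCoord p₀ y.2 (F.J y v) = (F.jMatrix p₀ y).mulVec (tangentCoord p₀ y.2 v) := by
  conv_lhs => rw [← sum_tangentCoord_smul hy v]
  ext i
  simp only [map_sum, map_smul, Finset.sum_apply, Pi.smul_apply, smul_eq_mul,
    Matrix.mulVec, dotProduct, CompatibleFamily.jMatrix, Matrix.of_apply]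
  exact Finset.sum_congr rfl fun j _ => mul_comm _ _

theorem CompatibleFamily.metricMatrix_eq (hy : y.2 ∈ (extChartAt 𝓘(ℝ, E) p₀).source) :
    F.metricMatrix p₀ y = Ω.matrix p₀ y.2 * F.jMatrix p₀ y := by
  ext i j
  have h : F.metricMatrix p₀ y i j =
      Ω.form y.2 (coordFrame p₀ i y.2) (F.J y (coordFrame p₀ j y.2)) := rfl
  rw [h, SymplecticForm.form_eq_dotProduct hy, F.tangentCoord_J hy, tangentCoord_coordFrame hy,
    tangentCoord_coordFrame hy, Matrix.mulVec_mulVec, single_one_dotProduct]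
  simp

theorem CompatibleFamily.jMatrix_mul_self (hy : y.2 ∈ (extChartAt 𝓘(ℝ, E) p₀).source) :
    F.jMatrix p₀ y * F.jMatrix p₀ y = -1 := by
  ext i j
  have h : tangentCoord p₀ y.2 (F.J y (F.J y (coordFrame p₀ j y.2))) i =
      tangentCoord p₀ y.2 (-(coordFrame p₀ j y.2)) i := by rw [F.sq]
  rw [F.tangentCoord_J hy, F.tangentCoord_J hy, map_neg, tangentCoord_coordFrame hy,
    Matrix.mulVec_mulVec] at h
  simpa [Matrix.one_apply, Pi.single_apply] using h

theorem CompatibleFamily.metricMatrix_symm : (F.metricMatrix p₀ y).transpose = F.metricMatrix p₀ y := by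
  ext i j
  exact (F.metric y.1).symm y.2 _ _

/-- A kernel vector of the matrix would be the coordinates of a nonzero `v` with `Ω(v, J v) = 0`,
against positivity. -/
theorem CompatibleFamily.det_metricMatrix_ne_zero (hy : y.2 ∈ (extChartAt 𝓘(ℝ, E) p₀).source) :
    (F.metricMatrix p₀ y).det ≠ 0 := by
  intro h
  obtain ⟨c, hc, h0⟩ := Matrix.exists_mulVec_eq_zero_iff.2 h
  refine hc ?_
  set v := ∑ i, c i • coordFrame p₀ i y.2 with hv
  have hcv : tangentCoord p₀ y.2 v = c := tangentCoord_sum_smul hy c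
  by_contra hne
  have hv0 : v ≠ 0 := by
    intro h1
    rw [h1, map_zero] at hcv
    exact hne hcv.symm
  have h2 := F.pos y v hv0
  rw [SymplecticForm.form_eq_dotProduct hy, F.tangentCoord_J hy, hcv, Matrix.mulVec_mulVec,
    ← F.metricMatrix_eq hy, h0] at h2
  simp at h2

theorem SymplecticForm.contMDiffAt_matrix {p : M} (hp : p ∈ (extChartAt 𝓘(ℝ, E) p₀).source)
    (i j : Fin (finrank ℝ E)) :
    ContMDiffAt 𝓘(ℝ, E) 𝓘(ℝ, ℝ) ∞ (fun p => Ω.matrix p₀ p i j) p := by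
  have h := ContMDiffAt.clm_bundle_apply₂ (F₁ := E) (F₂ := E) (F₃ := ℝ)
      (E₁ := (TangentSpace 𝓘(ℝ, E) : M → Type _)) (E₂ := (TangentSpace 𝓘(ℝ, E) : M → Type _))
      (E₃ := Bundle.Trivial M ℝ) (b := fun q : M => q) (ψ := Ω.form)
      (Ω.contMDiff p) (contMDiffAt_chartFrame hp (finBasis ℝ E i))
      (contMDiffAt_chartFrame hp (finBasis ℝ E j))
  rw [contMDiffAt_totalSpace] at h
  simpa using! h.2

variable {x : S × M}

theorem CompatibleFamily.contMDiffAt_jMatrix (hy : y.2 ∈ (extChartAt 𝓘(ℝ, E) p₀).source)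
    (i j : Fin (finrank ℝ E)) :
    ContMDiffAt 𝓙 𝓘(ℝ, ℝ) ∞ (fun y => F.jMatrix p₀ y i j) y := by
  have h0 : ContMDiffAt 𝓙 (𝓘(ℝ, E).prod 𝓘(ℝ, E)) ∞ (fun y : S × M => TotalSpace.mk' E
      (E := (TangentSpace 𝓘(ℝ, E) : M → Type _)) y.2 (coordFrame p₀ j y.2)) y :=
    ContMDiffAt.comp y (f := Prod.snd) (contMDiffAt_chartFrame hy (finBasis ℝ E j)) contMDiffAt_snd
  have h := ContMDiffAt.clm_bundle_apply (F₁ := E) (F₂ := E)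
      (E₁ := (TangentSpace 𝓘(ℝ, E) : M → Type _)) (E₂ := (TangentSpace 𝓘(ℝ, E) : M → Type _))
      (b := fun q : S × M => q.2) (ϕ := F.J) (F.contMDiff y) h0
  exact (contMDiffAt_section_iff contMDiffAt_snd hy).1 h i

variable [IsManifold 𝓘(ℝ, ES) ∞ S]

theorem mem_source_of_mem_target {z : ES × E} (hz : z ∈ (extChartAt 𝓙 x).target) :
    ((extChartAt 𝓙 x).symm z).2 ∈ (extChartAt 𝓘(ℝ, E) x.2).source :=
  (mem_source_prod.1 ((extChartAt 𝓙 x).map_target hz)).2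

theorem CompatibleFamily.matContDiffAt_jMatrix {z : ES × E} (hz : z ∈ (extChartAt 𝓙 x).target) :
    MatContDiffAt ∞ (fun z => F.jMatrix x.2 ((extChartAt 𝓙 x).symm z)) z := fun i j => by
  have h := contDiffAt_comp_symm le_rfl ((extChartAt 𝓙 x).map_target hz)
    (F.contMDiffAt_jMatrix (mem_source_of_mem_target hz) i j)
  rwa [(extChartAt 𝓙 x).right_inv hz] at h

theorem SymplecticForm.matContDiffAt_matrix {z : ES × E} (hz : z ∈ (extChartAt 𝓙 x).target) :
    MatContDiffAt ∞ (fun z => Ω.matrix x.2 ((extChartAt 𝓙 x).symm z).2) z := fun i j => by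
  have h := contDiffAt_comp_symm le_rfl ((extChartAt 𝓙 x).map_target hz)
    (f := fun y : S × M => Ω.matrix x.2 y.2 i j)
    ((SymplecticForm.contMDiffAt_matrix (mem_source_of_mem_target hz) i j).comp _ contMDiffAt_snd)
  rwa [(extChartAt 𝓙 x).right_inv hz] at h

theorem CompatibleFamily.matContDiffAt_metricMatrix {z : ES × E}
    (hz : z ∈ (extChartAt 𝓙 x).target) :
    MatContDiffAt ∞ (fun z => F.metricMatrix x.2 ((extChartAt 𝓙 x).symm z)) z :=
  ((SymplecticForm.matContDiffAt_matrix hz).mul (F.matContDiffAt_jMatrix hz)).congr <| by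
    filter_upwards [eventually_target hz] with q hq
    exact F.metricMatrix_eq (mem_source_of_mem_target hq)

/-- The right-hand side of the Koszul formula in coordinates. -/
def koszulMatrix (g : ES × E → Matrix (Fin (finrank ℝ E)) (Fin (finrank ℝ E)) ℝ)
    (a : Fin (finrank ℝ E)) (z : ES × E) : Matrix (Fin (finrank ℝ E)) (Fin (finrank ℝ E)) ℝ :=
  Matrix.of fun c d => 1 / 2 * (matDeriv g z (0, finBasis ℝ E a) c d +
    matDeriv g z (0, finBasis ℝ E c) a d - matDeriv g z (0, finBasis ℝ E d) a c)

omit [FiniteDimensional ℝ E] [IsManifold 𝓘(ℝ, E) ∞ M] [IsManifold 𝓘(ℝ, ES) ∞ S] in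
theorem infty_add_one_le : (∞ : ℕ∞ω) + 1 ≤ ∞ := le_rfl

/-- This is the Koszul formula on coordinate fields, whose brackets vanish: the entry `(c, d)` is
the metric product of `∇_a e_c` with `e_d`. It turns the pointwise defined Levi-Civita derivative
into a linear system for the Christoffel symbols. -/
theorem christoffel_transpose_mul {z : ES × E} (hz : z ∈ (extChartAt 𝓙 x).target)
    (a : Fin (finrank ℝ E)) :
    (F.christoffel x.2 (finBasis ℝ E a) ((extChartAt 𝓙 x).symm z)).transpose *
      F.metricMatrix x.2 ((extChartAt 𝓙 x).symm z) =
    koszulMatrix (fun z => F.metricMatrix x.2 ((extChartAt 𝓙 x).symm z)) a z := by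
  have : CompleteSpace E := FiniteDimensional.complete ℝ E
  have hy := (extChartAt 𝓙 x).map_target hz
  have hy2 := mem_source_of_mem_target hz
  have hr := (extChartAt 𝓙 x).right_inv hz
  set y := (extChartAt 𝓙 x).symm z with hyz
  have hF : ∀ a, MDiffAt (T% (coordFrame x.2 a : Π q : M, TangentSpace 𝓘(ℝ, E) q)) y.2 :=
    fun a => mdifferentiableAt_chartFrame hy2 (finBasis ℝ E a)
  -- The metric is differentiated with the parameter frozen, which in the product chart is a
  -- derivative along `(0, e_a)`.
  have hd : ∀ a c d, mvfderiv 𝓘(ℝ, E) (fun q => (F.metric y.1).inner q (coordFrame x.2 c q)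
      (coordFrame x.2 d q)) y.2 (coordFrame x.2 a y.2) =
      matDeriv (fun z => F.metricMatrix x.2 ((extChartAt 𝓙 x).symm z)) z (0, finBasis ℝ E a) c d := by
    intro a c d
    have h1 := ((F.matContDiffAt_metricMatrix hz) c d).differentiableAt (by simp)
    rw [← hr] at h1
    have h2 := (slice_snd hy (f := fun y => F.metricMatrix x.2 y c d) h1).2 (coordFrame x.2 a y.2)
    rw [hr] at h2
    refine h2.trans ?_
    rw [coordFrame, chartDiff_chartFrame hy2]
    rfl
  ext c d
  have hk := inner_leviCivitaFun (F.metric y.1) (hF a) (hF c) (hF d)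
  have hb : ∀ a c, VectorField.mlieBracket 𝓘(ℝ, E) (coordFrame x.2 a) (coordFrame x.2 c) y.2 = 0 :=
    fun a c => mlieBracket_chartFrame hy2 _ _
  rw [koszul, hb, hb, hb] at hk
  simp only [map_zero, zero_apply, add_zero, sub_zero, hd] at hk
  rw [koszulMatrix, Matrix.of_apply, ← hk]
  rw [← sum_tangentCoord_smul hy2 (leviCivitaFun (F.metric y.1) (coordFrame x.2 c) y.2
    (coordFrame x.2 a y.2))]
  simp only [map_sum, map_smul, _root_.sum_apply, smul_apply, smul_eq_mul]
  rfl

end KahlerCoordinates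

theorem two_le_infty : (2 : ℕ∞ω) ≤ ∞ := WithTop.coe_le_coe.2 (le_top : (2 : ℕ∞) ≤ ⊤)

/-- By the symmetry `hs`, the contraction `∑ a, A a a d` equals `tr (A d) = 0`, which removes the
terms `A a * J`. In the remaining terms the same symmetry exchanges the contracted index with the
index of `w`, producing the trace of `J` times `∑ c, w c • A c`. -/
theorem sum_commutator_mulVec {ι : Type*} [Fintype ι] (J : Matrix ι ι ℝ) (A : ι → Matrix ι ι ℝ)
    (hs : ∀ a i c, A a i c = A c i a) (ht : ∀ a, (A a).trace = 0) (w : ι → ℝ) :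
    ∑ a, ((J * A a - A a * J).mulVec w) a = (J * ∑ c, w c • A c).trace := by
  have h0 : ∀ d, ∑ a, A a a d = 0 := fun d => by
    rw [← ht d]
    exact Finset.sum_congr rfl fun a _ => hs a a d
  have h1 : ∑ a, ((A a * J).mulVec w) a = 0 := by
    simp only [← Matrix.mulVec_mulVec]
    simp only [Matrix.mulVec, dotProduct]
    rw [Finset.sum_comm]
    simp only [← Finset.sum_mul, h0, zero_mul, Finset.sum_const_zero]
  simp only [Matrix.sub_mulVec, Pi.sub_apply, Finset.sum_sub_distrib, h1, sub_zero]
  simp only [← Matrix.mulVec_mulVec]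
  simp only [Matrix.trace, Matrix.diag_apply, Matrix.mul_apply,
    Matrix.mulVec, dotProduct, Matrix.sum_apply, Matrix.smul_apply, smul_eq_mul]
  refine Finset.sum_congr rfl fun a _ => Finset.sum_congr rfl fun d _ => ?_
  congr 1
  exact Finset.sum_congr rfl fun c _ => by rw [hs a d c, mul_comm]

/-! ### Christoffel matrices in families, and the consequences of parallelism. -/

section LeviCivitaCoordinates

variable {E : Type*} [NormedAddCommGroup E] [NormedSpace ℝ E] [FiniteDimensional ℝ E]
  {M : Type*} [TopologicalSpace M] [ChartedSpace E M] [IsManifold 𝓘(ℝ, E) ∞ M]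
  {ES : Type*} [NormedAddCommGroup ES] [NormedSpace ℝ ES]
  {S : Type*} [TopologicalSpace S] [ChartedSpace ES S]
  {Ω : SymplecticForm E M}

local notation "𝓙" => ModelWithCorners.prod 𝓘(ℝ, ES) 𝓘(ℝ, E)

/-- The matrix of the symplectic form in the chart around `x`. -/
def SymplecticForm.chartMatrix (Ω : SymplecticForm E M) (x : S × M) (z : ES × E) :
    Matrix (Fin (finrank ℝ E)) (Fin (finrank ℝ E)) ℝ :=
  Ω.matrix x.2 ((extChartAt 𝓙 x).symm z).2

/-- The matrix of the complex structures in the chart around `x`. -/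
def CompatibleFamily.chartJ (F : CompatibleFamily Ω ES S) (x : S × M) (z : ES × E) :
    Matrix (Fin (finrank ℝ E)) (Fin (finrank ℝ E)) ℝ :=
  F.jMatrix x.2 ((extChartAt 𝓙 x).symm z)

/-- The matrix of the metrics in the chart around `x`. -/
def CompatibleFamily.chartMetric (F : CompatibleFamily Ω ES S) (x : S × M) (z : ES × E) :
    Matrix (Fin (finrank ℝ E)) (Fin (finrank ℝ E)) ℝ :=
  F.metricMatrix x.2 ((extChartAt 𝓙 x).symm z)

/-- The matrix of the Levi-Civita connections in the direction `w`, in the chart around `x`. -/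
def CompatibleFamily.chartChristoffel (F : CompatibleFamily Ω ES S) (x : S × M) (w : E)
    (z : ES × E) : Matrix (Fin (finrank ℝ E)) (Fin (finrank ℝ E)) ℝ :=
  F.christoffel x.2 w ((extChartAt 𝓙 x).symm z)

variable [IsManifold 𝓘(ℝ, ES) ∞ S] {x : S × M} {z : ES × E} (F : CompatibleFamily Ω ES S)

theorem CompatibleFamily.chartChristoffel_eq_sum (w : E) :
    F.chartChristoffel x w z =
      ∑ a, (finBasis ℝ E).repr w a • F.chartChristoffel x (finBasis ℝ E a) z := by
  let l : E →ₗ[ℝ] Matrix (Fin (finrank ℝ E)) (Fin (finrank ℝ E)) ℝ :=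
    { toFun := fun w => F.chartChristoffel x w z
      map_add' := fun w w' => connMatrix_add _ w w'
      map_smul' := fun c w => connMatrix_smul _ c w }
  change l w = ∑ a, (finBasis ℝ E).repr w a • l (finBasis ℝ E a)
  conv_lhs => rw [← (finBasis ℝ E).sum_repr w]
  simp only [map_sum, map_smul]

theorem CompatibleFamily.matContDiffAt_chartJ (hz : z ∈ (extChartAt 𝓙 x).target)
    : MatContDiffAt ∞ (F.chartJ x) z :=
  F.matContDiffAt_jMatrix hz

theorem CompatibleFamily.matContDiffAt_chartMetric (hz : z ∈ (extChartAt 𝓙 x).target)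
    : MatContDiffAt ∞ (F.chartMetric x) z :=
  F.matContDiffAt_metricMatrix hz

theorem SymplecticForm.matContDiffAt_chartMatrix (hz : z ∈ (extChartAt 𝓙 x).target)
    : MatContDiffAt ∞ (Ω.chartMatrix x) z :=
  SymplecticForm.matContDiffAt_matrix hz

theorem CompatibleFamily.chartJ_mul_self (hz : z ∈ (extChartAt 𝓙 x).target)
    : F.chartJ x z * F.chartJ x z = -1 :=
  F.jMatrix_mul_self (mem_source_of_mem_target hz)

theorem CompatibleFamily.chartMatrix_eq (hz : z ∈ (extChartAt 𝓙 x).target) :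
    Ω.chartMatrix x z = -(F.chartMetric x z * F.chartJ x z) := by
  rw [chartMetric, chartJ, F.metricMatrix_eq (mem_source_of_mem_target hz), mul_assoc,
    F.jMatrix_mul_self (mem_source_of_mem_target hz)]
  simp [SymplecticForm.chartMatrix]

theorem CompatibleFamily.chartMetric_symm : (F.chartMetric x z).transpose = F.chartMetric x z :=
  F.metricMatrix_symm

theorem CompatibleFamily.det_chartMetric_ne_zero (hz : z ∈ (extChartAt 𝓙 x).target)
    : (F.chartMetric x z).det ≠ 0 :=
  F.det_metricMatrix_ne_zero (mem_source_of_mem_target hz)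

include F in
theorem CompatibleFamily.det_chartMatrix_ne_zero (hz : z ∈ (extChartAt 𝓙 x).target)
    : (Ω.chartMatrix x z).det ≠ 0 := by
  have h : F.chartMetric x z = Ω.chartMatrix x z * F.chartJ x z :=
    F.metricMatrix_eq (mem_source_of_mem_target hz)
  have h1 := F.det_chartMetric_ne_zero hz
  rw [h, Matrix.det_mul] at h1
  exact left_ne_zero_of_mul h1

theorem CompatibleFamily.transpose_chartChristoffel_mul (hz : z ∈ (extChartAt 𝓙 x).target)
    (a : Fin (finrank ℝ E)) :
    (F.chartChristoffel x (finBasis ℝ E a) z).transpose * F.chartMetric x z =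
      koszulMatrix (F.chartMetric x) a z :=
  christoffel_transpose_mul F hz a

/-- The connections are constructed separately for each parameter, so joint smoothness is not built
in. It comes from solving the Koszul system: the Christoffel matrix is the transpose of the Koszul
matrix times the inverse metric, both jointly smooth. -/
theorem CompatibleFamily.matContDiffAt_chartChristoffel (hz : z ∈ (extChartAt 𝓙 x).target) (w : E) :
    MatContDiffAt ∞ (F.chartChristoffel x w) z := by
  have h : ∀ a, MatContDiffAt ∞ (F.chartChristoffel x (finBasis ℝ E a)) z := by
    intro a
    have hd : ∀ w, MatContDiffAt ∞ (fun z => matDeriv (F.chartMetric x) z w) z := fun w =>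
      (F.matContDiffAt_chartMetric hz).matDeriv infty_add_one_le w
    have hk : MatContDiffAt ∞ (koszulMatrix (F.chartMetric x) a) z := fun c d =>
      contDiffAt_const.mul (((hd (0, finBasis ℝ E a) c d).add (hd (0, finBasis ℝ E c) a d)).sub
        (hd (0, finBasis ℝ E d) a c))
    have h1 := hk.mul ((F.matContDiffAt_chartMetric hz).inv (F.det_chartMetric_ne_zero hz))
    have h2 : MatContDiffAt ∞ (fun z => (koszulMatrix (F.chartMetric x) a z *
        (F.chartMetric x z)⁻¹).transpose) z := fun i j => h1 j i
    refine h2.congr ?_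
    filter_upwards [eventually_target hz] with q hq
    rw [← F.transpose_chartChristoffel_mul hq, Matrix.mul_nonsing_inv_cancel_right _ _
      (F.det_chartMetric_ne_zero hq).isUnit, Matrix.transpose_transpose]
  have h2 : MatContDiffAt ∞ (fun z => ∑ a, (finBasis ℝ E).repr w a •
      F.chartChristoffel x (finBasis ℝ E a) z) z := fun i j => by
    simp only [Matrix.sum_apply, Matrix.smul_apply, smul_eq_mul]
    exact ContDiffAt.sum fun a _ => contDiffAt_const.mul (h a i j)
  exact h2.congr (Filter.Eventually.of_forall fun z => F.chartChristoffel_eq_sum w)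

/-- Absence of torsion: the Koszul expression is symmetric in `a` and `c` because the metric is
symmetric. -/
theorem CompatibleFamily.chartChristoffel_symm (hz : z ∈ (extChartAt 𝓙 x).target)
    (a c i : Fin (finrank ℝ E)) :
    F.chartChristoffel x (finBasis ℝ E a) z i c = F.chartChristoffel x (finBasis ℝ E c) z i a := by
  have hu := (F.det_chartMetric_ne_zero hz).isUnit
  have hs : ∀ w, (matDeriv (F.chartMetric x) z w) a c = (matDeriv (F.chartMetric x) z w) c a := by
    intro w
    have h := matDeriv_transpose (A := F.chartMetric x) (z := z) (w := w)
    simp only [F.chartMetric_symm] at h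
    exact congrFun (congrFun h a) c
  have h1 := F.transpose_chartChristoffel_mul hz a
  have h2 := F.transpose_chartChristoffel_mul hz c
  have h3 : (F.chartChristoffel x (finBasis ℝ E a) z).transpose =
      koszulMatrix (F.chartMetric x) a z * (F.chartMetric x z)⁻¹ := by
    rw [← h1, Matrix.mul_nonsing_inv_cancel_right _ _ hu]
  have h4 : (F.chartChristoffel x (finBasis ℝ E c) z).transpose =
      koszulMatrix (F.chartMetric x) c z * (F.chartMetric x z)⁻¹ := by
    rw [← h2, Matrix.mul_nonsing_inv_cancel_right _ _ hu]
  have h5 := congrFun (congrFun h3 c) i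
  have h6 := congrFun (congrFun h4 a) i
  rw [Matrix.transpose_apply, Matrix.mul_apply] at h5 h6
  rw [h5, h6]
  refine Finset.sum_congr rfl fun d _ => ?_
  congr 1
  simp only [koszulMatrix, Matrix.of_apply, hs]
  ring

/-- Compatibility with the metric: in the sum of the Koszul matrix and its transpose the last two
derivatives cancel and the first doubles. -/
theorem CompatibleFamily.matDeriv_chartMetric (hz : z ∈ (extChartAt 𝓙 x).target)
    (a : Fin (finrank ℝ E)) :
    matDeriv (F.chartMetric x) z (0, finBasis ℝ E a) =
      (F.chartChristoffel x (finBasis ℝ E a) z).transpose * F.chartMetric x z +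
        F.chartMetric x z * F.chartChristoffel x (finBasis ℝ E a) z := by
  have h1 := F.transpose_chartChristoffel_mul hz a
  have h2 := congrArg Matrix.transpose h1
  rw [Matrix.transpose_mul, F.chartMetric_symm, Matrix.transpose_transpose] at h2
  rw [h1, h2]
  have hs : ∀ w c d, (matDeriv (F.chartMetric x) z w) c d =
      (matDeriv (F.chartMetric x) z w) d c := by
    intro w c d
    have h := matDeriv_transpose (A := F.chartMetric x) (z := z) (w := w)
    simp only [F.chartMetric_symm] at h
    exact congrFun (congrFun h c) d
  ext c d
  simp only [koszulMatrix, Matrix.add_apply, Matrix.transpose_apply, Matrix.of_apply]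
  rw [hs _ d c]
  ring

/-- The symplectic form does not depend on the parameter. The identity holds at every `z`, even
outside the chart, so that it can be rewritten under a further derivative. -/
theorem matDeriv_chartMatrix_fst (v : ES) : matDeriv (Ω.chartMatrix x) z (v, 0) = 0 := by
  ext i j
  by_cases hd : DifferentiableAt ℝ (fun z => Ω.chartMatrix x z i j) z
  · have h : HasDerivAt (fun t : ℝ => z + t • (v, (0 : E))) (v, 0) 0 := by
      simpa using ((hasDerivAt_id (0 : ℝ)).smul_const (v, (0 : E))).const_add z
    have h1 := HasFDerivAt.comp_hasDerivAt (0 : ℝ) (f := fun t : ℝ => z + t • (v, (0 : E)))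
      (l := fun z => Ω.chartMatrix x z i j) (by simpa using hd.hasFDerivAt) h
    have h2 : ((fun z => Ω.chartMatrix x z i j) ∘ fun t : ℝ => z + t • (v, (0 : E))) =
        fun _ => Ω.chartMatrix x z i j := by
      ext t
      simp only [SymplecticForm.chartMatrix, extChartAt_prod_symm_apply, Function.comp_apply,
        Prod.snd_add, Prod.smul_mk, smul_zero, add_zero]
    rw [h2] at h1
    simpa [matDeriv] using h1.unique (hasDerivAt_const _ _)
  -- Where the entry is not differentiable, its derivative is zero by convention.
  · simp [matDeriv, fderiv_zero_of_not_differentiableAt hd]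

theorem CompatibleFamily.matDeriv_chartChristoffel (hz : z ∈ (extChartAt 𝓙 x).target) (w : E)
    (v : ES × E) : matDeriv (F.chartChristoffel x w) z v = ∑ a, (finBasis ℝ E).repr w a •
      matDeriv (F.chartChristoffel x (finBasis ℝ E a)) z v := by
  have hΓ := fun w => (F.matContDiffAt_chartChristoffel hz w).matDiffAt (by simp)
  have h1 : ∀ᶠ q in 𝓝 z, F.chartChristoffel x w q =
      ∑ a, (finBasis ℝ E).repr w a • F.chartChristoffel x (finBasis ℝ E a) q :=
    Filter.Eventually.of_forall fun q => F.chartChristoffel_eq_sum w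
  rw [matDeriv_congr h1]
  ext i j
  simp only [matDeriv, Matrix.of_apply, Matrix.sum_apply, Matrix.smul_apply, smul_eq_mul]
  rw [fderiv_fun_sum fun a _ => (hΓ _ i j).const_mul _, _root_.sum_apply]
  refine Finset.sum_congr rfl fun a _ => ?_
  rw [fderiv_const_mul (hΓ _ i j)]
  rfl

section Kahler

variable (F : KahlerFamily Ω ES S)

/-- This is `∇J = 0` evaluated on the coordinate fields: `∇_w (J e_j)` has coordinates `∂_w J + Γ_w
J`, and `J ∇_w e_j` has coordinates `J Γ_w`. -/
theorem KahlerFamily.matDeriv_chartJ (hz : z ∈ (extChartAt 𝓙 x).target) (w : E) :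
    matDeriv (F.chartJ x) z (0, w) =
      F.chartJ x z * F.chartChristoffel x w z - F.chartChristoffel x w z * F.chartJ x z := by
  have hy := (extChartAt 𝓙 x).map_target hz
  have hy2 := mem_source_of_mem_target hz
  have hr := (extChartAt 𝓙 x).right_inv hz
  ext i j
  set y := (extChartAt 𝓙 x).symm z with hyz
  have hd : ∀ i, DifferentiableAt ℝ ((fun y => F.jMatrix x.2 y i j) ∘ (extChartAt 𝓙 x).symm)
      (extChartAt 𝓙 x y) := fun i => by
    rw [hr]
    exact (F.matContDiffAt_chartJ hz i j).differentiableAt (by simp)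
  have h1 := F.parallel y.1 y.2 (coordFrame x.2 j) (chartFrame 𝓘(ℝ, E) x.2 w y.2)
    (contMDiffAt_chartFrame hy2 _)
  have h2 := congrArg (fun v => tangentCoord x.2 y.2 v i) h1
  have h3 := tangentCoord_covariantDerivative (leviCivita (F.metric y.1))
    (Y := fun q => F.J (y.1, q) (coordFrame x.2 j q)) hy2 (fun i => (slice_snd hy (hd i)).1)
    (chartFrame 𝓘(ℝ, E) x.2 w y.2)
  have h4 : tangentCoord x.2 y.2 (F.J y (leviCivita (F.metric y.1) (coordFrame x.2 j) y.2
      (chartFrame 𝓘(ℝ, E) x.2 w y.2))) i = (F.chartJ x z * F.chartChristoffel x w z) i j := by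
    rw [F.tangentCoord_J hy2]
    rfl
  have h5 := congrFun h3 i
  rw [Pi.add_apply, chartDiff_chartFrame hy2] at h5
  have h6 : tangentCoord x.2 y.2 (F.J (y.1, y.2) (coordFrame x.2 j y.2)) =
      fun k => F.chartJ x z k j := rfl
  rw [h6] at h5
  have h7 := (slice_snd hy (hd i)).2 (chartFrame 𝓘(ℝ, E) x.2 w y.2)
  rw [hr, chartDiff_chartFrame hy2] at h7
  have h8 := h5.symm.trans (h2.trans h4)
  rw [Matrix.sub_apply, ← h8]
  have h9 : matDeriv (F.chartJ x) z (0, w) i j =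
      mvfderiv 𝓘(ℝ, E) (fun p => F.jMatrix x.2 (y.1, p) i j) y.2
        (chartFrame 𝓘(ℝ, E) x.2 w y.2) := h7.symm
  rw [h9]
  exact (add_sub_cancel_right _ _).symm

/-- The symplectic form is parallel, because it is `-g J` with `g` and `J` both parallel. -/
theorem KahlerFamily.matDeriv_chartMatrix (hz : z ∈ (extChartAt 𝓙 x).target)
    (a : Fin (finrank ℝ E)) :
    matDeriv (Ω.chartMatrix x) z (0, finBasis ℝ E a) =
      (F.chartChristoffel x (finBasis ℝ E a) z).transpose * Ω.chartMatrix x z +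
        Ω.chartMatrix x z * F.chartChristoffel x (finBasis ℝ E a) z := by
  have hg := (F.matContDiffAt_chartMetric hz).matDiffAt (by simp)
  have hJ := (F.matContDiffAt_chartJ hz).matDiffAt (by simp)
  have h : ∀ᶠ q in 𝓝 z, Ω.chartMatrix x q = (-1 : ℝ) • (F.chartMetric x q * F.chartJ x q) := by
    filter_upwards [eventually_target hz] with q hq
    rw [F.chartMatrix_eq hq, neg_one_smul]
  rw [matDeriv_congr h, matDeriv_smul _ (hg.mul hJ), matDeriv_mul hg hJ, F.matDeriv_chartMetric hz,
    F.matDeriv_chartJ hz, F.chartMatrix_eq hz, neg_one_smul]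
  noncomm_ring

/-- Differentiating the parallelism of `Ω` along the parameter gives `Aᵀ Ω + Ω A = 0` for the
variation `A` of a Christoffel matrix. Thus `A` lies in the symplectic Lie algebra, whose elements
are trace-free. -/
theorem KahlerFamily.trace_matDeriv_chartChristoffel (hz : z ∈ (extChartAt 𝓙 x).target) (v : ES)
    (w : E) : (matDeriv (F.chartChristoffel x w) z (v, 0)).trace = 0 := by
  have hω := SymplecticForm.matContDiffAt_chartMatrix (Ω := Ω) hz
  have hω1 := hω.matDiffAt (by simp)
  have hΓ := fun w => (F.matContDiffAt_chartChristoffel hz w).matDiffAt (by simp)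
  have hb : ∀ a, (matDeriv (F.chartChristoffel x (finBasis ℝ E a)) z (v, 0)).trace = 0 := by
    intro a
    have h1 : ∀ᶠ q in 𝓝 z, matDeriv (Ω.chartMatrix x) q (0, finBasis ℝ E a) =
        (F.chartChristoffel x (finBasis ℝ E a) q).transpose * Ω.chartMatrix x q +
          Ω.chartMatrix x q * F.chartChristoffel x (finBasis ℝ E a) q := by
      filter_upwards [eventually_target hz] with q hq using F.matDeriv_chartMatrix hq a
    -- Exchanging the two derivatives shows that the parameter derivative of `∂_a Ω` is zero, as `Ω`
    -- is constant along `S`.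
    have h2 := matDeriv_comm (fun i j => (hω i j).of_le two_le_infty) (v, 0)
      (0, finBasis ℝ E a)
    simp only [matDeriv_chartMatrix_fst, matDeriv_const] at h2
    rw [matDeriv_congr h1, matDeriv_add ((hΓ _).transpose.mul hω1) (hω1.mul (hΓ _)),
      matDeriv_mul (hΓ _).transpose hω1, matDeriv_mul hω1 (hΓ _), matDeriv_transpose,
      matDeriv_chartMatrix_fst, mul_zero, zero_mul, add_zero, zero_add] at h2
    set A := matDeriv (F.chartChristoffel x (finBasis ℝ E a)) z (v, 0)
    have hu := (F.det_chartMatrix_ne_zero hz).isUnit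
    have h3 : (Ω.chartMatrix x z)⁻¹ * (A.transpose * Ω.chartMatrix x z) + A = 0 := by
      have := congrArg (fun B => (Ω.chartMatrix x z)⁻¹ * B) h2
      simpa [mul_add, Matrix.nonsing_inv_mul_cancel_left _ _ hu] using this
    have h4 := congrArg Matrix.trace h3
    rw [Matrix.trace_add, Matrix.trace_mul_comm, Matrix.mul_nonsing_inv_cancel_right _ _ hu,
      Matrix.trace_transpose, Matrix.trace_zero] at h4
    linarith
  rw [F.matDeriv_chartChristoffel hz, Matrix.trace_sum]
  simp [hb]

/-- The left side is the covariant derivative of the endomorphism `∂_v J`. The identity is `∂_w J =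
J Γ - Γ J` differentiated along `v`, with the mixed second derivative of `J` exchanged. -/
theorem KahlerFamily.matDeriv_variation (hz : z ∈ (extChartAt 𝓙 x).target) (v : ES) (w : E) :
    matDeriv (fun q => matDeriv (F.chartJ x) q (v, 0)) z (0, w) +
      F.chartChristoffel x w z * matDeriv (F.chartJ x) z (v, 0) -
      matDeriv (F.chartJ x) z (v, 0) * F.chartChristoffel x w z =
    F.chartJ x z * matDeriv (F.chartChristoffel x w) z (v, 0) -
      matDeriv (F.chartChristoffel x w) z (v, 0) * F.chartJ x z := by
  have hJ := F.matContDiffAt_chartJ hz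
  have hJ1 := hJ.matDiffAt (by simp)
  have hΓ := (F.matContDiffAt_chartChristoffel hz w).matDiffAt (by simp)
  have h1 : ∀ᶠ q in 𝓝 z, matDeriv (F.chartJ x) q (0, w) =
      F.chartJ x q * F.chartChristoffel x w q - F.chartChristoffel x w q * F.chartJ x q := by
    filter_upwards [eventually_target hz] with q hq using F.matDeriv_chartJ hq w
  rw [← matDeriv_comm (fun i j => (hJ i j).of_le two_le_infty) (v, 0) (0, w),
    matDeriv_congr h1, matDeriv_sub (hJ1.mul hΓ) (hΓ.mul hJ1), matDeriv_mul hJ1 hΓ,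
    matDeriv_mul hΓ hJ1]
  abel

theorem KahlerFamily.sum_variation (hz : z ∈ (extChartAt 𝓙 x).target) (v : ES) (w : E) :
    ∑ a, ((F.chartJ x z * matDeriv (F.chartChristoffel x (finBasis ℝ E a)) z (v, 0) -
      matDeriv (F.chartChristoffel x (finBasis ℝ E a)) z (v, 0) * F.chartJ x z).mulVec
        ((finBasis ℝ E).repr w)) a =
    (F.chartJ x z * matDeriv (F.chartChristoffel x w) z (v, 0)).trace := by
  rw [F.matDeriv_chartChristoffel hz w]
  refine sum_commutator_mulVec _ _ (fun a i c => ?_)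
    (fun a => F.trace_matDeriv_chartChristoffel hz v _) _
  simp only [matDeriv, Matrix.of_apply]
  rw [Filter.EventuallyEq.fderiv_eq]
  filter_upwards [eventually_target hz] with q hq using F.chartChristoffel_symm hq a c i

end Kahler

end LeviCivitaCoordinates

/-- Index bookkeeping for the Leibniz rule on `∑ C i j (e_i ⊗ e_j)`, contracted in the second factor
with the covector `U`: the connection matrix `A` acts on the first index from the left and on the
second through its transpose. -/
theorem sum_tensor_derivative {ι : Type*} [Fintype ι] [DecidableEq ι] (D C A : Matrix ι ι ℝ)
    (U : ι → ℝ) (k : ι) :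
    ∑ i, ∑ j, D i j * (U j * (Pi.single i 1 : ι → ℝ) k) +
      (∑ i, ∑ j, C i j * (U j * A k i) +
        ∑ i, ∑ j, C i j * ((fun l => A l j) ⬝ᵥ U * (Pi.single i 1 : ι → ℝ) k)) =
    D.mulVec U k + (A * C).mulVec U k + (C * A.transpose).mulVec U k := by
  have h : ∀ (f : ι → ι → ℝ), ∑ i, ∑ j, f i j * (Pi.single i 1 : ι → ℝ) k = ∑ j, f k j := by
    intro f
    rw [Finset.sum_eq_single k]
    · simp
    · intro i _ hi
      simp [hi.symm]
    · simp
  rw [add_assoc]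
  congr 1
  · simp only [← mul_assoc, h]
    rfl
  congr 1
  · simp only [← Matrix.mulVec_mulVec]
    simp only [Matrix.mulVec, dotProduct, Finset.mul_sum]
    exact Finset.sum_congr rfl fun i _ => Finset.sum_congr rfl fun j _ => by ring
  · simp only [← mul_assoc, h]
    simp only [← Matrix.mulVec_mulVec]
    rfl

/-! ### The trace term in coordinates. -/

section TraceTerm

variable {E : Type*} [NormedAddCommGroup E] [NormedSpace ℝ E] [FiniteDimensional ℝ E]
  {M : Type*} [TopologicalSpace M] [ChartedSpace E M] [IsManifold 𝓘(ℝ, E) ∞ M]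
  {ES : Type*} [NormedAddCommGroup ES] [NormedSpace ℝ ES] [FiniteDimensional ℝ ES]
  {S : Type*} [TopologicalSpace S] [ChartedSpace ES S] [IsManifold 𝓘(ℝ, ES) ∞ S]
  {Ω : SymplecticForm E M}

local notation "𝓙" => ModelWithCorners.prod 𝓘(ℝ, ES) 𝓘(ℝ, E)

/-- The coordinate isomorphism of the tangent space at `p` in the preferred chart around `p₀`. -/
def tangentCoordEquiv {p₀ p : M} (hp : p ∈ (extChartAt 𝓘(ℝ, E) p₀).source) :
    TangentSpace 𝓘(ℝ, E) p ≃ₗ[ℝ] (Fin (finrank ℝ E) → ℝ) :=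
  LinearEquiv.ofBijective (tangentCoord p₀ p)
    ⟨tangentCoord_injective hp, fun c => ⟨_, tangentCoord_sum_smul hp c⟩⟩

theorem trace_eq_sum_tangentCoord {p₀ p : M} (hp : p ∈ (extChartAt 𝓘(ℝ, E) p₀).source)
    (T : TangentSpace 𝓘(ℝ, E) p →ₗ[ℝ] TangentSpace 𝓘(ℝ, E) p) :
    LinearMap.trace ℝ (TangentSpace 𝓘(ℝ, E) p) T =
      ∑ a, tangentCoord p₀ p (T (coordFrame p₀ a p)) a := by
  classical
  rw [LinearMap.trace_eq_matrix_trace ℝ (Basis.ofEquivFun (tangentCoordEquiv hp)), Matrix.trace]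
  refine Finset.sum_congr rfl fun a _ => ?_
  rw [Matrix.diag_apply, LinearMap.toMatrix_apply, Basis.coe_ofEquivFun]
  have h : (tangentCoordEquiv hp).symm (Pi.single a 1) = coordFrame p₀ a p :=
    (LinearEquiv.symm_apply_eq _).2 (tangentCoord_coordFrame hp a).symm
  simp only [h]
  rfl

variable {x y : S × M}

/-- A linear functional commutes with differentiation. -/
theorem mvfderiv_clm_comp {N F F' : Type*} [TopologicalSpace N] [ChartedSpace ES N]
    [IsManifold 𝓘(ℝ, ES) ∞ N] [NormedAddCommGroup F] [NormedSpace ℝ F] [NormedAddCommGroup F']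
    [NormedSpace ℝ F'] (l : F →L[ℝ] F') {f : N → F} {σ : N}
    (hf : MDifferentiableAt 𝓘(ℝ, ES) 𝓘(ℝ, F) f σ) (v : TangentSpace 𝓘(ℝ, ES) σ) :
    mvfderiv 𝓘(ℝ, ES) (fun τ => l (f τ)) σ v = l (mvfderiv 𝓘(ℝ, ES) f σ v) := by
  have hσ := mem_extChartAt_source (I := 𝓘(ℝ, ES)) σ
  have h := differentiableAt_comp_symm hσ hf
  have h1 := l.hasFDerivAt.comp _ h.hasFDerivAt
  rw [(mvfderiv_eq_fderiv_of_differentiableAt (f := fun τ => l (f τ)) hσ h1.differentiableAt).2,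
    mvfderiv_eq_fderiv hσ hf]
  exact DFunLike.congr_fun h1.fderiv _

/-- At a fixed point of `M` the endomorphisms `J_σ` live in one finite-dimensional space, and the
passage to chart coordinates there is a constant linear map, which commutes with the parameter
derivative. -/
theorem CompatibleFamily.tangentCoord_variation (F : CompatibleFamily Ω ES S)
    (hy : y ∈ (extChartAt 𝓙 x).source) (v : TangentSpace 𝓘(ℝ, ES) y.1)
    (w : TangentSpace 𝓘(ℝ, E) y.2) :
    tangentCoord x.2 y.2 (F.variation y v w) =
      (matDeriv (F.chartJ x) (extChartAt 𝓙 x y) (chartDiff 𝓘(ℝ, ES) x.1 y.1 v, 0)).mulVec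
        (tangentCoord x.2 y.2 w) := by
  have hy2 := (mem_source_prod.1 hy).2
  have hd : ∀ i j, DifferentiableAt ℝ ((fun y => F.jMatrix x.2 y i j) ∘ (extChartAt 𝓙 x).symm)
      (extChartAt 𝓙 x y) := fun i j =>
    (F.matContDiffAt_chartJ ((extChartAt 𝓙 x).map_source hy) i j).differentiableAt (by simp)
  -- The elementary endomorphisms of the coordinate basis. Expanding `J_σ` in them proves that it is
  -- differentiable in `σ`, without which the derivative would take the value zero by convention.
  let B : Fin (finrank ℝ E) → Fin (finrank ℝ E) → E →L[ℝ] E := fun i j =>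
    LinearMap.toContinuousLinearMap
      (((LinearMap.proj j ∘ₗ tangentCoord x.2 y.2 : E →ₗ[ℝ] ℝ)).smulRight
        (coordFrame x.2 i y.2 : E))
  let f : S → E →L[ℝ] E := fun σ => F.J (σ, y.2)
  have hJ : f = fun σ => ∑ i, ∑ j, F.jMatrix x.2 (σ, y.2) i j • B i j := by
    funext σ
    refine ContinuousLinearMap.ext fun w => ?_
    have h := sum_tangentCoord_smul hy2 (F.J (σ, y.2) w)
    have hc : tangentCoord x.2 y.2 (F.J (σ, y.2) w) =
        (F.jMatrix x.2 (σ, y.2)).mulVec (tangentCoord x.2 y.2 w) :=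
      F.tangentCoord_J (y := (σ, y.2)) hy2 w
    rw [hc] at h
    refine h.symm.trans ?_
    have h' : (∑ i, ∑ j, F.jMatrix x.2 (σ, y.2) i j • B i j) w =
        ∑ i, ∑ j, F.jMatrix x.2 (σ, y.2) i j • ((tangentCoord x.2 y.2 w j) •
          (coordFrame x.2 i y.2 : E)) := by
      rw [_root_.sum_apply]
      refine Finset.sum_congr rfl fun i _ => ?_
      rw [_root_.sum_apply]
      rfl
    refine Eq.trans ?_ h'.symm
    refine Finset.sum_congr (M := E) rfl fun i _ => ?_
    change (∑ j, F.jMatrix x.2 (σ, y.2) i j * tangentCoord x.2 y.2 w j) •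
      (coordFrame x.2 i y.2 : E) = _
    rw [Finset.sum_smul]
    exact Finset.sum_congr (M := E) rfl fun j _ => mul_smul _ _ (coordFrame x.2 i y.2 : E)
  have hf : MDifferentiableAt 𝓘(ℝ, ES) 𝓘(ℝ, E →L[ℝ] E) f y.1 := by
    rw [hJ]
    refine (slice_fst hy (f := fun y' => ∑ i, ∑ j, F.jMatrix x.2 y' i j • B i j) ?_).1
    exact DifferentiableAt.fun_sum fun i _ => DifferentiableAt.fun_sum fun j _ =>
      (hd i j).smul_const _
  ext i
  let w' : E := w
  -- The functional reading off the `i`-th coordinate of the value at `w`.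
  let l : (E →L[ℝ] E) →L[ℝ] ℝ := LinearMap.toContinuousLinearMap
    (LinearMap.proj i ∘ₗ (tangentCoord x.2 y.2 : E →ₗ[ℝ] _) ∘ₗ
      (ContinuousLinearMap.apply ℝ E w' : (E →L[ℝ] E) →ₗ[ℝ] E))
  have h1 := mvfderiv_clm_comp l hf v
  have h2 : ∀ σ, l (f σ) =
      ∑ j, F.jMatrix x.2 (σ, y.2) i j * tangentCoord x.2 y.2 w j := fun σ =>
    congrFun (F.tangentCoord_J (y := (σ, y.2)) hy2 w) i
  have h3 : ∀ j, HasFDerivAt (fun q => ((fun y => F.jMatrix x.2 y i j) ∘ (extChartAt 𝓙 x).symm) q *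
      tangentCoord x.2 y.2 w j) _ (extChartAt 𝓙 x y) := fun j =>
    (hd i j).hasFDerivAt.mul_const _
  have h4 := HasFDerivAt.fun_sum fun j (_ : j ∈ Finset.univ) => h3 j
  have h5 := (slice_fst hy (f := fun y' => ∑ j, F.jMatrix x.2 y' i j * tangentCoord x.2 y.2 w j)
    h4.differentiableAt).2 v
  simp only [h2] at h1
  refine h1.symm.trans (h5.trans ?_)
  refine (DFunLike.congr_fun h4.fderiv _).trans ?_
  rw [_root_.sum_apply]
  refine Finset.sum_congr rfl fun j _ => ?_
  exact mul_comm _ _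

theorem tangentCoord_contractRight {p₀ p : M} (hp : p ∈ (extChartAt 𝓘(ℝ, E) p₀).source)
    (a b u : TangentSpace 𝓘(ℝ, E) p) :
    tangentCoord p₀ p (contractRight (Ω.form p) (Ω.nondegenerate p) (a ⊗ₜ b) u) =
      (tangentCoord p₀ p b ⬝ᵥ (Ω.matrix p₀ p).mulVec (tangentCoord p₀ p u)) •
        tangentCoord p₀ p a := by
  rw [contractRight_tmul, map_smul, SymplecticForm.form_eq_dotProduct hp]

/-- The components of a bivector at `p` in coordinates around `p₀`. -/
def bivectorCoord (p₀ p : M) (G : TangentSpace 𝓘(ℝ, E) p ⊗[ℝ] TangentSpace 𝓘(ℝ, E) p) :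
    Matrix (Fin (finrank ℝ E)) (Fin (finrank ℝ E)) ℝ :=
  Matrix.of fun i j => ((finBasis ℝ E).tensorProduct (finBasis ℝ E)).repr
    (TensorProduct.map ((trivializationAt E (TangentSpace 𝓘(ℝ, E) : M → Type _) p₀).linearMapAt ℝ p)
      ((trivializationAt E (TangentSpace 𝓘(ℝ, E) : M → Type _) p₀).linearMapAt ℝ p) G) (i, j)

theorem tangentCoord_contractRight_bivectorCoord {p₀ p : M}
    (hp : p ∈ (extChartAt 𝓘(ℝ, E) p₀).source)
    (G : TangentSpace 𝓘(ℝ, E) p ⊗[ℝ] TangentSpace 𝓘(ℝ, E) p) (u : TangentSpace 𝓘(ℝ, E) p) :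
    tangentCoord p₀ p (contractRight (Ω.form p) (Ω.nondegenerate p) G u) =
      (bivectorCoord p₀ p G * Ω.matrix p₀ p).mulVec (tangentCoord p₀ p u) := by
  induction G using TensorProduct.induction_on with
  | zero =>
    have : bivectorCoord p₀ p (0 : TangentSpace 𝓘(ℝ, E) p ⊗[ℝ] TangentSpace 𝓘(ℝ, E) p) = 0 := by
      ext i j
      simp [bivectorCoord]
    rw [this]
    simp
  | tmul a b =>
    rw [tangentCoord_contractRight hp, ← Matrix.mulVec_mulVec]
    ext i
    have h : ∀ j, bivectorCoord p₀ p (a ⊗ₜ b) i j =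
        tangentCoord p₀ p a i * tangentCoord p₀ p b j := fun j => by
      simp only [bivectorCoord, Matrix.of_apply, TensorProduct.map_tmul, tangentCoord_apply,
        chartDiff_eq_trivialization hp]
      rw [Basis.tensorProduct_repr_tmul_apply, smul_eq_mul, mul_comm]
    simp only [Pi.smul_apply, smul_eq_mul, Matrix.mulVec, dotProduct, h]
    rw [Finset.sum_mul]
    exact Finset.sum_congr rfl fun j _ => by ring
  | add G G' hG hG' =>
    have : bivectorCoord p₀ p (G + G') = bivectorCoord p₀ p G + bivectorCoord p₀ p G' := by
      ext i j
      simp [bivectorCoord]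
    rw [this, add_mul, Matrix.add_mulVec, ← hG, ← hG', map_add, LinearMap.add_apply, map_add]

/-- Since `Id ⊗ i_Ω` multiplies the component matrix on the right by the matrix of `Ω`, this is the
defining equation of the bivector in coordinates. -/
theorem CompatibleFamily.bivectorCoord_mul (F : CompatibleFamily Ω ES S)
    (hy : y ∈ (extChartAt 𝓙 x).source) (v : TangentSpace 𝓘(ℝ, ES) y.1) :
    bivectorCoord x.2 y.2 (F.bivector y v) * Ω.matrix x.2 y.2 =
      matDeriv (F.chartJ x) (extChartAt 𝓙 x y) (chartDiff 𝓘(ℝ, ES) x.1 y.1 v, 0) := by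
  have hy2 := (mem_source_prod.1 hy).2
  have h : ∀ w, (bivectorCoord x.2 y.2 (F.bivector y v) * Ω.matrix x.2 y.2).mulVec
      (tangentCoord x.2 y.2 w) = (matDeriv (F.chartJ x) (extChartAt 𝓙 x y)
        (chartDiff 𝓘(ℝ, ES) x.1 y.1 v, 0)).mulVec (tangentCoord x.2 y.2 w) := fun w => by
    rw [← F.tangentCoord_variation hy, ← tangentCoord_contractRight_bivectorCoord hy2,
      CompatibleFamily.bivector, LinearEquiv.apply_symm_apply]
    rfl
  refine Matrix.ext_of_mulVec_single fun i => ?_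
  rw [← tangentCoord_coordFrame hy2]
  exact h _

theorem coordFrame_eq {p₀ p : M} (hp : p ∈ (extChartAt 𝓘(ℝ, E) p₀).source)
    (i : Fin (finrank ℝ E)) : coordFrame p₀ i p =
      (trivializationAt E (TangentSpace 𝓘(ℝ, E) : M → Type _) p₀).symm p (finBasis ℝ E i) := by
  rw [coordFrame, chartFrame, Trivialization.coe_symmₗ _ (mem_baseSet_of_mem_source hp)]

/-- The two descriptions of the frame are known to agree near `p` only, which suffices as a
covariant derivative is local. -/
theorem covariantDerivative_coordFrame
    (D : CovariantDerivative 𝓘(ℝ, E) E (TangentSpace 𝓘(ℝ, E) : M → Type _)) {p₀ p : M}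
    (hp : p ∈ (extChartAt 𝓘(ℝ, E) p₀).source) (i : Fin (finrank ℝ E)) :
    D (coordFrame p₀ i) p = D (fun q =>
      (trivializationAt E (TangentSpace 𝓘(ℝ, E) : M → Type _) p₀).symm q (finBasis ℝ E i)) p := by
  have h : ∀ᶠ q in 𝓝 p, coordFrame p₀ i q =
      (trivializationAt E (TangentSpace 𝓘(ℝ, E) : M → Type _) p₀).symm q (finBasis ℝ E i) := by
    filter_upwards [mem_source_nhds (I := 𝓘(ℝ, E)) hp] with q hq using coordFrame_eq hq i
  have h1 : MDiffAt (T% (coordFrame p₀ i : Π q : M, TangentSpace 𝓘(ℝ, E) q)) p :=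
    mdifferentiableAt_chartFrame hp (finBasis ℝ E i)
  refine D.isCovariantDerivativeOnUniv.congr_of_eventuallyEq h1 ?_ Filter.univ_mem h
  refine h1.congr_of_eventuallyEq (h.mono fun q hq => ?_)
  simp only [hq]

/-- The trace term in coordinates. -/
theorem KahlerFamily.traceTerm_eq (F : KahlerFamily Ω ES S) (x : S × M)
    (v : TangentSpace 𝓘(ℝ, ES) x.1) (u : TangentSpace 𝓘(ℝ, E) x.2) :
    F.traceTerm x v u = (F.chartJ x (extChartAt 𝓙 x x) *
      matDeriv (F.chartChristoffel x (chartDiff 𝓘(ℝ, E) x.2 x.2 u)) (extChartAt 𝓙 x x)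
        (chartDiff 𝓘(ℝ, ES) x.1 x.1 v, 0)).trace := by
  have hx := mem_extChartAt_source (I := 𝓙) x
  have hx2 := (mem_source_prod.1 hx).2
  have hz := (extChartAt 𝓙 x).map_source hx
  have hl := (extChartAt 𝓙 x).left_inv hx
  set z := extChartAt 𝓙 x x with hzdef
  set v' := chartDiff 𝓘(ℝ, ES) x.1 x.1 v with hv'
  set W : ES × E → Matrix (Fin (finrank ℝ E)) (Fin (finrank ℝ E)) ℝ :=
    Ω.chartMatrix x with hωdef
  set A := fun q => matDeriv (F.chartJ x) q (v', 0) with hA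
  have hA1 : MatDiffAt A z := ((F.matContDiffAt_chartJ hz).matDeriv infty_add_one_le _).matDiffAt
    (by simp)
  have hωs := SymplecticForm.matContDiffAt_chartMatrix (Ω := Ω) hz
  have hω1 : MatDiffAt W z := hωs.matDiffAt (by simp)
  have hu := (F.det_chartMatrix_ne_zero hz).isUnit
  have hωi : MatDiffAt (fun q => (W q)⁻¹) z :=
    (hωs.inv (F.det_chartMatrix_ne_zero hz)).matDiffAt (by simp)
  -- The components of the bivector, extended to the chart of `S × M` by the formula `∂_v J Ω⁻¹`;
  -- along the slice through `x` they are the true ones (`hCx`).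
  set C := fun q => A q * (W q)⁻¹ with hC
  have hC1 : MatDiffAt C z := hA1.mul hωi
  have hCA : ∀ᶠ q in 𝓝 z, C q * W q = A q := by
    filter_upwards [eventually_target hz] with q hq
    exact Matrix.nonsing_inv_mul_cancel_right _ _ (F.det_chartMatrix_ne_zero hq).isUnit
  have hCx : ∀ᶠ p in 𝓝 x.2, bivectorCoord x.2 p (F.bivector (x.1, p) v) =
      C (extChartAt 𝓙 x (x.1, p)) := by
    filter_upwards [mem_source_nhds (I := 𝓘(ℝ, E)) hx2] with p hp
    have hy : (x.1, p) ∈ (extChartAt 𝓙 x).source := mem_source_prod.2 ⟨(mem_source_prod.1 hx).1, hp⟩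
    have h := F.bivectorCoord_mul hy v
    have h1 : W (extChartAt 𝓙 x (x.1, p)) = Ω.matrix x.2 p := by
      rw [hωdef, SymplecticForm.chartMatrix, (extChartAt 𝓙 x).left_inv hy]
    have hu' := (F.det_chartMatrix_ne_zero ((extChartAt 𝓙 x).map_source hy)).isUnit
    rw [← hωdef, h1] at hu'
    have h2 : C (extChartAt 𝓙 x (x.1, p)) = (bivectorCoord x.2 p (F.bivector (x.1, p) v) *
        Ω.matrix x.2 p) * (Ω.matrix x.2 p)⁻¹ := by
      rw [h, hC]
      simp only [h1, hA]
      rfl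
    rw [h2, Matrix.mul_nonsing_inv_cancel_right _ _ hu']
  have hCd : ∀ i j (w : TangentSpace 𝓘(ℝ, E) x.2), mvfderiv 𝓘(ℝ, E)
      (fun p => bivectorCoord x.2 p (F.bivector (x.1, p) v) i j) x.2 w =
      matDeriv C z (0, chartDiff 𝓘(ℝ, E) x.2 x.2 w) i j := by
    intro i j w
    have hd : DifferentiableAt ℝ ((fun y => C (extChartAt 𝓙 x y) i j) ∘ (extChartAt 𝓙 x).symm) z := by
      refine (hC1 i j).congr_of_eventuallyEq ?_
      filter_upwards [eventually_target hz] with q hq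
      simp only [Function.comp_apply, (extChartAt 𝓙 x).right_inv hq]
    have h1 := (slice_snd hx (f := fun y => C (extChartAt 𝓙 x y) i j) hd).2 w
    rw [mvfderiv, Filter.EventuallyEq.mfderiv_eq (hCx.mono fun p hp => congrFun (congrFun hp i) j)]
    refine h1.trans ?_
    rw [← hzdef, Filter.EventuallyEq.fderiv_eq (f := fun q => C q i j)]
    · rfl
    · filter_upwards [eventually_target hz] with q hq
      simp only [Function.comp_apply, (extChartAt 𝓙 x).right_inv hq]
  -- The covariant derivative of a bivector with components `C` has components `∂C + Γ C + C Γᵀ`;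
  -- multiplication by the matrix of `Ω` carries out the contraction.
  have hconn : ∀ a, tangentCoord x.2 x.2 (contractRight (Ω.form x.2) (Ω.nondegenerate x.2)
      (bivectorConn (leviCivita (F.metric x.1)) (fun p => F.bivector (x.1, p) v) x.2
        (coordFrame x.2 a x.2)) u) =
      ((matDeriv C z (0, finBasis ℝ E a) + F.chartChristoffel x (finBasis ℝ E a) z * C z +
        C z * (F.chartChristoffel x (finBasis ℝ E a) z).transpose) * W z).mulVec
          (tangentCoord x.2 x.2 u) := by
    intro a
    have hb : ∀ w : TangentSpace 𝓘(ℝ, E) x.2, bivectorConn (leviCivita (F.metric x.1))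
        (fun p => F.bivector (x.1, p) v) x.2 w = ∑ i, ∑ j, (mvfderiv 𝓘(ℝ, E)
          (fun p => bivectorCoord x.2 p (F.bivector (x.1, p) v) i j) x.2 w •
            (coordFrame x.2 i x.2 ⊗ₜ[ℝ] coordFrame x.2 j x.2) +
          bivectorCoord x.2 x.2 (F.bivector (x.1, x.2) v) i j •
            (leviCivita (F.metric x.1) (coordFrame x.2 i) x.2 w ⊗ₜ[ℝ] coordFrame x.2 j x.2 +
              coordFrame x.2 i x.2 ⊗ₜ[ℝ]
                leviCivita (F.metric x.1) (coordFrame x.2 j) x.2 w)) := fun w => by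
      simp only [bivectorConn, LinearMap.sum_apply]
      refine Finset.sum_congr rfl fun i _ => Finset.sum_congr rfl fun j _ => ?_
      have h1 := fun i => coordFrame_eq hx2 i
      have h2 := fun i => covariantDerivative_coordFrame (leviCivita (F.metric x.1)) hx2 i
      rw [h1, h1, h2, h2]
      rfl
    have hΓ : ∀ j, tangentCoord x.2 x.2 (leviCivita (F.metric x.1) (coordFrame x.2 j) x.2
        (coordFrame x.2 a x.2)) =
        fun k => F.chartChristoffel x (finBasis ℝ E a) z k j := fun j => by
      ext k
      rw [CompatibleFamily.chartChristoffel, hl]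
      rfl
    have hC0 : bivectorCoord x.2 x.2 (F.bivector (x.1, x.2) v) = C z := hCx.self_of_nhds
    have hW : Ω.matrix x.2 x.2 = W z := by
      rw [hωdef, SymplecticForm.chartMatrix, hl]
    rw [hb]
    simp only [hCd, hC0, map_sum, map_add, map_smul, LinearMap.sum_apply, LinearMap.add_apply,
      LinearMap.smul_apply, tangentCoord_contractRight hx2, hW, tangentCoord_coordFrame hx2, hΓ,
      single_one_dotProduct]
    rw [← Matrix.mulVec_mulVec]
    set U := (W z).mulVec (tangentCoord x.2 x.2 u)
    have hcd : chartDiff 𝓘(ℝ, E) x.2 x.2 (coordFrame x.2 a x.2) = finBasis ℝ E a :=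
      chartDiff_chartFrame hx2 _
    rw [hcd]
    ext k
    simp only [Finset.sum_apply, Pi.add_apply, Pi.smul_apply, smul_eq_mul, Finset.sum_add_distrib,
      mul_add, Matrix.add_mulVec]
    exact sum_tensor_derivative _ _ _ _ k
  rw [CompatibleFamily.traceTerm, trace_eq_sum_tangentCoord hx2]
  refine Eq.trans ?_ (F.sum_variation hz v' _)
  refine Finset.sum_congr rfl fun a _ => ?_
  refine (congrFun (hconn a) a).trans ?_
  -- As `Ω` is parallel, contraction commutes with the connection: `∇(C) Ω = ∇(C Ω)`, the covariant
  -- derivative of the endomorphism `∂_v J`.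
  have h : (matDeriv C z (0, finBasis ℝ E a) + F.chartChristoffel x (finBasis ℝ E a) z * C z +
      C z * (F.chartChristoffel x (finBasis ℝ E a) z).transpose) * W z =
      matDeriv A z (0, finBasis ℝ E a) + F.chartChristoffel x (finBasis ℝ E a) z * A z -
        A z * F.chartChristoffel x (finBasis ℝ E a) z := by
    have h1 := matDeriv_congr hCA (0, finBasis ℝ E a)
    rw [matDeriv_mul hC1 hω1, F.matDeriv_chartMatrix hz] at h1
    rw [← h1, ← hCA.self_of_nhds]
    noncomm_ring
  rw [h, F.matDeriv_variation hz]
  rfl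

end TraceTerm

/-! ### Complexified tangent vectors and the connection of `T` in coordinates. -/

section Complexification

variable {G : Type*} [NormedAddCommGroup G] [NormedSpace ℝ G] {α β : Type*}
  {A : G → Matrix α β ℝ} {z : G}

theorem MatContDiffAt.ofReal {n : ℕ∞ω} (hA : MatContDiffAt n A z) :
    MatContDiffAt n (fun y => (A y).map ((↑) : ℝ → ℂ)) z := fun i j =>
  Complex.ofRealCLM.contDiff.contDiffAt.comp z (hA i j)

theorem MatDiffAt.ofReal (hA : MatDiffAt A z) :
    MatDiffAt (fun y => (A y).map ((↑) : ℝ → ℂ)) z := fun i j =>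
  Complex.ofRealCLM.differentiableAt.comp z (hA i j)

theorem matDeriv_ofReal (hA : MatDiffAt A z) (w : G) :
    matDeriv (fun y => (A y).map ((↑) : ℝ → ℂ)) z w = (matDeriv A z w).map (↑) := by
  ext i j
  exact DFunLike.congr_fun (Complex.ofRealCLM.hasFDerivAt.comp z (hA i j).hasFDerivAt).fderiv w

end Complexification

section ComplexCoordinates

variable {E : Type*} [NormedAddCommGroup E] [NormedSpace ℝ E] [FiniteDimensional ℝ E]
  {M : Type*} [TopologicalSpace M] [ChartedSpace E M]

/-- The complex coordinates of a vector of the complexified tangent space at `p`, in the preferred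
chart around `p₀`. -/
def complexCoord (p₀ p : M) :
    ℂ ⊗[ℝ] TangentSpace 𝓘(ℝ, E) p →ₗ[ℂ] (Fin (finrank ℝ E) → ℂ) :=
  ((Algebra.linearMap ℝ ℂ).compLeft (Fin (finrank ℝ E)) ∘ₗ tangentCoord p₀ p).liftBaseChange ℂ

theorem complexCoord_tmul (p₀ p : M) (c : ℂ) (v : TangentSpace 𝓘(ℝ, E) p)
    (i : Fin (finrank ℝ E)) : complexCoord p₀ p (c ⊗ₜ v) i = c * tangentCoord p₀ p v i := by
  simp [complexCoord]

theorem complexCoord_apply (p₀ p : M) (v : ℂ ⊗[ℝ] TangentSpace 𝓘(ℝ, E) p)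
    (i : Fin (finrank ℝ E)) : complexCoord p₀ p v i =
      tangentCoord p₀ p (rePart v) i + Complex.I * tangentCoord p₀ p (imPart v) i := by
  conv_lhs => rw [← LinearMap.id_apply (R := ℝ) v, ← ofReIm_re_im]
  simp only [ofReIm, LinearMap.add_apply, LinearMap.comp_apply, TensorProduct.mk_apply, map_add,
    Pi.add_apply, complexCoord_tmul, one_mul]

theorem tangentCoord_rePart (p₀ p : M) (v : ℂ ⊗[ℝ] TangentSpace 𝓘(ℝ, E) p)
    (i : Fin (finrank ℝ E)) : tangentCoord p₀ p (rePart v) i = (complexCoord p₀ p v i).re := by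
  simp [complexCoord_apply]

theorem tangentCoord_imPart (p₀ p : M) (v : ℂ ⊗[ℝ] TangentSpace 𝓘(ℝ, E) p)
    (i : Fin (finrank ℝ E)) : tangentCoord p₀ p (imPart v) i = (complexCoord p₀ p v i).im := by
  simp [complexCoord_apply]

theorem complexCoord_tmul_add (p₀ p : M) (a b : TangentSpace 𝓘(ℝ, E) p)
    (i : Fin (finrank ℝ E)) : complexCoord p₀ p ((1 : ℂ) ⊗ₜ a + Complex.I ⊗ₜ b) i =
      tangentCoord p₀ p a i + Complex.I * tangentCoord p₀ p b i := by
  rw [map_add, Pi.add_apply, complexCoord_tmul, complexCoord_tmul, one_mul]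

variable [IsManifold 𝓘(ℝ, E) ∞ M] {p₀ p : M}

/-- The complexified tangent vector with given complex coordinates. -/
def complexVec (p₀ p : M) (c : Fin (finrank ℝ E) → ℂ) : ℂ ⊗[ℝ] TangentSpace 𝓘(ℝ, E) p :=
  ∑ i, c i ⊗ₜ coordFrame p₀ i p

theorem complexCoord_complexVec (hp : p ∈ (extChartAt 𝓘(ℝ, E) p₀).source)
    (c : Fin (finrank ℝ E) → ℂ) : complexCoord p₀ p (complexVec p₀ p c) = c := by
  ext i
  simp only [complexVec, map_sum, Finset.sum_apply, complexCoord_tmul, tangentCoord_coordFrame hp]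
  rw [Finset.sum_eq_single i]
  · simp
  · intro j _ hj
    simp [hj.symm]
  · simp

theorem complexCoord_injective (hp : p ∈ (extChartAt 𝓘(ℝ, E) p₀).source) :
    Function.Injective (complexCoord (E := E) p₀ p) := by
  rw [injective_iff_map_eq_zero]
  intro v hv
  have h1 : rePart v = 0 := tangentCoord_injective hp <| by
    ext i
    rw [tangentCoord_rePart, hv]
    simp
  have h2 : imPart v = 0 := tangentCoord_injective hp <| by
    ext i
    rw [tangentCoord_imPart, hv]
    simp
  have h3 := LinearMap.congr_fun (ofReIm_re_im (V := TangentSpace 𝓘(ℝ, E) p)) v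
  simpa [ofReIm, h1, h2] using h3.symm

variable {ES : Type*} [NormedAddCommGroup ES] [NormedSpace ℝ ES] [FiniteDimensional ℝ ES]
  {S : Type*} [TopologicalSpace S] [ChartedSpace ES S]
  {Ω : SymplecticForm E M} (F : CompatibleFamily Ω ES S) {x y : S × M}

local notation "𝓙" => ModelWithCorners.prod 𝓘(ℝ, ES) 𝓘(ℝ, E)

/-- The matrix of the projection onto the `(1,0)`-vectors in the chart around `x`. -/
def CompatibleFamily.chartProj (F : CompatibleFamily Ω ES S) (x : S × M) (z : ES × E) :
    Matrix (Fin (finrank ℝ E)) (Fin (finrank ℝ E)) ℂ :=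
  (1 / 2 : ℂ) • (1 - Complex.I • (F.chartJ x z).map (↑))

theorem CompatibleFamily.complexCoord_baseChange (hy : y.2 ∈ (extChartAt 𝓘(ℝ, E) p₀).source)
    (v : ℂ ⊗[ℝ] TangentSpace 𝓘(ℝ, E) y.2) : complexCoord p₀ y.2
      ((F.J y : TangentSpace 𝓘(ℝ, E) y.2 →ₗ[ℝ] TangentSpace 𝓘(ℝ, E) y.2).baseChange ℂ v) =
      ((F.jMatrix p₀ y).map ((↑) : ℝ → ℂ)).mulVec (complexCoord p₀ y.2 v) := by
  induction v using TensorProduct.induction_on with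
  | zero => simp
  | tmul c v =>
    ext i
    have h := congrFun (F.tangentCoord_J hy v) i
    rw [LinearMap.baseChange_tmul, complexCoord_tmul]
    refine (congrArg (fun r : ℝ => c * (r : ℂ)) h).trans ?_
    simp only [Matrix.mulVec, dotProduct, complexCoord_tmul, Matrix.map_apply, Complex.ofReal_sum,
      Complex.ofReal_mul, Finset.mul_sum]
    exact Finset.sum_congr rfl fun j _ => by ring
  | add v v' hv hv' => rw [map_add, map_add, hv, hv', map_add, Matrix.mulVec_add]

variable [IsManifold 𝓘(ℝ, ES) ∞ S]

theorem CompatibleFamily.complexCoord_proj (hy : y ∈ (extChartAt 𝓙 x).source)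
    (v : ℂ ⊗[ℝ] TangentSpace 𝓘(ℝ, E) y.2) : complexCoord x.2 y.2 (F.proj y v).1 =
      (F.chartProj x (extChartAt 𝓙 x y)).mulVec (complexCoord x.2 y.2 v) := by
  have h : (F.proj y v).1 = projHol _ v := rfl
  rw [h, projHol, CompatibleFamily.chartProj, CompatibleFamily.chartJ,
    (extChartAt 𝓙 x).left_inv hy]
  simp only [LinearMap.smul_apply, LinearMap.sub_apply, LinearMap.id_apply, map_smul, map_sub,
    F.complexCoord_baseChange (mem_source_prod.1 hy).2, Matrix.smul_mulVec, Matrix.sub_mulVec,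
    Matrix.one_mulVec]

/-- The complex coordinates of a section of `T` in the chart around `x`. -/
def CompatibleFamily.sectionCoord (F : CompatibleFamily Ω ES S) (x : S × M) (Y : Π y, F.T y)
    (z : ES × E) : Fin (finrank ℝ E) → ℂ :=
  complexCoord x.2 ((extChartAt 𝓙 x).symm z).2 (Y ((extChartAt 𝓙 x).symm z)).1

theorem CompatibleFamily.sectionCoord_extChartAt (hy : y ∈ (extChartAt 𝓙 x).source)
    (Y : Π y, F.T y) : F.sectionCoord x Y (extChartAt 𝓙 x y) = complexCoord x.2 y.2 (Y y).1 := by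
  rw [CompatibleFamily.sectionCoord, (extChartAt 𝓙 x).left_inv hy]

theorem CompatibleFamily.smoothAt_of_sectionCoord (hy : y ∈ (extChartAt 𝓙 x).source)
    {Y : Π y, F.T y}
    (hY : ∀ i, ContDiffAt ℝ ∞ (fun z => F.sectionCoord x Y z i) (extChartAt 𝓙 x y)) :
    F.SmoothAt Y y := by
  constructor
  · refine (contMDiffAt_section_iff contMDiffAt_snd (mem_source_prod.1 hy).2).2 fun i => ?_
    refine contMDiffAt_of_comp_symm le_rfl hy ?_
    refine (Complex.reCLM.contDiff.contDiffAt.comp _ (hY i)).congr_of_eventuallyEq ?_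
    exact Filter.Eventually.of_forall fun z => tangentCoord_rePart _ _ _ _
  · refine (contMDiffAt_section_iff contMDiffAt_snd (mem_source_prod.1 hy).2).2 fun i => ?_
    refine contMDiffAt_of_comp_symm le_rfl hy ?_
    refine (Complex.imCLM.contDiff.contDiffAt.comp _ (hY i)).congr_of_eventuallyEq ?_
    exact Filter.Eventually.of_forall fun z => tangentCoord_imPart _ _ _ _

/-- The vector is recovered from its coordinates by the fixed linear map `r`, so differentiable
coordinates make `f` differentiable, and then a linear functional commutes with the derivative. -/
theorem tangentCoord_mvfderiv (hp : p ∈ (extChartAt 𝓘(ℝ, E) p₀).source) {f : S → E} {σ : S}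
    (hf : ∀ i, MDifferentiableAt 𝓘(ℝ, ES) 𝓘(ℝ, ℝ)
      (fun τ => tangentCoord p₀ p (f τ : TangentSpace 𝓘(ℝ, E) p) i) σ)
    (v : TangentSpace 𝓘(ℝ, ES) σ) (i : Fin (finrank ℝ E)) :
    tangentCoord p₀ p (mvfderiv 𝓘(ℝ, ES) f σ v : TangentSpace 𝓘(ℝ, E) p) i =
      mvfderiv 𝓘(ℝ, ES) (fun τ => tangentCoord p₀ p (f τ : TangentSpace 𝓘(ℝ, E) p) i) σ v := by
  let l : E →L[ℝ] ℝ := LinearMap.toContinuousLinearMap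
    (LinearMap.proj i ∘ₗ (tangentCoord p₀ p : E →ₗ[ℝ] _))
  let r : (Fin (finrank ℝ E) → ℝ) →L[ℝ] E := LinearMap.toContinuousLinearMap
    (Fintype.linearCombination ℝ fun i => (coordFrame p₀ i p : E))
  have hr : f = fun τ => r fun i => tangentCoord p₀ p (f τ : TangentSpace 𝓘(ℝ, E) p) i := by
    funext τ
    exact (sum_tangentCoord_smul hp (f τ : TangentSpace 𝓘(ℝ, E) p)).symm
  have hf' : MDifferentiableAt 𝓘(ℝ, ES) 𝓘(ℝ, E) f σ := by
    rw [hr]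
    have hσ := mem_extChartAt_source (I := 𝓘(ℝ, ES)) σ
    refine (mvfderiv_eq_fderiv_of_differentiableAt hσ ?_).1
    exact r.differentiableAt.comp _ (differentiableAt_pi.2 fun i =>
      differentiableAt_comp_symm hσ (hf i))
  exact (mvfderiv_clm_comp l hf' v).symm

/-- The matrix of the Levi-Civita connections over the complex numbers. -/
def CompatibleFamily.complexChristoffel (F : CompatibleFamily Ω ES S) (x : S × M) (w : E)
    (z : ES × E) : Matrix (Fin (finrank ℝ E)) (Fin (finrank ℝ E)) ℂ :=
  (F.chartChristoffel x w z).map (↑)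

/-- The connection in `T` in coordinates. -/
theorem CompatibleFamily.complexCoord_holConn (hy : y ∈ (extChartAt 𝓙 x).source) {Y : Π y, F.T y}
    (hY : ∀ i, DifferentiableAt ℝ (fun z => F.sectionCoord x Y z i) (extChartAt 𝓙 x y))
    (w : TangentSpace 𝓙 y) : complexCoord x.2 y.2 (F.holConn Y y w).1 =
      (F.chartProj x (extChartAt 𝓙 x y)).mulVec
        ((fun i => fderiv ℝ (fun z => F.sectionCoord x Y z i) (extChartAt 𝓙 x y)
            (chartDiff 𝓙 x y w)) +
          (F.complexChristoffel x (chartDiff 𝓙 x y w).2 (extChartAt 𝓙 x y)).mulVec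
            (complexCoord x.2 y.2 (Y y).1)) := by
  obtain ⟨hy1, hy2⟩ := mem_source_prod.1 hy
  set wS : TangentSpace 𝓘(ℝ, ES) y.1 := mfderiv 𝓙 𝓘(ℝ, ES) Prod.fst y w with hwS
  set wM : TangentSpace 𝓘(ℝ, E) y.2 := mfderiv 𝓙 𝓘(ℝ, E) Prod.snd y w with hwM
  -- The direction splits into its `S` and `M` parts. Only the second sees the Christoffel matrix,
  -- and the two partial derivatives add up to the full one.
  have hw : chartDiff 𝓙 x y w = (chartDiff 𝓘(ℝ, ES) x.1 y.1 wS, 0) +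
      (0, chartDiff 𝓘(ℝ, E) x.2 y.2 wM) := by
    rw [chartDiff_prod hy, Prod.mk_add_mk, add_zero, zero_add]
  have hw2 : (chartDiff 𝓙 x y w).2 = chartDiff 𝓘(ℝ, E) x.2 y.2 wM := by rw [chartDiff_prod hy]
  have hre : ∀ i, HasFDerivAt ((fun y' : S × M => tangentCoord x.2 y'.2 (rePart (Y y').1) i) ∘
      (extChartAt 𝓙 x).symm) (Complex.reCLM ∘L fderiv ℝ (fun z => F.sectionCoord x Y z i)
        (extChartAt 𝓙 x y)) (extChartAt 𝓙 x y) := fun i => by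
    refine (Complex.reCLM.hasFDerivAt.comp _ (hY i).hasFDerivAt).congr_of_eventuallyEq ?_
    exact Filter.Eventually.of_forall fun z => tangentCoord_rePart _ _ _ _
  have him : ∀ i, HasFDerivAt ((fun y' : S × M => tangentCoord x.2 y'.2 (imPart (Y y').1) i) ∘
      (extChartAt 𝓙 x).symm) (Complex.imCLM ∘L fderiv ℝ (fun z => F.sectionCoord x Y z i)
        (extChartAt 𝓙 x y)) (extChartAt 𝓙 x y) := fun i => by
    refine (Complex.imCLM.hasFDerivAt.comp _ (hY i).hasFDerivAt).congr_of_eventuallyEq ?_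
    exact Filter.Eventually.of_forall fun z => tangentCoord_imPart _ _ _ _
  -- Along `M` the real and imaginary parts are differentiated by the same real connection, so their
  -- coordinate formulas recombine over the complex numbers.
  have hM : complexCoord x.2 y.2 (complexifiedConn (leviCivita (F.metric y.1))
      (fun p => (Y (y.1, p)).1) y.2 wM) =
      (fun i => fderiv ℝ (fun z => F.sectionCoord x Y z i) (extChartAt 𝓙 x y)
        (0, chartDiff 𝓘(ℝ, E) x.2 y.2 wM)) +
      (F.complexChristoffel x (chartDiff 𝓙 x y w).2 (extChartAt 𝓙 x y)).mulVec
            (complexCoord x.2 y.2 (Y y).1) := by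
    have h1 := tangentCoord_covariantDerivative (leviCivita (F.metric y.1))
      (Y := fun q => rePart (Y (y.1, q)).1) hy2
      (fun i => (slice_snd hy (hre i).differentiableAt).1) wM
    have h2 := tangentCoord_covariantDerivative (leviCivita (F.metric y.1))
      (Y := fun q => imPart (Y (y.1, q)).1) hy2
      (fun i => (slice_snd hy (him i).differentiableAt).1) wM
    have hΓ : connMatrix (leviCivita (F.metric y.1)) x.2 (chartDiff 𝓘(ℝ, E) x.2 y.2 wM) y.2 =
        F.chartChristoffel x (chartDiff 𝓙 x y w).2 (extChartAt 𝓙 x y) := by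
      rw [CompatibleFamily.chartChristoffel, (extChartAt 𝓙 x).left_inv hy, hw2]
      rfl
    rw [hΓ] at h1 h2
    ext i
    have h3 := (congrFun h1 i).trans (congrArg₂ (· + ·)
      ((slice_snd hy (hre i).differentiableAt).2 wM) rfl)
    have h4 := (congrFun h2 i).trans (congrArg₂ (· + ·)
      ((slice_snd hy (him i).differentiableAt).2 wM) rfl)
    rw [(hre i).fderiv] at h3
    rw [(him i).fderiv] at h4
    have h5 : complexCoord x.2 y.2 (complexifiedConn (leviCivita (F.metric y.1))
      (fun p => (Y (y.1, p)).1) y.2 wM) i =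
        (tangentCoord x.2 y.2 (leviCivita (F.metric y.1)
          (fun q => rePart (Y (y.1, q)).1) y.2 wM) i : ℂ) +
        Complex.I * (tangentCoord x.2 y.2 (leviCivita (F.metric y.1)
          (fun q => imPart (Y (y.1, q)).1) y.2 wM) i : ℂ) :=
      complexCoord_tmul_add _ _ _ _ i
    rw [h5, h3, h4]
    have h6 : ∀ j, complexCoord x.2 y.2 (Y y).1 j = tangentCoord x.2 y.2 (rePart (Y y).1) j +
      Complex.I * tangentCoord x.2 y.2 (imPart (Y y).1) j := complexCoord_apply _ _ _
    simp only [Pi.add_apply, CompatibleFamily.complexChristoffel, Matrix.mulVec, dotProduct,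
      Matrix.map_apply, h6, mul_add, Finset.sum_add_distrib, Complex.ofReal_add, Complex.ofReal_sum,
      Complex.ofReal_mul, mul_left_comm _ Complex.I, ← Finset.mul_sum]
    have h7 := Complex.re_add_im (fderiv ℝ (fun z => F.sectionCoord x Y z i) (extChartAt 𝓙 x y)
      (0, chartDiff 𝓘(ℝ, E) x.2 y.2 wM))
    conv_rhs => rw [← h7]
    simp only [ContinuousLinearMap.comp_apply, Complex.reCLM_apply, Complex.imCLM_apply]
    ring
  have hS : complexCoord x.2 y.2 (paramDeriv y.2 (fun σ => (Y (σ, y.2)).1) y.1 wS) =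
      fun i => fderiv ℝ (fun z => F.sectionCoord x Y z i) (extChartAt 𝓙 x y)
        (chartDiff 𝓘(ℝ, ES) x.1 y.1 wS, 0) := by
    ext i
    have h3 := (tangentCoord_mvfderiv hy2 (f := fun σ => rePart (Y (σ, y.2)).1)
      (fun i => (slice_fst hy (hre i).differentiableAt).1) wS i).trans
        ((slice_fst hy (hre i).differentiableAt).2 wS)
    have h4 := (tangentCoord_mvfderiv hy2 (f := fun σ => imPart (Y (σ, y.2)).1)
      (fun i => (slice_fst hy (him i).differentiableAt).1) wS i).trans
        ((slice_fst hy (him i).differentiableAt).2 wS)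
    rw [(hre i).fderiv] at h3
    rw [(him i).fderiv] at h4
    have h5 : complexCoord x.2 y.2 (paramDeriv y.2 (fun σ => (Y (σ, y.2)).1) y.1 wS) i =
        (tangentCoord x.2 y.2 (mvfderiv 𝓘(ℝ, ES)
          (fun σ => (rePart (Y (σ, y.2)).1 : E)) y.1 wS : TangentSpace 𝓘(ℝ, E) y.2) i : ℂ) +
        Complex.I * (tangentCoord x.2 y.2 (mvfderiv 𝓘(ℝ, ES)
          (fun σ => (imPart (Y (σ, y.2)).1 : E)) y.1 wS : TangentSpace 𝓘(ℝ, E) y.2) i : ℂ) :=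
      complexCoord_tmul_add _ _ _ _ i
    rw [h5, h3, h4]
    exact (congrArg₂ (· + ·) rfl (mul_comm _ _)).trans (Complex.re_add_im _)
  refine (F.complexCoord_proj hy _).trans (congrArg _ ?_)
  refine (map_add (complexCoord x.2 y.2) _ _).trans ?_
  refine (congrArg₂ (· + ·) hM hS).trans ?_
  ext i
  simp only [Pi.add_apply, hw, map_add]
  ring

end ComplexCoordinates

/-! ### A smooth local frame and coframe of `T`. -/

section Frame

variable {E : Type*} [NormedAddCommGroup E] [NormedSpace ℝ E] [FiniteDimensional ℝ E]
  {M : Type*} [TopologicalSpace M] [ChartedSpace E M] [IsManifold 𝓘(ℝ, E) ∞ M]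
  {ES : Type*} [NormedAddCommGroup ES] [NormedSpace ℝ ES] [FiniteDimensional ℝ ES]
  {S : Type*} [TopologicalSpace S] [ChartedSpace ES S] [IsManifold 𝓘(ℝ, ES) ∞ S]
  {Ω : SymplecticForm E M} (F : CompatibleFamily Ω ES S) {x y : S × M} {z : ES × E}
  {m : ℕ} (hm : finrank ℝ E = 2 * m)

local notation "𝓙" => ModelWithCorners.prod 𝓘(ℝ, ES) 𝓘(ℝ, E)

/-- The product of `Ω` and `J` is symmetric while `Ω` is skew, so `J` is conjugate to the negative
of its transpose. This makes the trace of the projection exactly `m`. -/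
theorem CompatibleFamily.trace_chartJ (hz : z ∈ (extChartAt 𝓙 x).target) :
    (F.chartJ x z).trace = 0 := by
  have hu := (F.det_chartMatrix_ne_zero hz).isUnit
  have ha : (Ω.chartMatrix x z).transpose = -Ω.chartMatrix x z := by
    ext i j
    have h : ∀ v w, Ω.form ((extChartAt 𝓙 x).symm z).2 v w = -Ω.form _ w v := fun v w => by
      have h1 := Ω.alternating ((extChartAt 𝓙 x).symm z).2 (v + w)
      simp only [map_add, add_apply, Ω.alternating, zero_add, add_zero] at h1
      linarith
    exact h _ _
  have hs : (Ω.chartMatrix x z * F.chartJ x z).transpose = Ω.chartMatrix x z * F.chartJ x z := by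
    have h := F.chartMetric_symm (x := x) (z := z)
    have h1 : F.chartMetric x z = Ω.chartMatrix x z * F.chartJ x z :=
      F.metricMatrix_eq (mem_source_of_mem_target hz)
    rwa [h1] at h
  rw [Matrix.transpose_mul, ha] at hs
  have h1 : F.chartJ x z = (Ω.chartMatrix x z)⁻¹ *
      ((F.chartJ x z).transpose * -Ω.chartMatrix x z) := by
    rw [hs, Matrix.nonsing_inv_mul_cancel_left _ _ hu]
  have h2 := congrArg Matrix.trace h1
  rw [Matrix.trace_mul_comm, mul_neg, neg_mul, Matrix.mul_nonsing_inv_cancel_right _ _ hu,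
    Matrix.trace_neg, Matrix.trace_transpose] at h2
  linarith

theorem CompatibleFamily.complexJ_mul_self (hz : z ∈ (extChartAt 𝓙 x).target) :
    (F.chartJ x z).map ((↑) : ℝ → ℂ) * (F.chartJ x z).map (↑) = -1 := by
  have h := congrArg (fun A : Matrix _ _ ℝ => A.map (Complex.ofRealHom : ℝ →+* ℂ))
    (F.chartJ_mul_self hz)
  rw [Matrix.map_mul] at h
  refine h.trans ?_
  ext i j
  simp [Matrix.one_apply, apply_ite]

theorem CompatibleFamily.chartProj_mul_self (hz : z ∈ (extChartAt 𝓙 x).target) :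
    F.chartProj x z * F.chartProj x z = F.chartProj x z := by
  have h := F.complexJ_mul_self hz
  rw [CompatibleFamily.chartProj]
  set A := (F.chartJ x z).map ((↑) : ℝ → ℂ)
  simp only [Matrix.smul_mul, Matrix.mul_smul, smul_smul, sub_mul, mul_sub, one_mul, mul_one, h]
  ext i j
  simp only [Matrix.smul_apply, Matrix.sub_apply, Matrix.neg_apply, smul_eq_mul]
  linear_combination (-1 / 4 : ℂ) * (1 : Matrix (Fin (finrank ℝ E)) (Fin (finrank ℝ E)) ℂ) i j *
    Complex.I_mul_I

include hm in
theorem CompatibleFamily.trace_chartProj (hz : z ∈ (extChartAt 𝓙 x).target) :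
    (F.chartProj x z).trace = m := by
  have h : ((F.chartJ x z).map ((↑) : ℝ → ℂ)).trace = 0 := by
    have h1 := congrArg ((↑) : ℝ → ℂ) (F.trace_chartJ hz)
    simpa [Matrix.trace] using h1
  rw [CompatibleFamily.chartProj, Matrix.trace_smul, Matrix.trace_sub, Matrix.trace_smul, h,
    Matrix.trace_one, Fintype.card_fin, hm]
  simp

theorem CompatibleFamily.matContDiffAt_chartProj (hz : z ∈ (extChartAt 𝓙 x).target) :
    MatContDiffAt ∞ (F.chartProj x) z := fun i j => by
  have h := (F.matContDiffAt_chartJ hz).ofReal i j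
  simp only [CompatibleFamily.chartProj, Matrix.smul_apply, Matrix.sub_apply, smul_eq_mul]
  exact contDiffAt_const.mul (contDiffAt_const.sub (contDiffAt_const.mul h))

/-- The coordinates at `x` of the basis of `T`. -/
def CompatibleFamily.basisMatrix (x : S × M) : Matrix (Fin (finrank ℝ E)) (Fin m) ℂ :=
  Matrix.of fun a i => complexCoord x.2 x.2 (F.holBasis hm x i).1 a

/-- The coordinates of the local frame `holFrame` of `T`. -/
def CompatibleFamily.frameMatrix (x : S × M) (z : ES × E) : Matrix (Fin (finrank ℝ E)) (Fin m) ℂ :=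
  F.chartProj x z * F.basisMatrix hm x

/-- A local frame of `T` around `x`. -/
def CompatibleFamily.holFrame (x : S × M) (i : Fin m) (y : S × M) : F.T y :=
  F.proj y (complexVec x.2 y.2 fun a => F.basisMatrix hm x a i)

theorem CompatibleFamily.complexCoord_holFrame (hy : y ∈ (extChartAt 𝓙 x).source) (i : Fin m) :
    complexCoord x.2 y.2 (F.holFrame hm x i y).1 =
      fun a => F.frameMatrix hm x (extChartAt 𝓙 x y) a i := by
  rw [CompatibleFamily.holFrame, F.complexCoord_proj hy,
    complexCoord_complexVec (mem_source_prod.1 hy).2]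
  rfl

theorem CompatibleFamily.sectionCoord_holFrame (hz : z ∈ (extChartAt 𝓙 x).target)
    (i : Fin m) : F.sectionCoord x (F.holFrame hm x i) z = fun a => F.frameMatrix hm x z a i := by
  rw [CompatibleFamily.sectionCoord, F.complexCoord_holFrame hm ((extChartAt 𝓙 x).map_target hz),
    (extChartAt 𝓙 x).right_inv hz]

theorem CompatibleFamily.matContDiffAt_frameMatrix (hz : z ∈ (extChartAt 𝓙 x).target) :
    MatContDiffAt ∞ (F.frameMatrix hm x) z :=
  (F.matContDiffAt_chartProj hz).mul (matContDiffAt_const _ _)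

theorem CompatibleFamily.smoothAt_holFrame (hy : y ∈ (extChartAt 𝓙 x).source) (i : Fin m) :
    F.SmoothAt (F.holFrame hm x i) y := by
  refine F.smoothAt_of_sectionCoord hy fun a => ?_
  refine (F.matContDiffAt_frameMatrix hm ((extChartAt 𝓙 x).map_source hy) a i).congr_of_eventuallyEq
    ?_
  filter_upwards [eventually_target ((extChartAt 𝓙 x).map_source hy)] with q hq
  rw [F.sectionCoord_holFrame hm hq]

/-- Vectors of `T` are fixed by the projection. -/
theorem CompatibleFamily.chartProj_mulVec (hy : y ∈ (extChartAt 𝓙 x).source) (v : F.T y) :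
    (F.chartProj x (extChartAt 𝓙 x y)).mulVec (complexCoord x.2 y.2 v.1) =
      complexCoord x.2 y.2 v.1 := by
  obtain ⟨w, hw⟩ := v.2
  have h : v = F.proj y w := Subtype.ext hw.symm
  rw [h, F.complexCoord_proj hy, Matrix.mulVec_mulVec,
    F.chartProj_mul_self ((extChartAt 𝓙 x).map_source hy)]

theorem CompatibleFamily.frameMatrix_self :
    F.frameMatrix hm x (extChartAt 𝓙 x x) = F.basisMatrix hm x := by
  ext a i
  exact congrFun (F.chartProj_mulVec (mem_extChartAt_source (I := 𝓙) x) (F.holBasis hm x i)) a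

/-- The columns are coordinates of linearly independent vectors. Composed with the left inverse, the
frame matrix becomes a square matrix equal to `1` at the centre, so a determinant can detect where
the frame stays a frame. -/
theorem CompatibleFamily.exists_left_inverse_basisMatrix (x : S × M) :
    ∃ B : Matrix (Fin m) (Fin (finrank ℝ E)) ℂ, B * F.basisMatrix hm x = 1 := by
  have hx := (mem_source_prod.1 (mem_extChartAt_source (I := 𝓙) x)).2
  have hinj : Function.Injective (F.basisMatrix hm x).mulVecLin := by
    rw [injective_iff_map_eq_zero]
    intro c hc
    have h1 : complexCoord x.2 x.2 (∑ i, c i • F.holBasis hm x i : F.T x).1 = 0 := by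
      rw [Submodule.coe_sum, map_sum, ← hc]
      ext a
      simp only [Submodule.coe_smul, map_smul, Finset.sum_apply, Pi.smul_apply, smul_eq_mul,
        Matrix.mulVecLin_apply, Matrix.mulVec, dotProduct, CompatibleFamily.basisMatrix,
        Matrix.of_apply]
      exact Finset.sum_congr rfl fun j _ => mul_comm _ _
    have h2 : (∑ i, c i • F.holBasis hm x i : F.T x) = 0 :=
      Subtype.ext (complexCoord_injective hx (h1.trans (map_zero _).symm))
    funext i
    exact Fintype.linearIndependent_iff.1 (F.holBasis hm x).linearIndependent c h2 i
  obtain ⟨g, hg⟩ := LinearMap.exists_leftInverse_of_injective _ (LinearMap.ker_eq_bot.2 hinj)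
  refine ⟨LinearMap.toMatrix' g, ?_⟩
  have h := congrArg LinearMap.toMatrix' hg
  rwa [LinearMap.toMatrix'_comp, LinearMap.toMatrix'_id, ← Matrix.toLin'_apply',
    LinearMap.toMatrix'_toLin'] at h

/-- A left inverse of `basisMatrix`. -/
def CompatibleFamily.cobasisMatrix (x : S × M) : Matrix (Fin m) (Fin (finrank ℝ E)) ℂ :=
  (F.exists_left_inverse_basisMatrix hm x).choose

theorem CompatibleFamily.cobasisMatrix_mul :
    F.cobasisMatrix hm x * F.basisMatrix hm x = 1 :=
  (F.exists_left_inverse_basisMatrix hm x).choose_spec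

/-- The coframe dual to `frameMatrix`. -/
def CompatibleFamily.coframeMatrix (x : S × M) (z : ES × E) :
    Matrix (Fin m) (Fin (finrank ℝ E)) ℂ :=
  (F.cobasisMatrix hm x * F.frameMatrix hm x z)⁻¹ * (F.cobasisMatrix hm x * F.chartProj x z)

/-- The points of the chart around `x` at which `holFrame` is a frame. -/
def CompatibleFamily.frameDomain (x : S × M) : Set (ES × E) :=
  {z | z ∈ (extChartAt 𝓙 x).target ∧ (F.cobasisMatrix hm x * F.frameMatrix hm x z).det ≠ 0}

theorem CompatibleFamily.eventually_frameDomain (hz : z ∈ F.frameDomain hm x) :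
    ∀ᶠ q in 𝓝 z, q ∈ F.frameDomain hm x := by
  have h1 : ContinuousAt (fun z => (F.cobasisMatrix hm x * F.frameMatrix hm x z).det) z :=
    (contDiffAt_det (n := ∞) ((matContDiffAt_const _ _).mul
      (F.matContDiffAt_frameMatrix hm hz.1))).continuousAt
  filter_upwards [eventually_target hz.1, h1.eventually_ne hz.2] with q h h' using ⟨h, h'⟩

theorem CompatibleFamily.mem_frameDomain_self : extChartAt 𝓙 x x ∈ F.frameDomain hm x := by
  refine ⟨(extChartAt 𝓙 x).map_source (mem_extChartAt_source (I := 𝓙) x), ?_⟩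
  rw [F.frameMatrix_self, F.cobasisMatrix_mul, Matrix.det_one]
  exact one_ne_zero

theorem CompatibleFamily.chartProj_mul_frameMatrix (hz : z ∈ (extChartAt 𝓙 x).target) :
    F.chartProj x z * F.frameMatrix hm x z = F.frameMatrix hm x z := by
  rw [CompatibleFamily.frameMatrix, ← Matrix.mul_assoc, F.chartProj_mul_self hz]

theorem CompatibleFamily.coframe_mul_frame (hz : z ∈ F.frameDomain hm x) :
    F.coframeMatrix hm x z * F.frameMatrix hm x z = 1 := by
  rw [CompatibleFamily.coframeMatrix, Matrix.mul_assoc, Matrix.mul_assoc,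
    F.chartProj_mul_frameMatrix hm hz.1, Matrix.nonsing_inv_mul _ hz.2.isUnit]

/-- The difference `P - Y Z` is idempotent, because `P Y = Y`, `Z P = Z` and `Z Y = 1`. Its trace is
`m - m = 0`, so it vanishes. -/
theorem CompatibleFamily.frame_mul_coframe (hz : z ∈ F.frameDomain hm x) :
    F.frameMatrix hm x z * F.coframeMatrix hm x z = F.chartProj x z := by
  have hP := F.chartProj_mul_self hz.1
  have h1 := F.coframe_mul_frame hm hz
  set Y := F.frameMatrix hm x z with hY
  set Z := F.coframeMatrix hm x z with hZ
  set P := F.chartProj x z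
  have hPY : P * Y = Y := F.chartProj_mul_frameMatrix hm hz.1
  have hZP : Z * P = Z := by
    rw [hZ, CompatibleFamily.coframeMatrix, Matrix.mul_assoc, Matrix.mul_assoc, hP]
  have hq : (P - Y * Z) * (P - Y * Z) = P - Y * Z := by
    have e1 : P * (Y * Z) = Y * Z := by rw [← Matrix.mul_assoc, hPY]
    have e2 : Y * Z * P = Y * Z := by rw [Matrix.mul_assoc, hZP]
    have e3 : Y * Z * (Y * Z) = Y * Z := by
      rw [Matrix.mul_assoc, ← Matrix.mul_assoc Z, h1, Matrix.one_mul]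
    rw [sub_mul, mul_sub, mul_sub, hP, e1, e2, e3]
    abel
  have ht : (P - Y * Z).trace = 0 := by
    rw [Matrix.trace_sub, Matrix.trace_mul_comm, h1, F.trace_chartProj hm hz.1, Matrix.trace_one,
      Fintype.card_fin, sub_self]
  exact (sub_eq_zero.1 (matrix_eq_zero_of_trace_eq_zero hq ht)).symm

theorem CompatibleFamily.matContDiffAt_coframeMatrix (hz : z ∈ F.frameDomain hm x) :
    MatContDiffAt ∞ (F.coframeMatrix hm x) z :=
  (((matContDiffAt_const _ _).mul (F.matContDiffAt_frameMatrix hm hz.1)).inv hz.2).mul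
    ((matContDiffAt_const _ _).mul (F.matContDiffAt_chartProj hz.1))

end Frame

/-! ### The connection of the canonical bundle in a fixed local frame. -/

section Canonical

variable {E : Type*} [NormedAddCommGroup E] [NormedSpace ℝ E] [FiniteDimensional ℝ E]
  {M : Type*} [TopologicalSpace M] [ChartedSpace E M] [IsManifold 𝓘(ℝ, E) ∞ M]
  {ES : Type*} [NormedAddCommGroup ES] [NormedSpace ℝ ES] [FiniteDimensional ℝ ES]
  {S : Type*} [TopologicalSpace S] [ChartedSpace ES S] [IsManifold 𝓘(ℝ, ES) ∞ S]
  {Ω : SymplecticForm E M} (F : CompatibleFamily Ω ES S) {x y : S × M} {z : ES × E}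
  {m : ℕ} (hm : finrank ℝ E = 2 * m)

local notation "𝓙" => ModelWithCorners.prod 𝓘(ℝ, ES) 𝓘(ℝ, E)

theorem CompatibleFamily.holExtend_self (v : F.T y) : F.holExtend y v y = v := by
  have h : ((1 : ℂ) ⊗ₜ[ℝ] rePart v.1 + Complex.I ⊗ₜ[ℝ] imPart v.1 :
      ℂ ⊗[ℝ] TangentSpace 𝓘(ℝ, E) y.2) = v.1 :=
    LinearMap.congr_fun (ofReIm_re_im (V := TangentSpace 𝓘(ℝ, E) y.2)) v.1
  have hy := mem_extChartAt_source (I := 𝓙) y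
  refine Subtype.ext (complexCoord_injective (mem_source_prod.1 hy).2 ?_)
  rw [CompatibleFamily.holExtend, FiberBundle.extend_apply_self, FiberBundle.extend_apply_self, h,
    F.complexCoord_proj hy, F.chartProj_mulVec hy]

/-- Regularity of the extension is needed at its base point only, where the first derivative is
taken. -/
theorem CompatibleFamily.differentiableAt_sectionCoord_holExtend
    (hy : y ∈ (extChartAt 𝓙 x).source) (v : F.T y) (i : Fin (finrank ℝ E)) :
    DifferentiableAt ℝ (fun z => F.sectionCoord x (F.holExtend y v) z i) (extChartAt 𝓙 x y) := by
  have hz := (extChartAt 𝓙 x).map_source hy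
  have hext : ∀ (u : TangentSpace 𝓘(ℝ, E) y.2) (j : Fin (finrank ℝ E)), DifferentiableAt ℝ
      ((fun y' : S × M => tangentCoord x.2 y'.2 (FiberBundle.extend E u y'.2) j) ∘
        (extChartAt 𝓙 x).symm) (extChartAt 𝓙 x y) := fun u j => by
    have h := (contMDiffAt_section_iff (p₀ := x.2) (I := 𝓘(ℝ, E)) (f := fun q : M => q)
      (s := fun q => FiberBundle.extend E u q) contMDiffAt_id (mem_source_prod.1 hy).2).1
        (FiberBundle.contMDiffAt_extend (k := ∞) 𝓘(ℝ, E) E u) j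
    have h2 := h.comp y (contMDiffAt_snd (I := 𝓘(ℝ, ES)) (J := 𝓘(ℝ, E)))
    exact (contDiffAt_comp_symm le_rfl hy h2).differentiableAt (by simp)
  have hP := ((F.matContDiffAt_chartProj hz).matDiffAt (by simp)) i
  have h : DifferentiableAt ℝ (fun z => ∑ j, F.chartProj x z i j *
      ((tangentCoord x.2 ((extChartAt 𝓙 x).symm z).2
        (FiberBundle.extend E (rePart v.1) ((extChartAt 𝓙 x).symm z).2) j : ℂ) + Complex.I *
      (tangentCoord x.2 ((extChartAt 𝓙 x).symm z).2
        (FiberBundle.extend E (imPart v.1) ((extChartAt 𝓙 x).symm z).2) j : ℂ)))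
      (extChartAt 𝓙 x y) := by
    refine DifferentiableAt.fun_sum fun j _ => (hP j).mul (DifferentiableAt.add ?_ ?_)
    · exact Complex.ofRealCLM.differentiableAt.comp _ (hext (rePart v.1) j)
    · exact (Complex.ofRealCLM.differentiableAt.comp _ (hext (imPart v.1) j)).const_mul _
  refine h.congr_of_eventuallyEq ?_
  filter_upwards [eventually_target hz] with q hq
  have h1 := congrFun (F.complexCoord_proj ((extChartAt 𝓙 x).map_target hq)
    ((1 : ℂ) ⊗ₜ[ℝ] FiberBundle.extend E (rePart v.1) ((extChartAt 𝓙 x).symm q).2 +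
    Complex.I ⊗ₜ[ℝ] FiberBundle.extend E (imPart v.1) ((extChartAt 𝓙 x).symm q).2)) i
  rw [(extChartAt 𝓙 x).right_inv hq] at h1
  refine h1.trans ?_
  simp only [Matrix.mulVec, dotProduct, complexCoord_tmul_add]

/-- The trace of the connection form of `T` in the frame `holFrame`. -/
def CompatibleFamily.connTrace (x : S × M) (z w : ES × E) : ℂ :=
  (F.coframeMatrix hm x z * (matDeriv (F.frameMatrix hm x) z w +
    F.complexChristoffel x w.2 z * F.frameMatrix hm x z)).trace

/-- A vector of `T` from its coordinates in the frame `holFrame`. -/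
theorem CompatibleFamily.eq_sum_holFrame (hy : y ∈ (extChartAt 𝓙 x).source)
    {v : F.T y} {c : Fin m → ℂ}
    (h : complexCoord x.2 y.2 v.1 = (F.frameMatrix hm x (extChartAt 𝓙 x y)).mulVec c) :
    v = ∑ j, c j • F.holFrame hm x j y := by
  refine Subtype.ext (complexCoord_injective (mem_source_prod.1 hy).2 ?_)
  rw [h, Submodule.coe_sum, map_sum]
  ext a
  simp only [Submodule.coe_smul, map_smul, Finset.sum_apply, Pi.smul_apply, smul_eq_mul,
    F.complexCoord_holFrame hm hy, Matrix.mulVec, dotProduct]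
  exact Finset.sum_congr rfl fun j _ => mul_comm _ _

/-- The connection at `y` is defined through a basis chosen at `y` and its extension, with no
regularity in `y`. That extension is `Y' = Y a` for the smooth frame `Y`. The change of frame
multiplies top forms by `det a`, whose logarithmic derivative `tr (a⁻¹ da)` is also the gauge term
in the connection matrix, so that the choice at `y` drops out. -/
theorem CompatibleFamily.canonicalConn_holFrame (hy : y ∈ (extChartAt 𝓙 x).source)
    (hd : extChartAt 𝓙 x y ∈ F.frameDomain hm x) {κ : Π y, F.K m y}
    (hκ : DifferentiableAt ℝ ((fun y => κ y fun i => F.holFrame hm x i y) ∘ (extChartAt 𝓙 x).symm)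
      (extChartAt 𝓙 x y)) (w : TangentSpace 𝓙 y) :
    F.canonicalConn hm κ y w (fun i => F.holFrame hm x i y) =
      fderiv ℝ ((fun y => κ y fun i => F.holFrame hm x i y) ∘ (extChartAt 𝓙 x).symm)
        (extChartAt 𝓙 x y) (chartDiff 𝓙 x y w) -
      F.connTrace hm x (extChartAt 𝓙 x y) (chartDiff 𝓙 x y w) *
        κ y (fun i => F.holFrame hm x i y) := by
  set z := extChartAt 𝓙 x y with hzdef
  have hz := hd.1
  have hl : (extChartAt 𝓙 x).symm z = y := (extChartAt 𝓙 x).left_inv hy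
  set w' := chartDiff 𝓙 x y w with hw'
  set b := F.holBasis hm y with hb
  -- The coordinates of the extended basis at `y`, to be compared with the frame `Y`; the transition
  -- matrix is `a = Z Y'`.
  let Y' : ES × E → Matrix (Fin (finrank ℝ E)) (Fin m) ℂ := fun q =>
    Matrix.of fun a i => F.sectionCoord x (F.holExtend y (b i)) q a
  have hY' : MatDiffAt Y' z := fun a i => F.differentiableAt_sectionCoord_holExtend hy (b i) a
  set Y := F.frameMatrix hm x with hY
  set Z := F.coframeMatrix hm x with hZ
  have hY1 : MatDiffAt Y z := (F.matContDiffAt_frameMatrix hm hz).matDiffAt (by simp)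
  have hZ1 : MatDiffAt Z z := (F.matContDiffAt_coframeMatrix hm hd).matDiffAt (by simp)
  let a : ES × E → Matrix (Fin m) (Fin m) ℂ := fun q => Z q * Y' q
  have ha : MatDiffAt a z := hZ1.mul hY'
  have hYa : ∀ q ∈ F.frameDomain hm x, Y' q = Y q * a q := by
    intro q hq
    have hq1 := (extChartAt 𝓙 x).map_target hq.1
    have hP : F.chartProj x q * Y' q = Y' q := by
      ext c i
      have h1 := F.chartProj_mulVec hq1 (F.holExtend y (b i) ((extChartAt 𝓙 x).symm q))
      rw [(extChartAt 𝓙 x).right_inv hq.1] at h1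
      exact congrFun h1 c
    rw [← Matrix.mul_assoc, F.frame_mul_coframe hm hq, hP]
  have hext : ∀ q ∈ F.frameDomain hm x, ∀ i, F.holExtend y (b i) ((extChartAt 𝓙 x).symm q) =
      ∑ j, a q j i • F.holFrame hm x j ((extChartAt 𝓙 x).symm q) := by
    intro q hq i
    refine F.eq_sum_holFrame hm ((extChartAt 𝓙 x).map_target hq.1) ?_
    rw [(extChartAt 𝓙 x).right_inv hq.1]
    ext c
    exact congrFun (congrFun (hYa q hq) c) i
  have hbY : ∀ i, b i = ∑ j, a z j i • F.holFrame hm x j y := by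
    intro i
    have h := hext z hd i
    rw [hl] at h
    rwa [F.holExtend_self] at h
  -- The basis is `a` applied to the frame, and its determinant form takes the value `1` on itself.
  have hdet : (a z).det * b.det (fun i => F.holFrame hm x i y) = 1 := by
    rw [← alternating_sum_smul, ← funext hbY, Basis.det_self]
  have hdet0 : (a z).det ≠ 0 := left_ne_zero_of_mul_eq_one hdet
  set c := (fun y => κ y fun i => F.holFrame hm x i y) ∘ (extChartAt 𝓙 x).symm with hc
  have hcz : κ y (fun i => F.holFrame hm x i y) = c z := by
    rw [hc, Function.comp_apply, hl]
  have hc' : ∀ᶠ q in 𝓝 z, ((fun y' => κ y' fun i => F.holExtend y (b i) y') ∘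
      (extChartAt 𝓙 x).symm) q = (a q).det * c q := by
    filter_upwards [F.eventually_frameDomain hm hd] with q hq
    rw [Function.comp_apply, funext (hext q hq), alternating_sum_smul]
    rfl
  obtain ⟨hda, hda'⟩ := hasFDerivAt_det ha
  have hD := ((hda.hasFDerivAt.mul hκ.hasFDerivAt).congr_of_eventuallyEq hc')
  have hmv := (mvfderiv_eq_fderiv_of_differentiableAt hy hD.differentiableAt).2 w
  rw [hD.fderiv] at hmv
  set N := Z z * (matDeriv Y z w' + F.complexChristoffel x w'.2 z * Y z) with hN
  set D := matDeriv a z w' with hDdef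
  have hY'd : matDeriv Y' z w' = matDeriv Y z w' * a z + Y z * D := by
    rw [matDeriv_congr ((F.eventually_frameDomain hm hd).mono hYa), matDeriv_mul hY1 ha]
  -- The Leibniz rule `∇(Y a) = Y (N a + da)`, with `N` the connection matrix in the frame `Y`.
  have hmat : F.chartProj x z * (matDeriv Y' z w' + F.complexChristoffel x w'.2 z * Y' z) =
      Y z * (N * a z + D) := by
    have h1 : F.chartProj x z * (Y z * D) = Y z * D := by
      rw [← Matrix.mul_assoc, F.chartProj_mul_frameMatrix hm hz]
    rw [hY'd, hYa z hd, Matrix.mul_add, Matrix.mul_add, h1, ← F.frame_mul_coframe hm hd,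
      Matrix.mul_add, hN]
    simp only [Matrix.mul_assoc, Matrix.mul_add, Matrix.add_mul]
    abel
  -- In the basis `b = Y a` the connection matrix is `a⁻¹ N a + a⁻¹ da`.
  have hconn : ∀ i, F.holConn (F.holExtend y (b i)) y w =
      ∑ j, ((a z)⁻¹ * (N * a z + D)) j i • b j := by
    intro i
    have h1 := F.complexCoord_holConn hy
      (fun c => F.differentiableAt_sectionCoord_holExtend hy (b i) c) w
    have h2 : F.holConn (F.holExtend y (b i)) y w =
        ∑ j, (N * a z + D) j i • F.holFrame hm x j y := by
      refine F.eq_sum_holFrame hm hy (h1.trans ?_)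
      have h3 := congrArg (fun B : Matrix (Fin (finrank ℝ E)) (Fin m) ℂ => fun r => B r i) hmat
      refine Eq.trans ?_ h3
      have h4 : complexCoord x.2 y.2 (F.holExtend y (b i) y).1 = fun r => Y' z r i := by
        rw [← F.sectionCoord_extChartAt hy]
        rfl
      rw [h4]
      rfl
    rw [h2]
    simp only [hbY, Finset.smul_sum, smul_smul]
    rw [Finset.sum_comm]
    refine Finset.sum_congr rfl fun k _ => ?_
    rw [← Finset.sum_smul]
    congr 1
    have h5 : (N * a z + D) = a z * ((a z)⁻¹ * (N * a z + D)) := by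
      rw [Matrix.mul_nonsing_inv_cancel_left _ _ hdet0.isUnit]
    rw [h5, Matrix.mul_apply, ← h5]
    exact Finset.sum_congr rfl fun j _ => mul_comm _ _
  have hκb : κ y b = (a z).det * c z := by
    have h := hc'.self_of_nhds
    rw [Function.comp_apply, hl] at h
    rw [← h]
    congr 1
    ext i
    rw [F.holExtend_self]
  -- The derivation induced on top forms is the trace, and conjugation by `a` leaves the trace of
  -- `N` unchanged.
  have hsum : ∑ i, κ y (Function.update b i (F.holConn (F.holExtend y (b i)) y w)) =
      (N.trace + ((a z)⁻¹ * D).trace) * ((a z).det * c z) := by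
    simp only [hconn]
    rw [sum_update_eq_trace_mul, hκb, Matrix.mul_add, Matrix.trace_add, ← Matrix.mul_assoc,
      Matrix.trace_mul_comm _ (a z), ← Matrix.mul_assoc,
      Matrix.mul_nonsing_inv _ hdet0.isUnit, Matrix.one_mul]
  have hmain : F.canonicalConn hm κ y w (fun i => F.holFrame hm x i y) =
      (mvfderiv 𝓙 (fun y' => κ y' fun i => F.holExtend y (b i) y') y w -
        ∑ i, κ y (Function.update b i (F.holConn (F.holExtend y (b i)) y w))) *
        b.det (fun i => F.holFrame hm x i y) := by
    have h1 : ∑ i, κ y (Function.update b i (F.holConn (F.holExtend y (b i)) y w)) =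
        (∑ i, ((κ y).toMultilinearMap.toLinearMap b i).restrictScalars ℝ ∘ₗ
          F.holConn (F.holExtend y (b i)) y) w := by
      rw [LinearMap.sum_apply]
      rfl
    rw [h1]
    rfl
  have hadj : (a z).adjugate = (a z).det • (a z)⁻¹ := by
    rw [Matrix.inv_def, smul_smul, Ring.mul_inverse_cancel _ hdet0.isUnit, one_smul]
  rw [hmain, hsum, hcz, hmv]
  simp only [add_apply, smul_apply, smul_eq_mul, hda', hadj, Matrix.smul_mul, Matrix.trace_smul]
  rw [CompatibleFamily.connTrace, ← hN]
  -- The terms with `tr (a⁻¹ da)` have cancelled, and the common factor `det a` is absorbed by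
  -- `hdet`.
  linear_combination (fderiv ℝ c z w' - N.trace * c z) * hdet

end Canonical

/-! ### Local frames of complex line bundles. -/

section LineBundle

variable {B : Type*} {EB : Type*} [NormedAddCommGroup EB] [NormedSpace ℝ EB]
  {HB : Type*} [TopologicalSpace HB] {IB : ModelWithCorners ℝ EB HB} [TopologicalSpace B]
  [ChartedSpace HB B] {L : B → Type*} [∀ x, AddCommGroup (L x)]
  [∀ x, Module ℂ (L x)] [∀ x, TopologicalSpace (L x)] [TopologicalSpace (TotalSpace ℂ L)]
  [FiberBundle ℂ L] [VectorBundle ℂ ℂ L] {x₀ x : B}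

theorem lineCoord_lineFrame (hx : x ∈ (trivializationAt ℂ L x₀).baseSet) :
    lineCoord L x₀ x (lineFrame L x₀ x) = 1 := by
  rw [lineCoord, lineFrame, ← Trivialization.coe_symmₗ (R := ℂ) _ hx,
    Trivialization.linearMapAt_symmₗ _ hx]

theorem lineCoord_smul_lineFrame (hx : x ∈ (trivializationAt ℂ L x₀).baseSet) (v : L x) :
    lineCoord L x₀ x v • lineFrame L x₀ x = v := by
  rw [lineCoord, lineFrame, ← Trivialization.coe_symmₗ (R := ℂ) _ hx, ← map_smul, smul_eq_mul,
    mul_one, Trivialization.symmₗ_linearMapAt _ hx]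

theorem eventually_baseSet (hx : x ∈ (trivializationAt ℂ L x₀).baseSet) :
    ∀ᶠ q in 𝓝 x, q ∈ (trivializationAt ℂ L x₀).baseSet :=
  (trivializationAt ℂ L x₀).open_baseSet.mem_nhds hx

/-- Coordinates in two frames differ by the transition function. -/
theorem lineCoord_mul_lineCoord {x₁ : B} (h₀ : x ∈ (trivializationAt ℂ L x₀).baseSet) (v : L x) :
    lineCoord L x₁ x (lineFrame L x₀ x) * lineCoord L x₀ x v = lineCoord L x₁ x v := by
  conv_rhs => rw [← lineCoord_smul_lineFrame h₀ v]
  rw [map_smul, smul_eq_mul, mul_comm]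

variable [VectorBundle ℝ ℂ L] [ContMDiffVectorBundle ∞ ℂ L IB] [IsManifold IB ∞ B]

theorem contMDiffAt_lineFrame (hx : x ∈ (trivializationAt ℂ L x₀).baseSet) :
    ContMDiffAt IB (IB.prod 𝓘(ℝ, ℂ)) ∞ (fun q => TotalSpace.mk' ℂ q (lineFrame L x₀ q)) x := by
  rw [Trivialization.contMDiffAt_iff (e := trivializationAt ℂ L x₀)
    ((Trivialization.mem_source _).2 hx)]
  refine ⟨contMDiffAt_id, contMDiffAt_const (c := (1 : ℂ)) |>.congr_of_eventuallyEq ?_⟩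
  filter_upwards [eventually_baseSet hx] with q hq
  have h := lineCoord_lineFrame hq
  rwa [lineCoord, Trivialization.linearMapAt_apply, if_pos hq] at h

theorem contMDiffAt_lineCoord (hx : x ∈ (trivializationAt ℂ L x₀).baseSet) {s : Π q, L q}
    (hs : ContMDiffAt IB (IB.prod 𝓘(ℝ, ℂ)) ∞ (fun q => TotalSpace.mk' ℂ q (s q)) x) :
    ContMDiffAt IB 𝓘(ℝ, ℂ) ∞ (fun q => lineCoord L x₀ q (s q)) x := by
  rw [Trivialization.contMDiffAt_iff (e := trivializationAt ℂ L x₀)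
    ((Trivialization.mem_source _).2 hx)] at hs
  refine hs.2.congr_of_eventuallyEq ?_
  filter_upwards [eventually_baseSet hx] with q hq
  rw [lineCoord, Trivialization.linearMapAt_apply, if_pos hq]

theorem continuousLinearEquivAt_symm_apply (c : ℂ) :
    (VectorBundle.continuousLinearEquivAt ℝ ℂ L x).symm c = c • lineFrame L x x := by
  have hx := FiberBundle.mem_baseSet_trivializationAt' (F := ℂ) (E := L) x
  rw [ContinuousLinearEquiv.symm_apply_eq]
  have h : lineCoord L x x (c • lineFrame L x x) = c := by
    rw [map_smul, lineCoord_lineFrame hx, smul_eq_mul, mul_one]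
  rw [lineCoord, Trivialization.linearMapAt_apply, if_pos hx] at h
  exact h.symm

end LineBundle

/-! ### The connection form of the half-form bundle. -/

section SquareRoot

variable {E : Type*} [NormedAddCommGroup E] [NormedSpace ℝ E] [FiniteDimensional ℝ E]
  {M : Type*} [TopologicalSpace M] [ChartedSpace E M] [IsManifold 𝓘(ℝ, E) ∞ M]
  {ES : Type*} [NormedAddCommGroup ES] [NormedSpace ℝ ES] [FiniteDimensional ℝ ES]
  {S : Type*} [TopologicalSpace S] [ChartedSpace ES S] [IsManifold 𝓘(ℝ, ES) ∞ S]
  {Ω : SymplecticForm E M} {F : CompatibleFamily Ω ES S} {x y : S × M} {z : ES × E}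
  {m : ℕ} (hm : finrank ℝ E = 2 * m)
  {δ : S × M → Type*} [∀ x, AddCommGroup (δ x)] [∀ x, Module ℂ (δ x)]
  [∀ x, TopologicalSpace (δ x)] [∀ x, IsTopologicalAddGroup (δ x)] [∀ x, ContinuousSMul ℝ (δ x)]
  [TopologicalSpace (TotalSpace ℂ δ)] [FiberBundle ℂ δ] [VectorBundle ℂ ℂ δ] [VectorBundle ℝ ℂ δ]
  [ContMDiffVectorBundle ∞ ℂ δ (𝓘(ℝ, ES).prod 𝓘(ℝ, E))] (Q : SquareRoot F m δ)

local notation "𝓙" => ModelWithCorners.prod 𝓘(ℝ, ES) 𝓘(ℝ, E)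

/-- The square of the frame `lineFrame δ x`, as a section of the canonical bundle. -/
def SquareRoot.squareFrame (Q : SquareRoot F m δ) (x y : S × M) : F.K m y :=
  Q.iso y (lineFrame δ x y ⊗ₜ[ℂ] lineFrame δ x y)

/-- The square of the frame spans the fibre of `K`, and the factor `2` undoes the half in the
definition of the connection form. -/
theorem SquareRoot.canonicalConn_squareFrame (y : S × M) (w : TangentSpace 𝓙 y) :
    F.canonicalConn hm (Q.squareFrame y) y w = (2 * Q.connForm hm y w) • Q.squareFrame y y := by
  have hy := FiberBundle.mem_baseSet_trivializationAt' (F := ℂ) (E := δ) y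
  set l : δ y ⊗[ℂ] δ y →ₗ[ℂ] ℂ := TensorProduct.lift
    ((LinearMap.mul ℂ ℂ).compl₁₂ (lineCoord δ y y) (lineCoord δ y y)) with hl
  -- The fibre of `δ` is a line, so its tensor square is spanned by the square of the frame vector.
  have h : ∀ t : δ y ⊗[ℂ] δ y, t = l t • (lineFrame δ y y ⊗ₜ[ℂ] lineFrame δ y y) := by
    intro t
    induction t using TensorProduct.induction_on with
    | zero => simp
    | tmul a b =>
      conv_lhs => rw [← lineCoord_smul_lineFrame hy a, ← lineCoord_smul_lineFrame hy b]
      rw [TensorProduct.smul_tmul_smul]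
      rfl
    | add s t hs ht =>
      rw [map_add, add_smul, ← hs, ← ht]
  have h1 := h ((Q.iso y).symm (F.canonicalConn hm (Q.squareFrame y) y w))
  have h2 := congrArg (Q.iso y) h1
  rw [LinearEquiv.apply_symm_apply, map_smul] at h2
  rw [h2]
  have h3 : Q.connForm hm y w =
      (1 / 2 : ℝ) • l ((Q.iso y).symm (F.canonicalConn hm (Q.squareFrame y) y w)) := rfl
  rw [h3, Complex.real_smul]
  congr 1
  push_cast
  ring

theorem SquareRoot.squareFrame_ne_zero (hy : y ∈ (trivializationAt ℂ δ x).baseSet) :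
    Q.squareFrame x y ≠ 0 := by
  intro h
  have h1 := (LinearEquiv.map_eq_zero_iff _).1 h
  have h2 := congrArg (TensorProduct.lift
    ((LinearMap.mul ℂ ℂ).compl₁₂ (lineCoord δ x y) (lineCoord δ x y))) h1
  rw [TensorProduct.lift.tmul, map_zero] at h2
  simp [lineCoord_lineFrame hy] at h2

/-- The points of the chart around `x` at which the local frames of `T` and `δ` are defined. -/
def SquareRoot.domain (_ : SquareRoot F m δ) (x : S × M) : Set (ES × E) :=
  {z | z ∈ F.frameDomain hm x ∧ (extChartAt 𝓙 x).symm z ∈ (trivializationAt ℂ δ x).baseSet}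

theorem SquareRoot.mem_domain_self : extChartAt 𝓙 x x ∈ Q.domain hm x := by
  refine ⟨F.mem_frameDomain_self hm, ?_⟩
  rw [(extChartAt 𝓙 x).left_inv (mem_extChartAt_source (I := 𝓙) x)]
  exact FiberBundle.mem_baseSet_trivializationAt' x

theorem SquareRoot.eventually_domain (hz : z ∈ Q.domain hm x) :
    ∀ᶠ q in 𝓝 z, q ∈ Q.domain hm x := by
  filter_upwards [F.eventually_frameDomain hm hz.1,
    (continuousAt_symm (I := 𝓙) hz.1.1).eventually (eventually_baseSet hz.2)] with q h h' using ⟨h, h'⟩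

/-- The value of the square of the frame of `δ` on the frame of `T`. -/
def SquareRoot.chartSquare (Q : SquareRoot F m δ) (x : S × M) (z : ES × E) : ℂ :=
  Q.squareFrame x ((extChartAt 𝓙 x).symm z) fun i => F.holFrame hm x i ((extChartAt 𝓙 x).symm z)

/-- The centres `x'` of the frame of `δ` and `x` of the frame of `T` are kept apart, because the
connection of `δ` at `y` uses the frame of `δ` around `y`. -/
theorem SquareRoot.contDiffAt_squareFrame {x' : S × M} (hz : z ∈ (extChartAt 𝓙 x).target)
    (hy : (extChartAt 𝓙 x).symm z ∈ (trivializationAt ℂ δ x').baseSet) :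
    ContDiffAt ℝ ∞ ((fun y => Q.squareFrame x' y fun i => F.holFrame hm x i y) ∘
      (extChartAt 𝓙 x).symm) z := by
  have hs := (extChartAt 𝓙 x).map_target hz
  have h := Q.contMDiff _ (lineFrame δ x') (lineFrame δ x') (F.holFrame hm x)
    (contMDiffAt_lineFrame hy) (contMDiffAt_lineFrame hy) (fun i => F.smoothAt_holFrame hm hs i)
  have h1 := contDiffAt_comp_symm le_rfl hs h
  rwa [(extChartAt 𝓙 x).right_inv hz] at h1

theorem SquareRoot.contDiffAt_chartSquare (hz : z ∈ Q.domain hm x) :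
    ContDiffAt ℝ ∞ (Q.chartSquare hm x) z :=
  Q.contDiffAt_squareFrame hm hz.1.1 hz.2

theorem CompatibleFamily.sum_coframe (hy : y ∈ (extChartAt 𝓙 x).source)
    (hd : extChartAt 𝓙 x y ∈ F.frameDomain hm x) (v : F.T y) :
    v = ∑ j, (F.coframeMatrix hm x (extChartAt 𝓙 x y)).mulVec (complexCoord x.2 y.2 v.1) j •
      F.holFrame hm x j y := by
  refine F.eq_sum_holFrame hm hy ?_
  rw [Matrix.mulVec_mulVec, F.frame_mul_coframe hm hd, F.chartProj_mulVec hy]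

/-- The frame spans the fibre, so the value of a top form on any basis is a multiple of its value on
the frame. -/
theorem CompatibleFamily.apply_holFrame_ne_zero (hy : y ∈ (extChartAt 𝓙 x).source)
    (hd : extChartAt 𝓙 x y ∈ F.frameDomain hm x) {κ : F.K m y} (hκ : κ ≠ 0) :
    (κ fun i => F.holFrame hm x i y) ≠ 0 := by
  intro h
  refine hκ ?_
  set b := F.holBasis hm y
  have h1 : κ b = 0 := by
    have hb : (b : Fin m → F.T y) = fun i => ∑ j, (Matrix.of fun j i =>
        (F.coframeMatrix hm x (extChartAt 𝓙 x y)).mulVec (complexCoord x.2 y.2 (b i).1) j) j i •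
          F.holFrame hm x j y := funext fun i => F.sum_coframe hm hy hd (b i)
    rw [hb, alternating_sum_smul, h, mul_zero]
  rw [AlternatingMap.eq_smul_basis_det b κ, h1, zero_smul]

theorem SquareRoot.chartSquare_ne_zero (hz : z ∈ Q.domain hm x) : Q.chartSquare hm x z ≠ 0 := by
  refine F.apply_holFrame_ne_zero hm ((extChartAt 𝓙 x).map_target hz.1.1) ?_
    (Q.squareFrame_ne_zero hz.2)
  rw [(extChartAt 𝓙 x).right_inv hz.1.1]
  exact hz.1

theorem SquareRoot.conn_eq (s : Π y, δ y) (y : S × M) (w : TangentSpace 𝓙 y) :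
    Q.conn hm s y w = (mvfderiv 𝓙 (fun q => lineCoord δ y q (s q)) y w +
      lineCoord δ y y (s y) * Q.connForm hm y w) • lineFrame δ y y :=
  continuousLinearEquivAt_symm_apply _

/-- The connection form of `δ` in the frame `lineFrame δ x`. -/
theorem SquareRoot.lineCoord_conn_lineFrame (hy : y ∈ (extChartAt 𝓙 x).source)
    (hd : extChartAt 𝓙 x y ∈ Q.domain hm x) (w : TangentSpace 𝓙 y) :
    lineCoord δ x y (Q.conn hm (lineFrame δ x) y w) =
      1 / 2 * ((Q.chartSquare hm x (extChartAt 𝓙 x y))⁻¹ *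
        fderiv ℝ (Q.chartSquare hm x) (extChartAt 𝓙 x y) (chartDiff 𝓙 x y w) -
        F.connTrace hm x (extChartAt 𝓙 x y) (chartDiff 𝓙 x y w)) := by
  have hyx : y ∈ (trivializationAt ℂ δ x).baseSet := by
    have h := hd.2
    rwa [(extChartAt 𝓙 x).left_inv hy] at h
  have hyy := FiberBundle.mem_baseSet_trivializationAt' (F := ℂ) (E := δ) y
  set z := extChartAt 𝓙 x y with hz
  have hl : (extChartAt 𝓙 x).symm z = y := (extChartAt 𝓙 x).left_inv hy
  -- The transition function from the frame of `δ` around `x` to the frame around `y`, in which the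
  -- connection at `y` is defined.
  set g : S × M → ℂ := fun q => lineCoord δ y q (lineFrame δ x q) with hg
  have hgs : ContMDiffAt 𝓙 𝓘(ℝ, ℂ) ∞ g y := contMDiffAt_lineCoord hyy (contMDiffAt_lineFrame hyx)
  have hgd := hgs.mdifferentiableAt (by simp)
  have hg1 := (differentiableAt_comp_symm hy hgd).hasFDerivAt
  have hgw := mvfderiv_eq_fderiv hy hgd w
  have hgi : g y * lineCoord δ x y (lineFrame δ y y) = 1 := by
    rw [lineCoord_mul_lineCoord hyx, lineCoord_lineFrame hyy]
  have hg0 : g y ≠ 0 := left_ne_zero_of_mul_eq_one hgi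
  set c := (fun q => Q.squareFrame y q fun i => F.holFrame hm x i q) ∘ (extChartAt 𝓙 x).symm with hc
  have hcd : DifferentiableAt ℝ c z :=
    (Q.contDiffAt_squareFrame hm hd.1.1 (by rwa [hl])).differentiableAt (by simp)
  have hcz : Q.squareFrame y y (fun i => F.holFrame hm x i y) = c z := by
    rw [hc, Function.comp_apply, hl]
  -- Squaring the frame squares the transition function. Half the logarithmic derivative of `g² c`
  -- is `d log g + (1/2) d log c`, which matches the change of the connection form of `δ` by `d log
  -- g`.
  have hcq : ∀ᶠ q in 𝓝 z, Q.chartSquare hm x q =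
      (g ∘ (extChartAt 𝓙 x).symm) q * (g ∘ (extChartAt 𝓙 x).symm) q * c q := by
    have hcont := continuousAt_symm (I := 𝓙) hd.1.1
    rw [ContinuousAt, hl] at hcont
    filter_upwards [hcont.eventually (eventually_baseSet hyy)] with q hq
    rw [SquareRoot.chartSquare, SquareRoot.squareFrame, ← lineCoord_smul_lineFrame hq
      (lineFrame δ x ((extChartAt 𝓙 x).symm q)), TensorProduct.smul_tmul_smul, map_smul]
    rfl
  rw [← hz] at hg1 hgw
  have hD := ((hg1.mul hg1).mul hcd.hasFDerivAt).congr_of_eventuallyEq hcq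
  have hq := hcq.self_of_nhds
  have hgz : (g ∘ (extChartAt 𝓙 x).symm) z = g y := by rw [Function.comp_apply, hl]
  have hne := Q.chartSquare_ne_zero hm hd
  have hcan := F.canonicalConn_holFrame hm hy hd.1 hcd w
  rw [Q.canonicalConn_squareFrame, AlternatingMap.smul_apply, hcz, smul_eq_mul] at hcan
  rw [Q.conn_eq, map_smul, smul_eq_mul, hD.fderiv, hgw]
  have hc0 : c z ≠ 0 := right_ne_zero_of_mul (hq ▸ hne)
  simp only [add_apply, smul_apply, smul_eq_mul, Pi.mul_apply]
  have hinv : lineCoord δ x y (lineFrame δ y y) = (g y)⁻¹ := eq_inv_of_mul_eq_one_right hgi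
  rw [hinv, hq, hgz]
  have hcf : Q.connForm hm y w = 1 / 2 * ((c z)⁻¹ * fderiv ℝ c z (chartDiff 𝓙 x y w) -
      F.connTrace hm x z (chartDiff 𝓙 x y w)) := by
    field_simp
    linear_combination hcan
  rw [hcf]
  change (_ + g y * _) * _ = _
  field_simp
  ring

end SquareRoot

/-! ### Curvature of `d + Θ` on a trivial line bundle. -/

section OneForm

variable {G : Type*} [NormedAddCommGroup G] [NormedSpace ℝ G] [FiniteDimensional ℝ G]
  {W : Type*} [NormedAddCommGroup W] [NormedSpace ℝ W]

/-- A differentiable one-form from its values on constant vector fields. -/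
theorem exists_oneForm {Θ : G → G → W} {z : G} (hl : ∀ᶠ y in 𝓝 z, IsLinearMap ℝ (Θ y))
    (hd : ∀ w, DifferentiableAt ℝ (fun y => Θ y w) z) :
    ∃ η : G → G →L[ℝ] W, DifferentiableAt ℝ η z ∧ ∀ᶠ y in 𝓝 z, ∀ w, η y w = Θ y w := by
  let b := finBasis ℝ G
  let c := fun i => LinearMap.toContinuousLinearMap (b.coord i)
  refine ⟨fun y => ∑ i, (c i).smulRight (Θ y (b i)), ?_, ?_⟩
  · refine DifferentiableAt.fun_sum fun i _ => ?_
    exact (ContinuousLinearMap.smulRightL ℝ G W (c i)).differentiableAt.comp z (hd (b i))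
  · filter_upwards [hl] with y hy w
    conv_rhs => rw [← b.sum_repr w]
    have h := map_sum hy.mk' (fun i => b.repr w i • b i) Finset.univ
    rw [IsLinearMap.mk'_apply] at h
    rw [h, _root_.sum_apply]
    refine Finset.sum_congr rfl fun i _ => ?_
    rw [IsLinearMap.mk'_apply, hy.map_smul]
    rfl

/-- The curvature of the connection `d + Θ` in the trivial line bundle. -/
theorem curvature_oneForm {Θ : G → G → ℂ} {f : G → ℂ} {V X : G → G} {z : G}
    (hl : ∀ᶠ y in 𝓝 z, IsLinearMap ℝ (Θ y)) (hd : ∀ w, DifferentiableAt ℝ (fun y => Θ y w) z)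
    (hf : ContDiffAt ℝ 2 f z) (hV : DifferentiableAt ℝ V z) (hX : DifferentiableAt ℝ X z) :
    (fderiv ℝ (fun y => fderiv ℝ f y (X y) + f y * Θ y (X y)) z (V z) +
        (fderiv ℝ f z (X z) + f z * Θ z (X z)) * Θ z (V z)) -
      (fderiv ℝ (fun y => fderiv ℝ f y (V y) + f y * Θ y (V y)) z (X z) +
        (fderiv ℝ f z (V z) + f z * Θ z (V z)) * Θ z (X z)) -
      (fderiv ℝ f z (VectorField.lieBracket ℝ V X z) +
        f z * Θ z (VectorField.lieBracket ℝ V X z)) =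
    (fderiv ℝ (fun y => Θ y (X z)) z (V z) - fderiv ℝ (fun y => Θ y (V z)) z (X z)) * f z := by
  obtain ⟨η, hη, he⟩ := exists_oneForm hl hd
  have hf1 : DifferentiableAt ℝ f z := hf.differentiableAt two_ne_zero
  have hf2 : DifferentiableAt ℝ (fderiv ℝ f) z :=
    (hf.fderiv_right (m := 1) (by norm_num)).differentiableAt one_ne_zero
  have hs : fderiv ℝ (fderiv ℝ f) z (V z) (X z) = fderiv ℝ (fderiv ℝ f) z (X z) (V z) :=
    (hf.isSymmSndFDerivAt (by simp)).eq _ _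
  -- The covariant derivative of `f` as a one-form. Its exterior derivative is `df ∧ η + f dη`,
  -- since the second derivative of `f` is symmetric; the undifferentiated terms in `Θ` cancel the
  -- wedge product.
  let ζ : G → G →L[ℝ] ℂ := fun y => fderiv ℝ f y + f y • η y
  have hζ : DifferentiableAt ℝ ζ z := hf2.add (hf1.smul hη)
  have key := fderiv_oneForm_lieBracket hζ hV hX
  have hζe : ∀ U : G → G, (fun y => fderiv ℝ f y (U y) + f y * Θ y (U y)) =ᶠ[𝓝 z]
      fun y => ζ y (U y) := fun U => by
    filter_upwards [he] with y hy
    rw [← hy]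
    rfl
  have hη' : ∀ u w, fderiv ℝ (fun y => Θ y u) z w = fderiv ℝ η z w u := fun u w => by
    have h : (fun y => Θ y u) =ᶠ[𝓝 z] fun y => η y u := by
      filter_upwards [he] with y hy using (hy u).symm
    rw [h.fderiv_eq, fderiv_clm_apply hη (differentiableAt_const u)]
    simp
  have hζd : ∀ u w, fderiv ℝ ζ z w u = fderiv ℝ (fderiv ℝ f) z w u +
      (f z * fderiv ℝ η z w u + fderiv ℝ f z w * Θ z u) := fun u w => by
    have h : HasFDerivAt ζ _ z := hf2.hasFDerivAt.add (hf1.hasFDerivAt.smul hη.hasFDerivAt)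
    rw [h.fderiv, ← he.self_of_nhds u]
    simp
  rw [(hζe X).fderiv_eq, (hζe V).fderiv_eq, hη', hη']
  rw [hζd, hζd, hs] at key
  have hζz : ∀ u, ζ z u = fderiv ℝ f z u + f z * Θ z u := fun u => by
    rw [← he.self_of_nhds u]
    rfl
  rw [hζz] at key
  linear_combination key

end OneForm

/-! ### The curvature of the half-form bundle in mixed directions. -/

section SquareRoot

variable {E : Type*} [NormedAddCommGroup E] [NormedSpace ℝ E] [FiniteDimensional ℝ E]
  {M : Type*} [TopologicalSpace M] [ChartedSpace E M] [IsManifold 𝓘(ℝ, E) ∞ M]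
  {ES : Type*} [NormedAddCommGroup ES] [NormedSpace ℝ ES] [FiniteDimensional ℝ ES]
  {S : Type*} [TopologicalSpace S] [ChartedSpace ES S] [IsManifold 𝓘(ℝ, ES) ∞ S]
  {Ω : SymplecticForm E M} {x y : S × M} {z : ES × E}
  {m : ℕ} (hm : finrank ℝ E = 2 * m)
  {δ : S × M → Type*} [∀ x, AddCommGroup (δ x)] [∀ x, Module ℂ (δ x)]
  [∀ x, TopologicalSpace (δ x)] [∀ x, IsTopologicalAddGroup (δ x)] [∀ x, ContinuousSMul ℝ (δ x)]
  [TopologicalSpace (TotalSpace ℂ δ)] [FiberBundle ℂ δ] [VectorBundle ℂ ℂ δ] [VectorBundle ℝ ℂ δ]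
  [ContMDiffVectorBundle ∞ ℂ δ (𝓘(ℝ, ES).prod 𝓘(ℝ, E))]

local notation "𝓙" => ModelWithCorners.prod 𝓘(ℝ, ES) 𝓘(ℝ, E)

theorem CompatibleFamily.differentiableAt_connTrace (F : CompatibleFamily Ω ES S)
    (hz : z ∈ F.frameDomain hm x) (w : ES × E) :
    DifferentiableAt ℝ (fun y => F.connTrace hm x y w) z := by
  have hY := F.matContDiffAt_frameMatrix hm hz.1
  exact differentiableAt_trace (((F.matContDiffAt_coframeMatrix hm hz).matDiffAt (by simp)).mul
    (((hY.matDeriv infty_add_one_le w).matDiffAt (by simp)).add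
      (((F.matContDiffAt_chartChristoffel hz.1 w.2).matDiffAt (by simp)).ofReal.mul
        (hY.matDiffAt (by simp)))))

/-- The general formula for the exterior derivative of the connection trace applies, and its term
`tr (∂_v Γ) / 2` vanishes because variations of Christoffel matrices are trace-free. -/
theorem KahlerFamily.fderiv_connTrace (F : KahlerFamily Ω ES S)
    (hz : z ∈ F.frameDomain hm x) (v : ES) (u : E) :
    fderiv ℝ (fun y => F.connTrace hm x y (0, u)) z (v, 0) -
      fderiv ℝ (fun y => F.connTrace hm x y (v, 0)) z (0, u) =
    -(Complex.I / 2) * ((F.chartJ x z * matDeriv (F.chartChristoffel x u) z (v, 0)).trace : ℝ) := by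
  have hJ := F.matContDiffAt_chartJ hz.1
  have hJ1 := hJ.matDiffAt (by simp)
  have hΓ := (F.matContDiffAt_chartChristoffel hz.1 u).matDiffAt (by simp)
  have hY := F.matContDiffAt_frameMatrix hm hz.1
  have hmap : ∀ A B : Matrix (Fin (finrank ℝ E)) (Fin (finrank ℝ E)) ℝ,
      (A * B).map ((↑) : ℝ → ℂ) = A.map (↑) * B.map (↑) := fun A B =>
    Matrix.map_mul (f := Complex.ofRealHom)
  have htr : ∀ A : Matrix (Fin (finrank ℝ E)) (Fin (finrank ℝ E)) ℝ,
      (A.map ((↑) : ℝ → ℂ)).trace = (A.trace : ℝ) := fun A => by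
    simp [Matrix.trace]
  have hpar : matDeriv (fun q => (F.chartJ x q).map ((↑) : ℝ → ℂ)) z (0, u) =
      (F.chartJ x z).map (↑) * F.complexChristoffel x u z -
        F.complexChristoffel x u z * (F.chartJ x z).map (↑) := by
    rw [matDeriv_ofReal hJ1, F.matDeriv_chartJ hz.1, CompatibleFamily.complexChristoffel, ← hmap,
      ← hmap]
    exact Matrix.map_sub _ (fun a b => Complex.ofReal_sub a b) _ _
  have h := fderiv_trace_connection (v := ((v, 0) : ES × E))
    (J := fun q => (F.chartJ x q).map ((↑) : ℝ → ℂ))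
    (Γ := F.complexChristoffel x u) (Y := F.frameMatrix hm x) (Z := F.coframeMatrix hm x)
    ((eventually_target hz.1).mono fun q hq => F.complexJ_mul_self hq)
    ((F.eventually_frameDomain hm hz).mono fun q hq => F.coframe_mul_frame hm hq)
    ((F.eventually_frameDomain hm hz).mono fun q hq => F.frame_mul_coframe hm hq)
    hJ1.ofReal hΓ.ofReal ((F.matContDiffAt_coframeMatrix hm hz).matDiffAt (by simp))
    (fun i j => (hY i j).of_le two_le_infty) hpar
  have h0 : ∀ q, F.complexChristoffel x 0 q = 0 := fun q => by
    rw [CompatibleFamily.complexChristoffel, F.chartChristoffel_eq_sum]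
    ext i j
    simp
  -- In a direction of `S` the connection of `T` is the projected derivative, without Christoffel
  -- term.
  have e1 : (fun y => F.connTrace hm x y (v, 0)) =
      fun y => (F.coframeMatrix hm x y * matDeriv (F.frameMatrix hm x) y (v, 0)).trace := by
    ext q
    simp only [CompatibleFamily.connTrace, h0, Matrix.zero_mul, add_zero]
  have hd : matDeriv (F.complexChristoffel x u) z (v, 0) =
      (matDeriv (F.chartChristoffel x u) z (v, 0)).map (↑) := matDeriv_ofReal hΓ _
  rw [e1]
  refine h.trans ?_
  rw [hd, ← hmap, htr, htr, F.trace_matDeriv_chartChristoffel hz.1]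
  push_cast
  ring

/-- The connection form of `δ` in the frame `lineFrame δ x`, in coordinates. -/
def SquareRoot.chartConnForm {F : CompatibleFamily Ω ES S} (Q : SquareRoot F m δ) (x : S × M)
    (z w : ES × E) : ℂ :=
  lineCoord δ x ((extChartAt 𝓙 x).symm z) (Q.conn hm (lineFrame δ x) ((extChartAt 𝓙 x).symm z)
    (chartFrame 𝓙 x w ((extChartAt 𝓙 x).symm z)))

theorem SquareRoot.isLinearMap_chartConnForm {F : CompatibleFamily Ω ES S} (Q : SquareRoot F m δ) :
    IsLinearMap ℝ (Q.chartConnForm hm x z) := by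
  constructor
  · intro w w'
    simp only [SquareRoot.chartConnForm, chartFrame_add, map_add]
  · intro c w
    simp only [SquareRoot.chartConnForm, chartFrame_smul, map_smul]
    exact map_smul ((lineCoord δ x ((extChartAt 𝓙 x).symm z)).restrictScalars ℝ) c _

theorem SquareRoot.chartConnForm_eq {F : CompatibleFamily Ω ES S} (Q : SquareRoot F m δ)
    (hz : z ∈ Q.domain hm x) (w : ES × E) :
    Q.chartConnForm hm x z w = 1 / 2 * ((Q.chartSquare hm x z)⁻¹ *
      fderiv ℝ (Q.chartSquare hm x) z w - F.connTrace hm x z w) := by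
  have hy := (extChartAt 𝓙 x).map_target hz.1.1
  have hr := (extChartAt 𝓙 x).right_inv hz.1.1
  rw [SquareRoot.chartConnForm, Q.lineCoord_conn_lineFrame hm hy (by rwa [hr]), hr,
    chartDiff_chartFrame hy]

theorem SquareRoot.differentiableAt_logDeriv {F : CompatibleFamily Ω ES S} (Q : SquareRoot F m δ)
    (hz : z ∈ Q.domain hm x) (w : ES × E) :
    DifferentiableAt ℝ (fun q => (Q.chartSquare hm x q)⁻¹ * fderiv ℝ (Q.chartSquare hm x) q w) z := by
  have h := Q.contDiffAt_chartSquare hm hz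
  exact ((h.differentiableAt (by simp)).fun_inv (Q.chartSquare_ne_zero hm hz)).mul
    (((h.fderiv_right infty_add_one_le).differentiableAt (by simp)).clm_apply
      (differentiableAt_const w))

theorem SquareRoot.differentiableAt_chartConnForm {F : CompatibleFamily Ω ES S}
    (Q : SquareRoot F m δ) (hz : z ∈ Q.domain hm x) (w : ES × E) :
    DifferentiableAt ℝ (fun q => Q.chartConnForm hm x q w) z :=
  (((Q.differentiableAt_logDeriv hm hz w).sub
    (F.differentiableAt_connTrace hm hz.1 w)).const_mul _).congr_of_eventuallyEq
      ((Q.eventually_domain hm hz).mono fun _ hq => Q.chartConnForm_eq hm hq w)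

/-- The curvature of `δ` in a direction of `S` and a direction of `M`. -/
theorem SquareRoot.fderiv_chartConnForm (F : KahlerFamily Ω ES S)
    (Q : SquareRoot F.toCompatibleFamily m δ) (hz : z ∈ Q.domain hm x) (v : ES) (u : E) :
    fderiv ℝ (fun q => Q.chartConnForm hm x q (0, u)) z (v, 0) -
      fderiv ℝ (fun q => Q.chartConnForm hm x q (v, 0)) z (0, u) =
    Complex.I / 4 *
      ((F.chartJ x z * matDeriv (F.chartChristoffel x u) z (v, 0)).trace : ℝ) := by
  have h := Q.contDiffAt_chartSquare hm hz
  have h0 := Q.chartSquare_ne_zero hm hz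
  have hd : DifferentiableAt ℝ (Q.chartSquare hm x) z := h.differentiableAt (by simp)
  have hd2 : DifferentiableAt ℝ (fderiv ℝ (Q.chartSquare hm x)) z :=
    (h.fderiv_right infty_add_one_le).differentiableAt (by simp)
  -- Apart from the trace term, the result is symmetric in `a` and `w`: the logarithmic derivative
  -- is a closed form.
  have e : ∀ a w, fderiv ℝ (fun q => Q.chartConnForm hm x q w) z a =
      1 / 2 * (((Q.chartSquare hm x z)⁻¹ * fderiv ℝ (fderiv ℝ (Q.chartSquare hm x)) z a w -
        ((Q.chartSquare hm x z) ^ 2)⁻¹ * fderiv ℝ (Q.chartSquare hm x) z a *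
          fderiv ℝ (Q.chartSquare hm x) z w) -
        fderiv ℝ (fun q => F.connTrace hm x q w) z a) := fun a w => by
    obtain ⟨D, h1, hD⟩ : ∃ D : ES × E →L[ℝ] ℂ,
        HasFDerivAt (fun q => (Q.chartSquare hm x q)⁻¹) D z ∧
        D a = -((Q.chartSquare hm x z) ^ 2)⁻¹ * fderiv ℝ (Q.chartSquare hm x) z a := by
      refine ⟨_, (hasFDerivAt_inv' (𝕜 := ℝ) h0).comp z hd.hasFDerivAt, ?_⟩
      simp only [ContinuousLinearMap.comp_apply, neg_apply,
        ContinuousLinearMap.mulLeftRight_apply]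
      ring
    have h2 := h1.mul (hd2.hasFDerivAt.clm_apply (hasFDerivAt_const w z))
    have h3 := (h2.sub (F.differentiableAt_connTrace hm hz.1 w).hasFDerivAt).const_mul (1 / 2 : ℂ)
    rw [(h3.congr_of_eventuallyEq ((Q.eventually_domain hm hz).mono fun _ hq =>
      Q.chartConnForm_eq hm hq w)).fderiv]
    simp only [add_apply, sub_apply, smul_apply, smul_eq_mul, hD,
      ContinuousLinearMap.comp_apply, ContinuousLinearMap.flip_apply, zero_apply, map_zero]
    ring
  have hs : fderiv ℝ (fderiv ℝ (Q.chartSquare hm x)) z (v, 0) (0, u) =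
      fderiv ℝ (fderiv ℝ (Q.chartSquare hm x)) z (0, u) (v, 0) :=
    ((h.of_le two_le_infty).isSymmSndFDerivAt (by simp)).eq _ _
  rw [e, e, hs]
  -- The form is half of `d log c` minus the trace, so the factor `-i/2` for the trace becomes
  -- `i/4`.
  linear_combination (-1 / 2) * F.fderiv_connTrace hm hz.1 v u

end SquareRoot

/-! ### Smooth sections of line bundles and the connection form of the prequantum bundle. -/

section LineBundle

variable {B : Type*} {EB : Type*} [NormedAddCommGroup EB] [NormedSpace ℝ EB]
  {HB : Type*} [TopologicalSpace HB] {IB : ModelWithCorners ℝ EB HB} [TopologicalSpace B]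
  [ChartedSpace HB B] {L : B → Type*} [∀ x, AddCommGroup (L x)]
  [∀ x, Module ℂ (L x)] [∀ x, TopologicalSpace (L x)] [TopologicalSpace (TotalSpace ℂ L)]
  [FiberBundle ℂ L] [VectorBundle ℂ ℂ L] {x₀ x : B}
  [VectorBundle ℝ ℂ L] [ContMDiffVectorBundle ∞ ℂ L IB] [IsManifold IB ∞ B]

theorem contMDiffAt_of_lineCoord (hx : x ∈ (trivializationAt ℂ L x₀).baseSet) {s : Π q, L q}
    (hs : ContMDiffAt IB 𝓘(ℝ, ℂ) ∞ (fun q => lineCoord L x₀ q (s q)) x) :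
    ContMDiffAt IB (IB.prod 𝓘(ℝ, ℂ)) ∞ (fun q => TotalSpace.mk' ℂ q (s q)) x := by
  rw [Trivialization.contMDiffAt_iff (e := trivializationAt ℂ L x₀)
    ((Trivialization.mem_source _).2 hx)]
  refine ⟨contMDiffAt_id, hs.congr_of_eventuallyEq ?_⟩
  filter_upwards [eventually_baseSet hx] with q hq
  rw [lineCoord, Trivialization.linearMapAt_apply, if_pos hq]

theorem contMDiffAt_smul_section {g : B → ℂ} (hg : ContMDiffAt IB 𝓘(ℝ, ℂ) ∞ g x) {s : Π q, L q}
    (hs : ContMDiffAt IB (IB.prod 𝓘(ℝ, ℂ)) ∞ (fun q => TotalSpace.mk' ℂ q (s q)) x) :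
    ContMDiffAt IB (IB.prod 𝓘(ℝ, ℂ)) ∞ (fun q => TotalSpace.mk' ℂ q (g q • s q)) x := by
  have hx := FiberBundle.mem_baseSet_trivializationAt' (F := ℂ) (E := L) x
  refine contMDiffAt_of_lineCoord hx ?_
  simp only [map_smul, smul_eq_mul]
  exact (contDiff_mul (𝕜 := ℝ) (𝔸 := ℂ)).contMDiff.contMDiffAt.comp x
    (hg.prodMk_space (contMDiffAt_lineCoord hx hs))

end LineBundle

section Prequantum

variable {E : Type*} [NormedAddCommGroup E] [NormedSpace ℝ E] [FiniteDimensional ℝ E]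
  {M : Type*} [TopologicalSpace M] [ChartedSpace E M] [IsManifold 𝓘(ℝ, E) ∞ M]
  {Ω : SymplecticForm E M}
  {L : M → Type*} [∀ p, AddCommGroup (L p)] [∀ p, Module ℂ (L p)] [∀ p, TopologicalSpace (L p)]
  [∀ p, IsTopologicalAddGroup (L p)] [∀ p, ContinuousSMul ℝ (L p)]
  [TopologicalSpace (TotalSpace ℂ L)] [FiberBundle ℂ L] [VectorBundle ℂ ℂ L] [VectorBundle ℝ ℂ L]
  [ContMDiffVectorBundle ∞ ℂ L 𝓘(ℝ, E)] (P : PrequantumStructure Ω L) {p₀ p : M}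

/-- The Leibniz rule for complex functions. -/
theorem PrequantumStructure.conn_smul {g : M → ℂ} (hg : ContMDiffAt 𝓘(ℝ, E) 𝓘(ℝ, ℂ) ∞ g p)
    {s : Π q, L q}
    (hs : ContMDiffAt 𝓘(ℝ, E) (𝓘(ℝ, E).prod 𝓘(ℝ, ℂ)) ∞ (fun q => TotalSpace.mk' ℂ q (s q)) p)
    (v : TangentSpace 𝓘(ℝ, E) p) :
    P.conn (fun q => g q • s q) p v = mvfderiv 𝓘(ℝ, E) g p v • s p + g p • P.conn s p v := by
  have hs1 : MDifferentiableAt 𝓘(ℝ, E) (𝓘(ℝ, E).prod 𝓘(ℝ, ℂ))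
      (fun q => TotalSpace.mk' ℂ q (s q)) p := hs.mdifferentiableAt (by simp)
  have hI : MDifferentiableAt 𝓘(ℝ, E) (𝓘(ℝ, E).prod 𝓘(ℝ, ℂ))
      (fun q => TotalSpace.mk' ℂ q (Complex.I • s q)) p :=
    (contMDiffAt_smul_section (contMDiffAt_const (c := Complex.I)) hs).mdifferentiableAt (by simp)
  have hr : MDifferentiableAt 𝓘(ℝ, E) 𝓘(ℝ, ℝ) (fun q => (g q).re) p :=
    (Complex.reCLM.contMDiff.contMDiffAt.comp p hg).mdifferentiableAt (n := ∞) (by simp)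
  have hi : MDifferentiableAt 𝓘(ℝ, E) 𝓘(ℝ, ℝ) (fun q => (g q).im) p :=
    (Complex.imCLM.contMDiff.contMDiffAt.comp p hg).mdifferentiableAt (n := ∞) (by simp)
  -- The Leibniz rule of a covariant derivative is for real functions. Splitting `g` into real and
  -- imaginary parts reduces to it, with multiplication by `i` commuting with the connection.
  have e : (fun q => g q • s q) =
      (fun q => (g q).re) • s + (fun q => (g q).im) • fun q => Complex.I • s q := by
    ext q
    simp only [Pi.add_apply, Pi.smul_apply']
    rw [← Complex.coe_smul, ← Complex.coe_smul, smul_smul, ← add_smul, Complex.re_add_im]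
  have hgd := hg.mdifferentiableAt (by simp)
  have dr : mvfderiv 𝓘(ℝ, E) (fun q => (g q).re) p v = (mvfderiv 𝓘(ℝ, E) g p v).re :=
    mvfderiv_clm_comp Complex.reCLM hgd v
  have di : mvfderiv 𝓘(ℝ, E) (fun q => (g q).im) p v = (mvfderiv 𝓘(ℝ, E) g p v).im :=
    mvfderiv_clm_comp Complex.imCLM hgd v
  have h1 := P.conn.isCovariantDerivativeOnUniv.leibniz hs1 hr
  have h2 := P.conn.isCovariantDerivativeOnUniv.leibniz hI hi
  have h3 := P.conn.isCovariantDerivativeOnUniv.add (hr.smul_section hs1) (hi.smul_section hI)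
  have h4 : P.conn (fun q => g q • s q) p v = (g p).re • P.conn s p v +
      (mvfderiv 𝓘(ℝ, E) g p v).re • s p + ((g p).im • P.conn (fun q => Complex.I • s q) p v +
      (mvfderiv 𝓘(ℝ, E) g p v).im • Complex.I • s p) := by
    rw [e, ← dr, ← di]
    exact (congrArg (fun l => l v) h3).trans (congrArg₂ (fun l l' => l v + l' v) h1 h2)
  rw [h4, P.conn_I_smul p s v hs]
  conv_rhs => rw [← Complex.re_add_im (mvfderiv 𝓘(ℝ, E) g p v), ← Complex.re_add_im (g p)]
  simp only [add_smul, mul_smul, Complex.coe_smul]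
  abel

/-- The connection form of `L` in the frame `lineFrame L p₀`. -/
def PrequantumStructure.connForm (p₀ p : M) (u : TangentSpace 𝓘(ℝ, E) p) : ℂ :=
  lineCoord L p₀ p (P.conn (lineFrame L p₀) p u)

theorem PrequantumStructure.conn_lineFrame (hp : p ∈ (trivializationAt ℂ L p₀).baseSet)
    (u : TangentSpace 𝓘(ℝ, E) p) :
    P.conn (lineFrame L p₀) p u = P.connForm p₀ p u • lineFrame L p₀ p :=
  (lineCoord_smul_lineFrame hp _).symm

/-- The change of the connection form under a change of frame. -/
theorem PrequantumStructure.connForm_change {p₁ : M} (hp : p ∈ (trivializationAt ℂ L p₀).baseSet)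
    (hp₁ : p ∈ (trivializationAt ℂ L p₁).baseSet) (u : TangentSpace 𝓘(ℝ, E) p) :
    lineCoord L p₁ p (lineFrame L p₀ p) * P.connForm p₀ p u =
      mvfderiv 𝓘(ℝ, E) (fun q => lineCoord L p₁ q (lineFrame L p₀ q)) p u +
        lineCoord L p₁ p (lineFrame L p₀ p) * P.connForm p₁ p u := by
  have hg := contMDiffAt_lineCoord hp₁ (contMDiffAt_lineFrame (IB := 𝓘(ℝ, E)) hp)
  have hs := contMDiffAt_lineFrame (IB := 𝓘(ℝ, E)) hp₁
  have h := P.conn_smul hg hs u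
  have e : P.conn (lineFrame L p₀) p =
      P.conn (fun q => lineCoord L p₁ q (lineFrame L p₀ q) • lineFrame L p₁ q) p :=
    P.conn.isCovariantDerivativeOnUniv.congr_of_eventuallyEq
      ((contMDiffAt_lineFrame hp).mdifferentiableAt (by simp))
      ((contMDiffAt_smul_section hg hs).mdifferentiableAt (by simp)) Filter.univ_mem <| by
        filter_upwards [eventually_baseSet hp₁] with q hq
        exact (lineCoord_smul_lineFrame hq _).symm
  have h2 := congrArg (fun l => lineCoord L p₁ p (l u)) e
  refine Eq.trans ?_ (h2.trans ?_)
  · exact lineCoord_mul_lineCoord hp _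
  · refine (congrArg _ h).trans ?_
    rw [map_add, map_smul, map_smul, lineCoord_lineFrame hp₁, smul_eq_mul, mul_one, smul_eq_mul]
    rfl

end Prequantum

/-! ### The reference connection in a single local frame. -/

section Twisted

variable {E : Type*} [NormedAddCommGroup E] [NormedSpace ℝ E] [FiniteDimensional ℝ E]
  {M : Type*} [TopologicalSpace M] [ChartedSpace E M] [IsManifold 𝓘(ℝ, E) ∞ M]
  {ES : Type*} [NormedAddCommGroup ES] [NormedSpace ℝ ES] [FiniteDimensional ℝ ES]
  {S : Type*} [TopologicalSpace S] [ChartedSpace ES S] [IsManifold 𝓘(ℝ, ES) ∞ S]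
  {Ω : SymplecticForm E M} {x x₁ y : S × M} {z : ES × E}
  {m : ℕ} (hm : finrank ℝ E = 2 * m)
  {L : M → Type*} [∀ p, AddCommGroup (L p)] [∀ p, Module ℂ (L p)] [∀ p, TopologicalSpace (L p)]
  [∀ p, IsTopologicalAddGroup (L p)] [∀ p, ContinuousSMul ℝ (L p)]
  [TopologicalSpace (TotalSpace ℂ L)] [FiberBundle ℂ L] [VectorBundle ℂ ℂ L] [VectorBundle ℝ ℂ L]
  [ContMDiffVectorBundle ∞ ℂ L 𝓘(ℝ, E)]
  {δ : S × M → Type*} [∀ x, AddCommGroup (δ x)] [∀ x, Module ℂ (δ x)]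
  [∀ x, TopologicalSpace (δ x)] [∀ x, IsTopologicalAddGroup (δ x)] [∀ x, ContinuousSMul ℝ (δ x)]
  [TopologicalSpace (TotalSpace ℂ δ)] [FiberBundle ℂ δ] [VectorBundle ℂ ℂ δ] [VectorBundle ℝ ℂ δ]
  [ContMDiffVectorBundle ∞ ℂ δ (𝓘(ℝ, ES).prod 𝓘(ℝ, E))] {k : ℕ}
  {F : CompatibleFamily Ω ES S} (P : PrequantumStructure Ω L) (Q : SquareRoot F m δ)

local notation "𝓙" => ModelWithCorners.prod 𝓘(ℝ, ES) 𝓘(ℝ, E)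

variable (L δ k) in
/-- The local frame of `L̂^k ⊗ δ` around `x`. -/
def twistedFrame (x y : S × M) : Twisted L δ k y :=
  (⨂ₜ[ℂ] _ : Fin k, lineFrame L x.2 y.2) ⊗ₜ[ℂ] lineFrame δ x y

theorem twistedCoord_tmul (v : Fin k → L y.2) (w : δ y) :
    twistedCoord L δ k x y ((⨂ₜ[ℂ] i, v i) ⊗ₜ[ℂ] w) =
      (∏ i, lineCoord L x.2 y.2 (v i)) * lineCoord δ x y w := by
  simp [twistedCoord]

theorem twistedCoord_twistedFrame : twistedCoord L δ k x₁ y (twistedFrame L δ k x y) =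
    lineCoord L x₁.2 y.2 (lineFrame L x.2 y.2) ^ k * lineCoord δ x₁ y (lineFrame δ x y) := by
  rw [twistedFrame, twistedCoord_tmul, Finset.prod_const, Finset.card_univ, Fintype.card_fin]

theorem twistedCoord_twistedFrame_self (hL : y.2 ∈ (trivializationAt ℂ L x.2).baseSet)
    (hδ : y ∈ (trivializationAt ℂ δ x).baseSet) :
    twistedCoord L δ k x y (twistedFrame L δ k x y) = 1 := by
  rw [twistedCoord_twistedFrame, lineCoord_lineFrame hL, lineCoord_lineFrame hδ, one_pow, mul_one]

theorem twistedCoord_smul_twistedFrame (hL : y.2 ∈ (trivializationAt ℂ L x.2).baseSet)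
    (hδ : y ∈ (trivializationAt ℂ δ x).baseSet) (w : Twisted L δ k y) :
    twistedCoord L δ k x y w • twistedFrame L δ k x y = w := by
  have h : LinearMap.toSpanSingleton ℂ _ (twistedFrame L δ k x y) ∘ₗ twistedCoord L δ k x y =
      LinearMap.id := by
    ext v w
    simp only [LinearMap.compMultilinearMap_apply, TensorProduct.AlgebraTensorModule.curry_apply,
      TensorProduct.curry_apply, LinearMap.restrictScalars_self, LinearMap.comp_apply,
      twistedCoord_tmul, LinearMap.toSpanSingleton_apply, LinearMap.id_apply, twistedFrame]
    rw [← TensorProduct.smul_tmul_smul, lineCoord_smul_lineFrame hδ,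
      ← MultilinearMap.map_smul_univ]
    simp only [lineCoord_smul_lineFrame hL]
  exact LinearMap.congr_fun h w

theorem twistedCoord_mul_twistedCoord (hL : y.2 ∈ (trivializationAt ℂ L x.2).baseSet)
    (hδ : y ∈ (trivializationAt ℂ δ x).baseSet) (w : Twisted L δ k y) :
    twistedCoord L δ k x₁ y (twistedFrame L δ k x y) * twistedCoord L δ k x y w =
      twistedCoord L δ k x₁ y w := by
  conv_rhs => rw [← twistedCoord_smul_twistedFrame hL hδ w]
  rw [map_smul, smul_eq_mul, mul_comm]

/-- A frame pulled back from `M` is constant along `S`, so only the connection of `L` contributes.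
-/
theorem pullbackConn_lineFrame (v : TangentSpace 𝓙 y) :
    pullbackConn (ES := ES) P.conn (fun q : S × M => lineFrame L y.2 q.2) y v =
      P.connForm y.2 y.2 (mfderiv 𝓙 𝓘(ℝ, E) Prod.snd y v) • lineFrame L y.2 y.2 := by
  have h : mvfderiv 𝓘(ℝ, ES) (fun _ : S => lineCoord L y.2 y.2 (lineFrame L y.2 y.2)) y.1 = 0 := by
    have h1 := hasMFDerivAt_const (I := 𝓘(ℝ, ES)) (I' := 𝓘(ℝ, ℂ))
      (lineCoord L y.2 y.2 (lineFrame L y.2 y.2)) y.1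
    exact h1.mfderiv
  rw [pullbackConn, h]
  simp only [ContinuousLinearMap.comp_apply, ContinuousLinearMap.zero_comp,
    ContinuousLinearMap.comp_zero, add_zero]
  exact P.conn_lineFrame (FiberBundle.mem_baseSet_trivializationAt' y.2) _

/-- The connection form of the reference connection in the frame `twistedFrame L δ k x`. -/
def referenceForm (k : ℕ) (x y : S × M) (v : TangentSpace 𝓙 y) : ℂ :=
  k * P.connForm x.2 y.2 (mfderiv 𝓙 𝓘(ℝ, E) Prod.snd y v) +
    lineCoord δ x y (Q.conn hm (lineFrame δ x) y v)

/-- Each of the `k` slots of the tensor power contributes the same multiple of the frame, so the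
terms of the Leibniz rule collapse to one scalar form. -/
theorem referenceConn_eq (s : Π y, Twisted L δ k y) (v : TangentSpace 𝓙 y) :
    referenceConn P Q hm k s y v = (mvfderiv 𝓙 (fun q => twistedCoord L δ k y q (s q)) y v +
      twistedCoord L δ k y y (s y) * referenceForm hm P Q k y y v) • twistedFrame L δ k y y := by
  have hδ := FiberBundle.mem_baseSet_trivializationAt' (F := ℂ) (E := δ) y
  have h1 : ∀ c : ℂ, ∑ j : Fin k, PiTensorProduct.tprod ℂ
      (Function.update (fun _ => lineFrame L y.2 y.2) j (c • lineFrame L y.2 y.2)) =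
      ((k : ℂ) * c) • PiTensorProduct.tprod ℂ (fun _ : Fin k => lineFrame L y.2 y.2) := fun c => by
    simp only [MultilinearMap.map_update_smul, Function.update_eq_self, Finset.sum_const,
      Finset.card_univ, Fintype.card_fin, mul_smul, Nat.cast_smul_eq_nsmul]
  simp only [referenceConn]
  rw [pullbackConn_lineFrame, h1, ← lineCoord_smul_lineFrame hδ (Q.conn hm (lineFrame δ y) y v),
    ← TensorProduct.smul_tmul', TensorProduct.tmul_smul, ← add_smul, smul_smul, ← add_smul]
  rfl

/-- Change of frame for the connection form of `δ`. It follows from the definition at `y`, since the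
frame around `y` has coordinate constantly `1` near `y`. -/
theorem SquareRoot.conn_change (hy : y ∈ (trivializationAt ℂ δ x).baseSet)
    (v : TangentSpace 𝓙 y) :
    lineCoord δ y y (lineFrame δ x y) * lineCoord δ x y (Q.conn hm (lineFrame δ x) y v) =
      mvfderiv 𝓙 (fun q => lineCoord δ y q (lineFrame δ x q)) y v +
        lineCoord δ y y (lineFrame δ x y) *
          lineCoord δ y y (Q.conn hm (lineFrame δ y) y v) := by
  have hyy := FiberBundle.mem_baseSet_trivializationAt' (F := ℂ) (E := δ) y
  have h : mvfderiv 𝓙 (fun q => lineCoord δ y q (lineFrame δ y q)) y v = 0 := by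
    have h0 : (fun q => lineCoord δ y q (lineFrame δ y q)) =ᶠ[𝓝 y] fun _ => (1 : ℂ) := by
      filter_upwards [eventually_baseSet hyy] with q hq using lineCoord_lineFrame hq
    have h1 := (hasMFDerivAt_const (I := 𝓙) (I' := 𝓘(ℝ, ℂ)) (1 : ℂ) y).congr_of_eventuallyEq h0
    exact congrArg (fun l : TangentSpace 𝓙 y →L[ℝ] ℂ => l v) h1.mfderiv
  rw [lineCoord_mul_lineCoord hy, Q.conn_eq, Q.conn_eq, map_smul, map_smul, h,
    lineCoord_lineFrame hyy]
  simp

/-- The reference connection in the frame around `x`. -/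
theorem twistedCoord_referenceConn (hy : y ∈ (extChartAt 𝓙 x).source)
    (hL : y.2 ∈ (trivializationAt ℂ L x.2).baseSet) (hδ : y ∈ (trivializationAt ℂ δ x).baseSet)
    {s : Π y, Twisted L δ k y}
    (hs : MDifferentiableAt 𝓙 𝓘(ℝ, ℂ) (fun q => twistedCoord L δ k x q (s q)) y)
    (v : TangentSpace 𝓙 y) :
    twistedCoord L δ k x y (referenceConn P Q hm k s y v) =
      mvfderiv 𝓙 (fun q => twistedCoord L δ k x q (s q)) y v +
        twistedCoord L δ k x y (s y) * referenceForm hm P Q k x y v := by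
  have hδy := FiberBundle.mem_baseSet_trivializationAt' (F := ℂ) (E := δ) y
  have hLy := FiberBundle.mem_baseSet_trivializationAt' (F := ℂ) (E := L) y.2
  set g₁ : M → ℂ := fun p => lineCoord L y.2 p (lineFrame L x.2 p) with hg₁
  set g₂ : S × M → ℂ := fun q => lineCoord δ y q (lineFrame δ x q) with hg₂
  set f : S × M → ℂ := fun q => twistedCoord L δ k x q (s q) with hf
  have d₁ : MDifferentiableAt 𝓘(ℝ, E) 𝓘(ℝ, ℂ) g₁ y.2 :=
    (contMDiffAt_lineCoord hLy (contMDiffAt_lineFrame hL)).mdifferentiableAt (by simp)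
  have d₂ : MDifferentiableAt 𝓙 𝓘(ℝ, ℂ) g₂ y :=
    (contMDiffAt_lineCoord hδy (contMDiffAt_lineFrame hδ)).mdifferentiableAt (by simp)
  have dc : MDifferentiableAt 𝓙 𝓘(ℝ, ℂ) (fun q : S × M => g₁ q.2) y :=
    d₁.comp y mdifferentiableAt_snd
  have hc : mvfderiv 𝓘(ℝ, E) g₁ y.2 (mfderiv 𝓙 𝓘(ℝ, E) Prod.snd y v) =
      mvfderiv 𝓙 (fun q : S × M => g₁ q.2) y v :=
    (congrArg (fun l : TangentSpace 𝓙 y →L[ℝ] ℂ => l v)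
      (mfderiv_comp y d₁ (mdifferentiableAt_snd (I := 𝓘(ℝ, ES)) (I' := 𝓘(ℝ, E))))).symm
  have c₁ := P.connForm_change hL hLy (mfderiv 𝓙 𝓘(ℝ, E) Prod.snd y v)
  have c₂ := Q.conn_change hm hδ v
  rw [hc, mvfderiv_eq_fderiv hy dc v] at c₁
  rw [mvfderiv_eq_fderiv hy d₂ v] at c₂
  have hfd := mvfderiv_eq_fderiv hy hs v
  have D₁ := (differentiableAt_comp_symm hy dc).hasFDerivAt
  have D₂ := (differentiableAt_comp_symm hy d₂).hasFDerivAt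
  have Df := (differentiableAt_comp_symm hy hs).hasFDerivAt
  have D := ((D₁.pow k).mul D₂).mul Df
  -- The definition at `y` uses the frame around `y`; passing to it from the frame around `x`
  -- multiplies coordinates by `g₁ ^ k * g₂`, and the derivative of this factor compensates the
  -- change of the connection forms.
  have e : (fun q => twistedCoord L δ k y q (s q)) =ᶠ[𝓝 y]
      fun q => g₁ q.2 ^ k * g₂ q * f q := by
    filter_upwards [(continuous_snd.continuousAt (x := y)).eventually (eventually_baseSet hL),
      eventually_baseSet hδ] with q hq₁ hq₂
    rw [← twistedCoord_mul_twistedCoord hq₁ hq₂ (s q), twistedCoord_twistedFrame]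
  have hl : (extChartAt 𝓙 x).symm (extChartAt 𝓙 x y) = y := (extChartAt 𝓙 x).left_inv hy
  have e' : (fun q => twistedCoord L δ k y q (s q)) ∘ (extChartAt 𝓙 x).symm
      =ᶠ[𝓝 (extChartAt 𝓙 x y)] (((fun q : S × M => g₁ q.2) ∘ (extChartAt 𝓙 x).symm) ^ k *
        (g₂ ∘ (extChartAt 𝓙 x).symm)) * (f ∘ (extChartAt 𝓙 x).symm) := by
    have hcont := continuousAt_symm (I := 𝓙) ((extChartAt 𝓙 x).map_source hy)
    rw [ContinuousAt, hl] at hcont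
    exact hcont.eventually e
  have D' := D.congr_of_eventuallyEq e'
  have hv := (mvfderiv_eq_fderiv_of_differentiableAt hy D'.differentiableAt).2 v
  rw [D'.fderiv] at hv
  have hT : (g₁ y.2 ^ k * g₂ y) * twistedCoord L δ k x y (twistedFrame L δ k y y) = 1 := by
    have h := twistedCoord_mul_twistedCoord (x₁ := y) hL hδ (twistedFrame L δ k y y)
    rwa [twistedCoord_twistedFrame, twistedCoord_twistedFrame_self hLy hδy] at h
  -- Natural subtraction makes `k - 1` equal to `0` when `k = 0`; the factor `k` then kills both
  -- sides.
  have hk : (k : ℂ) * g₁ y.2 ^ k = k * g₁ y.2 ^ (k - 1) * g₁ y.2 := by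
    rcases k with _ | k
    · simp
    · rw [Nat.add_sub_cancel, pow_succ, mul_assoc]
  have hsy : twistedCoord L δ k y y (s y) = g₁ y.2 ^ k * g₂ y * f y := e.self_of_nhds
  have e₁ : ((fun q : S × M => g₁ q.2) ∘ (extChartAt 𝓙 x).symm) (extChartAt 𝓙 x y) = g₁ y.2 := by
    rw [Function.comp_apply, hl]
  have e₂ : (g₂ ∘ (extChartAt 𝓙 x).symm) (extChartAt 𝓙 x y) = g₂ y := by
    rw [Function.comp_apply, hl]
  have e₃ : (f ∘ (extChartAt 𝓙 x).symm) (extChartAt 𝓙 x y) = f y := by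
    rw [Function.comp_apply, hl]
  simp only [add_apply, smul_apply, smul_eq_mul, Pi.mul_apply, e₁, e₂, e₃,
    nsmul_eq_mul] at hv
  rw [referenceConn_eq, map_smul, smul_eq_mul, hv, hsy, hfd, referenceForm, referenceForm]
  change g₁ y.2 * _ = _ + g₁ y.2 * _ at c₁
  change g₂ y * _ = _ + g₂ y * _ at c₂
  change _ = _ + f y * _
  generalize P.connForm x.2 y.2 (mfderiv 𝓙 𝓘(ℝ, E) Prod.snd y v) = α at *
  generalize P.connForm y.2 y.2 (mfderiv 𝓙 𝓘(ℝ, E) Prod.snd y v) = a at *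
  generalize lineCoord δ x y (Q.conn hm (lineFrame δ x) y v) = θ at *
  generalize lineCoord δ y y (Q.conn hm (lineFrame δ y) y v) = b at *
  generalize fderiv ℝ (f ∘ (extChartAt 𝓙 x).symm) (extChartAt 𝓙 x y) (chartDiff 𝓙 x y v) = df
  generalize twistedCoord L δ k x y (twistedFrame L δ k y y) = T at *
  -- The weights of `c₁` and `c₂` eliminate the derivatives of the two transition functions, and
  -- `hT` removes the remaining factor.
  linear_combination (df + f y * (k * α + θ)) * hT + T * (-(f y * g₁ y.2 ^ k) * c₂ -
    f y * g₂ y * k * g₁ y.2 ^ (k - 1) * c₁ + f y * g₂ y * (a - α) * hk)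

end Twisted

/-! ### The connection form of the reference connection in coordinates. -/

section Reference

variable {E : Type*} [NormedAddCommGroup E] [NormedSpace ℝ E] [FiniteDimensional ℝ E]
  {M : Type*} [TopologicalSpace M] [ChartedSpace E M] [IsManifold 𝓘(ℝ, E) ∞ M]
  {ES : Type*} [NormedAddCommGroup ES] [NormedSpace ℝ ES] [FiniteDimensional ℝ ES]
  {S : Type*} [TopologicalSpace S] [ChartedSpace ES S] [IsManifold 𝓘(ℝ, ES) ∞ S]
  {Ω : SymplecticForm E M} {x y : S × M} {z : ES × E}
  {m : ℕ} (hm : finrank ℝ E = 2 * m)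
  {L : M → Type*} [∀ p, AddCommGroup (L p)] [∀ p, Module ℂ (L p)] [∀ p, TopologicalSpace (L p)]
  [∀ p, IsTopologicalAddGroup (L p)] [∀ p, ContinuousSMul ℝ (L p)]
  [TopologicalSpace (TotalSpace ℂ L)] [FiberBundle ℂ L] [VectorBundle ℂ ℂ L] [VectorBundle ℝ ℂ L]
  [ContMDiffVectorBundle ∞ ℂ L 𝓘(ℝ, E)]
  {δ : S × M → Type*} [∀ x, AddCommGroup (δ x)] [∀ x, Module ℂ (δ x)]
  [∀ x, TopologicalSpace (δ x)] [∀ x, IsTopologicalAddGroup (δ x)] [∀ x, ContinuousSMul ℝ (δ x)]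
  [TopologicalSpace (TotalSpace ℂ δ)] [FiberBundle ℂ δ] [VectorBundle ℂ ℂ δ] [VectorBundle ℝ ℂ δ]
  [ContMDiffVectorBundle ∞ ℂ δ (𝓘(ℝ, ES).prod 𝓘(ℝ, E))] {k : ℕ}
  (P : PrequantumStructure Ω L)

local notation "𝓙" => ModelWithCorners.prod 𝓘(ℝ, ES) 𝓘(ℝ, E)

/-- The connection form of `L` in the frame `lineFrame L p₀`, in coordinates. -/
def PrequantumStructure.chartConnForm (p₀ : M) (z w : E) : ℂ :=
  P.connForm p₀ ((extChartAt 𝓘(ℝ, E) p₀).symm z)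
    (chartFrame 𝓘(ℝ, E) p₀ w ((extChartAt 𝓘(ℝ, E) p₀).symm z))

theorem PrequantumStructure.isLinearMap_chartConnForm (p₀ : M) (z : E) :
    IsLinearMap ℝ (P.chartConnForm p₀ z) := by
  constructor
  · intro w w'
    simp only [PrequantumStructure.chartConnForm, PrequantumStructure.connForm, chartFrame_add,
      map_add]
  · intro c w
    simp only [PrequantumStructure.chartConnForm, PrequantumStructure.connForm, chartFrame_smul,
      map_smul]
    exact map_smul ((lineCoord L p₀ ((extChartAt 𝓘(ℝ, E) p₀).symm z)).restrictScalars ℝ) c _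

theorem PrequantumStructure.differentiableAt_chartConnForm (p₀ : M) (w : E) :
    DifferentiableAt ℝ (fun z => P.chartConnForm p₀ z w) (extChartAt 𝓘(ℝ, E) p₀ p₀) := by
  have hp := mem_extChartAt_source (I := 𝓘(ℝ, E)) p₀
  have hb := FiberBundle.mem_baseSet_trivializationAt' (F := ℂ) (E := L) p₀
  have h := contMDiffAt_lineCoord hb (P.conn_contMDiff p₀ (lineFrame L p₀)
    (chartFrame 𝓘(ℝ, E) p₀ w) (contMDiffAt_lineFrame hb) (contMDiffAt_chartFrame hp w))
  exact (contDiffAt_comp_symm le_rfl hp h).differentiableAt (by simp)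

variable {F : CompatibleFamily Ω ES S} (Q : SquareRoot F m δ)

/-- The connection form of the reference connection in coordinates. -/
def chartReferenceForm (k : ℕ) (x : S × M) (z w : ES × E) : ℂ :=
  k * P.chartConnForm x.2 z.2 w.2 + Q.chartConnForm hm x z w

theorem isLinearMap_chartReferenceForm : IsLinearMap ℝ (chartReferenceForm hm P Q k x z) := by
  have h₁ := P.isLinearMap_chartConnForm x.2 z.2
  have h₂ := Q.isLinearMap_chartConnForm hm (x := x) (z := z)
  constructor
  · intro w w'
    simp only [chartReferenceForm, Prod.snd_add, h₁.map_add, h₂.map_add]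
    ring
  · intro c w
    simp only [chartReferenceForm, Prod.smul_snd, h₁.map_smul, h₂.map_smul, Complex.real_smul]
    ring

theorem referenceForm_eq (hy : y ∈ (extChartAt 𝓙 x).source) (v : TangentSpace 𝓙 y) :
    referenceForm hm P Q k x y v =
      chartReferenceForm hm P Q k x (extChartAt 𝓙 x y) (chartDiff 𝓙 x y v) := by
  have hy2 := (mem_source_prod.1 hy).2
  have h₁ : P.connForm x.2 y.2 (mfderiv 𝓙 𝓘(ℝ, E) Prod.snd y v) =
      P.chartConnForm x.2 (extChartAt 𝓘(ℝ, E) x.2 y.2)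
        (chartDiff 𝓘(ℝ, E) x.2 y.2 (mfderiv 𝓙 𝓘(ℝ, E) Prod.snd y v)) := by
    rw [PrequantumStructure.chartConnForm, (extChartAt 𝓘(ℝ, E) x.2).left_inv hy2,
      chartFrame_chartDiff hy2]
  have h₂ : lineCoord δ x y (Q.conn hm (lineFrame δ x) y v) =
      Q.chartConnForm hm x (extChartAt 𝓙 x y) (chartDiff 𝓙 x y v) := by
    rw [SquareRoot.chartConnForm, (extChartAt 𝓙 x).left_inv hy, chartFrame_chartDiff hy]
  rw [referenceForm, h₁, h₂, chartReferenceForm, chartDiff_prod hy, extChartAt_prod_apply]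

theorem differentiableAt_chartConnForm_snd (x : S × M) (w : E) :
    DifferentiableAt ℝ (fun z : ES × E => P.chartConnForm x.2 z.2 w) (extChartAt 𝓙 x x) := by
  have h := P.differentiableAt_chartConnForm x.2 w
  refine DifferentiableAt.comp (extChartAt 𝓙 x x) (g := fun z => P.chartConnForm x.2 z w) ?_
    differentiableAt_snd
  rwa [extChartAt_prod_apply]

theorem differentiableAt_chartReferenceForm (w : ES × E) :
    DifferentiableAt ℝ (fun z => chartReferenceForm hm P Q k x z w) (extChartAt 𝓙 x x) :=
  ((differentiableAt_chartConnForm_snd P x w.2).const_mul _).add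
    (Q.differentiableAt_chartConnForm hm (Q.mem_domain_self hm) w)

/-- The form of `L` is pulled back from `M`: its coefficients do not vary along `(v, 0)`, and it
vanishes on `(v, 0)`. Only the form of `δ` contributes to the mixed component. -/
theorem fderiv_chartReferenceForm (F : KahlerFamily Ω ES S)
    (Q : SquareRoot F.toCompatibleFamily m δ) (v : ES) (u : E) :
    fderiv ℝ (fun z => chartReferenceForm hm P Q k x z (0, u)) (extChartAt 𝓙 x x) (v, 0) -
      fderiv ℝ (fun z => chartReferenceForm hm P Q k x z (v, 0)) (extChartAt 𝓙 x x) (0, u) =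
    Complex.I / 4 * ((F.chartJ x (extChartAt 𝓙 x x) *
      matDeriv (F.chartChristoffel x u) (extChartAt 𝓙 x x) (v, 0)).trace : ℝ) := by
  have hz := Q.mem_domain_self hm (x := x)
  have e : ∀ a w, fderiv ℝ (fun z => chartReferenceForm hm P Q k x z w) (extChartAt 𝓙 x x) a =
      k * fderiv ℝ (fun z : ES × E => P.chartConnForm x.2 z.2 w.2) (extChartAt 𝓙 x x) a +
        fderiv ℝ (fun z => Q.chartConnForm hm x z w) (extChartAt 𝓙 x x) a := fun a w => by
    have h := ((differentiableAt_chartConnForm_snd P x w.2).hasFDerivAt.const_mul (k : ℂ)).add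
      (Q.differentiableAt_chartConnForm hm hz w).hasFDerivAt
    exact congrArg (fun l : ES × E →L[ℝ] ℂ => l a) h.fderiv
  have h₀ : (fun z : ES × E => P.chartConnForm x.2 z.2 0) = fun _ => 0 :=
    funext fun z => (P.isLinearMap_chartConnForm x.2 z.2).map_zero
  have h₁ : fderiv ℝ (fun z : ES × E => P.chartConnForm x.2 z.2 u) (extChartAt 𝓙 x x) (v, 0) = 0 := by
    have h := P.differentiableAt_chartConnForm x.2 u
    have h' : DifferentiableAt ℝ (fun z => P.chartConnForm x.2 z u) (extChartAt 𝓙 x x).2 := by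
      rwa [extChartAt_prod_apply]
    have h2 := h'.hasFDerivAt.comp (extChartAt 𝓙 x x) (hasFDerivAt_snd (𝕜 := ℝ) (E := ES) (F := E))
    refine (congrArg (fun l : ES × E →L[ℝ] ℂ => l (v, 0)) h2.fderiv).trans ?_
    exact map_zero (fderiv ℝ (fun z => P.chartConnForm x.2 z u) (extChartAt 𝓙 x x).2)
  rw [e, e, h₁, h₀, ← SquareRoot.fderiv_chartConnForm hm F Q hz v u]
  simp

/-- The reference connection in coordinates. -/
theorem twistedCoord_referenceConn_eq_fderiv (hy : y ∈ (extChartAt 𝓙 x).source)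
    (hL : y.2 ∈ (trivializationAt ℂ L x.2).baseSet) (hδ : y ∈ (trivializationAt ℂ δ x).baseSet)
    {s : Π y, Twisted L δ k y} (hs : DifferentiableAt ℝ
      ((fun q => twistedCoord L δ k x q (s q)) ∘ (extChartAt 𝓙 x).symm) (extChartAt 𝓙 x y))
    (v : TangentSpace 𝓙 y) :
    twistedCoord L δ k x y (referenceConn P Q hm k s y v) =
      fderiv ℝ ((fun q => twistedCoord L δ k x q (s q)) ∘ (extChartAt 𝓙 x).symm)
          (extChartAt 𝓙 x y) (chartDiff 𝓙 x y v) +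
        ((fun q => twistedCoord L δ k x q (s q)) ∘ (extChartAt 𝓙 x).symm) (extChartAt 𝓙 x y) *
          chartReferenceForm hm P Q k x (extChartAt 𝓙 x y) (chartDiff 𝓙 x y v) := by
  obtain ⟨h₁, h₂⟩ := mvfderiv_eq_fderiv_of_differentiableAt hy hs
  rw [twistedCoord_referenceConn hm P Q hy hL hδ h₁ v, h₂, referenceForm_eq hm P Q hy,
    Function.comp_apply, (extChartAt 𝓙 x).left_inv hy]

/-- The covariant derivative of a section along a vector field, in coordinates. -/
theorem eventually_twistedCoord_referenceConn {s : Π y, Twisted L δ k y}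
    (hs : TwistedSmoothAt ES E s x) (X : Π y : S × M, TangentSpace 𝓙 y) :
    ((fun q => twistedCoord L δ k x q (referenceConn P Q hm k s q (X q))) ∘ (extChartAt 𝓙 x).symm)
      =ᶠ[𝓝 (extChartAt 𝓙 x x)] fun z =>
        fderiv ℝ ((fun q => twistedCoord L δ k x q (s q)) ∘ (extChartAt 𝓙 x).symm) z
            (chartField 𝓙 x X z) +
          ((fun q => twistedCoord L δ k x q (s q)) ∘ (extChartAt 𝓙 x).symm) z *
            chartReferenceForm hm P Q k x z (chartField 𝓙 x X z) := by
  have hx := mem_extChartAt_source (I := 𝓙) x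
  have hz := (extChartAt 𝓙 x).map_source hx
  have hf : ContDiffAt ℝ ∞ _ _ := contDiffAt_comp_symm (I := 𝓙) le_rfl hx hs
  have hc := continuousAt_symm (I := 𝓙) hz
  rw [ContinuousAt, (extChartAt 𝓙 x).left_inv hx] at hc
  have hL : ∀ᶠ q : S × M in 𝓝 x, q.2 ∈ (trivializationAt ℂ L x.2).baseSet :=
    (continuous_snd.continuousAt (x := x)).eventually
      (eventually_baseSet (FiberBundle.mem_baseSet_trivializationAt' x.2))
  have hδ := eventually_baseSet (FiberBundle.mem_baseSet_trivializationAt' (F := ℂ) (E := δ) x)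
  filter_upwards [eventually_target hz, hc.eventually hL, hc.eventually hδ,
    (hf.of_le (m := 1) (by simp)).eventually (by simp)] with q hq hqL hqδ hqf
  have hr := (extChartAt 𝓙 x).right_inv hq
  have h := twistedCoord_referenceConn_eq_fderiv hm P Q ((extChartAt 𝓙 x).map_target hq) hqL hqδ
    (s := s) (by rw [hr]; exact hqf.differentiableAt one_ne_zero) (X ((extChartAt 𝓙 x).symm q))
  rw [hr] at h
  exact h

end Reference

section OneForm

variable {G : Type*} [NormedAddCommGroup G] [NormedSpace ℝ G] [FiniteDimensional ℝ G]

/-- Needed to differentiate a covariant derivative `∇_U s` a second time in coordinates. -/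
theorem differentiableAt_oneForm {Θ : G → G → ℂ} {f : G → ℂ} {U : G → G} {z : G}
    (hl : ∀ᶠ y in 𝓝 z, IsLinearMap ℝ (Θ y)) (hd : ∀ w, DifferentiableAt ℝ (fun y => Θ y w) z)
    (hf : ContDiffAt ℝ 2 f z) (hU : DifferentiableAt ℝ U z) :
    DifferentiableAt ℝ (fun y => fderiv ℝ f y (U y) + f y * Θ y (U y)) z := by
  obtain ⟨η, hη, he⟩ := exists_oneForm hl hd
  have hf2 : DifferentiableAt ℝ (fderiv ℝ f) z :=
    (hf.fderiv_right (m := 1) (by norm_num)).differentiableAt one_ne_zero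
  refine ((hf2.clm_apply hU).add ((hf.differentiableAt two_ne_zero).mul
    (hη.clm_apply hU))).congr_of_eventuallyEq ?_
  filter_upwards [he] with y hy
  rw [← hy]
  rfl

end OneForm

section Reference

variable {E : Type*} [NormedAddCommGroup E] [NormedSpace ℝ E] [FiniteDimensional ℝ E]
  {M : Type*} [TopologicalSpace M] [ChartedSpace E M] [IsManifold 𝓘(ℝ, E) ∞ M]
  {ES : Type*} [NormedAddCommGroup ES] [NormedSpace ℝ ES] [FiniteDimensional ℝ ES]
  {S : Type*} [TopologicalSpace S] [ChartedSpace ES S] [IsManifold 𝓘(ℝ, ES) ∞ S]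
  {Ω : SymplecticForm E M} {x y : S × M} {z : ES × E}
  {m : ℕ} (hm : finrank ℝ E = 2 * m)
  {L : M → Type*} [∀ p, AddCommGroup (L p)] [∀ p, Module ℂ (L p)] [∀ p, TopologicalSpace (L p)]
  [∀ p, IsTopologicalAddGroup (L p)] [∀ p, ContinuousSMul ℝ (L p)]
  [TopologicalSpace (TotalSpace ℂ L)] [FiberBundle ℂ L] [VectorBundle ℂ ℂ L] [VectorBundle ℝ ℂ L]
  [ContMDiffVectorBundle ∞ ℂ L 𝓘(ℝ, E)]
  {δ : S × M → Type*} [∀ x, AddCommGroup (δ x)] [∀ x, Module ℂ (δ x)]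
  [∀ x, TopologicalSpace (δ x)] [∀ x, IsTopologicalAddGroup (δ x)] [∀ x, ContinuousSMul ℝ (δ x)]
  [TopologicalSpace (TotalSpace ℂ δ)] [FiberBundle ℂ δ] [VectorBundle ℂ ℂ δ] [VectorBundle ℝ ℂ δ]
  [ContMDiffVectorBundle ∞ ℂ δ (𝓘(ℝ, ES).prod 𝓘(ℝ, E))] {k : ℕ}
  (P : PrequantumStructure Ω L)

local notation "𝓙" => ModelWithCorners.prod 𝓘(ℝ, ES) 𝓘(ℝ, E)

variable {F : CompatibleFamily Ω ES S} (Q : SquareRoot F m δ)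

/-- In one frame the connection is `d + Θ` on coordinate functions, the bracket is the bracket of
the coordinate fields, and the curvature is therefore multiplication by `dΘ`. -/
theorem twistedCoord_curvature {V X : Π y : S × M, TangentSpace 𝓙 y} {s : Π y, Twisted L δ k y}
    (hV : DifferentiableAt ℝ (chartField 𝓙 x V) (extChartAt 𝓙 x x))
    (hX : DifferentiableAt ℝ (chartField 𝓙 x X) (extChartAt 𝓙 x x))
    (hs : TwistedSmoothAt ES E s x) :
    twistedCoord L δ k x x (curvature 𝓙 (referenceConn P Q hm k) V X s x) =
      (fderiv ℝ (fun z => chartReferenceForm hm P Q k x z (chartDiff 𝓙 x x (X x)))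
          (extChartAt 𝓙 x x) (chartDiff 𝓙 x x (V x)) -
        fderiv ℝ (fun z => chartReferenceForm hm P Q k x z (chartDiff 𝓙 x x (V x)))
          (extChartAt 𝓙 x x) (chartDiff 𝓙 x x (X x))) * twistedCoord L δ k x x (s x) := by
  have hx := mem_extChartAt_source (I := 𝓙) x
  have hL := FiberBundle.mem_baseSet_trivializationAt' (F := ℂ) (E := L) x.2
  have hδ := FiberBundle.mem_baseSet_trivializationAt' (F := ℂ) (E := δ) x
  have hl : ∀ᶠ z in 𝓝 (extChartAt 𝓙 x x), IsLinearMap ℝ (chartReferenceForm hm P Q k x z) :=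
    Filter.Eventually.of_forall fun z => isLinearMap_chartReferenceForm hm P Q
  have hd := fun w => differentiableAt_chartReferenceForm hm P (k := k) Q (x := x) w
  have hf : ContDiffAt ℝ 2 ((fun q => twistedCoord L δ k x q (s q)) ∘ (extChartAt 𝓙 x).symm)
      (extChartAt 𝓙 x x) := (contDiffAt_comp_symm (I := 𝓙) le_rfl hx hs).of_le two_le_infty
  have hf0 : ((fun q => twistedCoord L δ k x q (s q)) ∘ (extChartAt 𝓙 x).symm)
      (extChartAt 𝓙 x x) = twistedCoord L δ k x x (s x) := by
    rw [Function.comp_apply, (extChartAt 𝓙 x).left_inv hx]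
  have hfield : ∀ U : Π y : S × M, TangentSpace 𝓙 y,
      chartField 𝓙 x U (extChartAt 𝓙 x x) = chartDiff 𝓙 x x (U x) := fun U => by
    rw [chartField, (extChartAt 𝓙 x).left_inv hx]
  -- The coordinate formula applied twice. The inner derivative is known by its formula on a whole
  -- neighbourhood, so it may be differentiated again.
  have h₂ : ∀ U U' : Π y : S × M, TangentSpace 𝓙 y,
      DifferentiableAt ℝ (chartField 𝓙 x U) (extChartAt 𝓙 x x) →
      twistedCoord L δ k x x (referenceConn P Q hm k
        (fun y => referenceConn P Q hm k s y (U y)) x (U' x)) =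
      fderiv ℝ (fun z =>
        fderiv ℝ ((fun q => twistedCoord L δ k x q (s q)) ∘ (extChartAt 𝓙 x).symm) z
            (chartField 𝓙 x U z) +
          ((fun q => twistedCoord L δ k x q (s q)) ∘ (extChartAt 𝓙 x).symm) z *
            chartReferenceForm hm P Q k x z (chartField 𝓙 x U z))
          (extChartAt 𝓙 x x) (chartDiff 𝓙 x x (U' x)) +
        (fderiv ℝ ((fun q => twistedCoord L δ k x q (s q)) ∘ (extChartAt 𝓙 x).symm)
            (extChartAt 𝓙 x x) (chartField 𝓙 x U (extChartAt 𝓙 x x)) +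
          ((fun q => twistedCoord L δ k x q (s q)) ∘ (extChartAt 𝓙 x).symm) (extChartAt 𝓙 x x) *
            chartReferenceForm hm P Q k x (extChartAt 𝓙 x x)
              (chartField 𝓙 x U (extChartAt 𝓙 x x))) *
          chartReferenceForm hm P Q k x (extChartAt 𝓙 x x) (chartDiff 𝓙 x x (U' x)) := fun U U' hU => by
    have he := eventually_twistedCoord_referenceConn hm P Q hs U
    have h := twistedCoord_referenceConn_eq_fderiv hm P Q hx hL hδ
      (s := fun y => referenceConn P Q hm k s y (U y))
      ((differentiableAt_oneForm hl hd hf hU).congr_of_eventuallyEq he) (U' x)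
    rw [he.fderiv_eq, he.self_of_nhds] at h
    exact h
  have h₁ := twistedCoord_referenceConn_eq_fderiv hm P Q hx hL hδ (s := s)
    (hf.differentiableAt two_ne_zero) (VectorField.mlieBracket 𝓙 V X x)
  have key := curvature_oneForm hl hd hf hV hX
  rw [curvature, map_sub, map_sub, h₂ X V hX, h₂ V X hV, h₁, chartDiff_mlieBracket]
  rw [hf0] at key ⊢
  simp only [hfield] at key ⊢
  exact key

theorem chartDiff_mfderiv_prodMk_left (hy : y ∈ (extChartAt 𝓙 x).source)
    (v : TangentSpace 𝓘(ℝ, ES) y.1) :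
    chartDiff 𝓙 x y (mfderiv 𝓘(ℝ, ES) 𝓙 (fun σ => (σ, y.2)) y.1 v) =
      (chartDiff 𝓘(ℝ, ES) x.1 y.1 v, 0) := by
  rw [mfderiv_prod_left, chartDiff_prod hy, mfderiv_fst, mfderiv_snd]
  exact Prod.ext rfl (map_zero (chartDiff 𝓘(ℝ, E) x.2 y.2))

theorem differentiableAt_chartField_prodMk_left {V : Π σ : S, TangentSpace 𝓘(ℝ, ES) σ}
    (hV : ContMDiffAt 𝓘(ℝ, ES) (𝓘(ℝ, ES).prod 𝓘(ℝ, ES)) ∞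
      (fun σ => TotalSpace.mk' ES (E := (TangentSpace 𝓘(ℝ, ES) : S → Type _)) σ (V σ)) x.1) :
    DifferentiableAt ℝ (chartField 𝓙 x fun y => mfderiv 𝓘(ℝ, ES) 𝓙 (fun σ => (σ, y.2)) y.1 (V y.1))
      (extChartAt 𝓙 x x) := by
  have hz := (extChartAt 𝓙 x).map_source (mem_extChartAt_source (I := 𝓙) x)
  have h := differentiableAt_chartField hV
  have h' : DifferentiableAt ℝ (chartField 𝓘(ℝ, ES) x.1 V) (extChartAt 𝓙 x x).1 := by
    rwa [extChartAt_prod_apply]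
  refine ((h'.comp (extChartAt 𝓙 x x) differentiableAt_fst).prodMk
    (differentiableAt_const (0 : E))).congr_of_eventuallyEq ?_
  filter_upwards [eventually_target hz] with q hq
  rw [chartField, chartDiff_mfderiv_prodMk_left ((extChartAt 𝓙 x).map_target hq)]
  rfl

end Reference

end
end HalfForm

/-! ### The curvature formula. -/

theorem proposition5
    {E : Type*} [NormedAddCommGroup E] [NormedSpace ℝ E] [FiniteDimensional ℝ E]
    {M : Type*} [TopologicalSpace M] [ChartedSpace E M] [IsManifold 𝓘(ℝ, E) ∞ M]
    {ES : Type*} [NormedAddCommGroup ES] [NormedSpace ℝ ES] [FiniteDimensional ℝ ES]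
    {S : Type*} [TopologicalSpace S] [ChartedSpace ES S] [IsManifold 𝓘(ℝ, ES) ∞ S]
    {L : M → Type*} [∀ p, AddCommGroup (L p)] [∀ p, Module ℂ (L p)] [∀ p, TopologicalSpace (L p)]
    [∀ p, IsTopologicalAddGroup (L p)] [∀ p, ContinuousSMul ℝ (L p)]
    [TopologicalSpace (TotalSpace ℂ L)] [FiberBundle ℂ L] [VectorBundle ℂ ℂ L]
    [VectorBundle ℝ ℂ L] [ContMDiffVectorBundle ∞ ℂ L 𝓘(ℝ, E)]
    {δ : S × M → Type*} [∀ x, AddCommGroup (δ x)] [∀ x, Module ℂ (δ x)]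
    [∀ x, TopologicalSpace (δ x)] [∀ x, IsTopologicalAddGroup (δ x)] [∀ x, ContinuousSMul ℝ (δ x)]
    [TopologicalSpace (TotalSpace ℂ δ)] [FiberBundle ℂ δ] [VectorBundle ℂ ℂ δ]
    [VectorBundle ℝ ℂ δ] [ContMDiffVectorBundle ∞ ℂ δ (𝓘(ℝ, ES).prod 𝓘(ℝ, E))]
    {m : ℕ} (hm : Module.finrank ℝ E = 2 * m)
    (Ω : HalfForm.SymplecticForm E M) (F : HalfForm.KahlerFamily Ω ES S)
    (P : HalfForm.PrequantumStructure Ω L)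
    (Q : HalfForm.SquareRoot F.toCompatibleFamily m δ) (k : ℕ)
    (V : Π σ : S, TangentSpace 𝓘(ℝ, ES) σ)
    (X : Π y : S × M, TangentSpace (𝓘(ℝ, ES).prod 𝓘(ℝ, E)) y)
    (hXM : ∀ y, mfderiv (𝓘(ℝ, ES).prod 𝓘(ℝ, E)) 𝓘(ℝ, ES) Prod.fst y (X y) = 0)
    (s : Π y, HalfForm.Twisted L δ k y) (x : S × M)
    (hV : ContMDiffAt 𝓘(ℝ, ES) (𝓘(ℝ, ES).prod 𝓘(ℝ, ES)) ∞
      (fun σ => TotalSpace.mk' ES (E := (TangentSpace 𝓘(ℝ, ES) : S → Type _)) σ (V σ)) x.1)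
    (hX : ContMDiffAt (𝓘(ℝ, ES).prod 𝓘(ℝ, E))
      ((𝓘(ℝ, ES).prod 𝓘(ℝ, E)).prod 𝓘(ℝ, ES × E)) ∞
      (fun y => TotalSpace.mk' (ES × E)
        (E := (TangentSpace (𝓘(ℝ, ES).prod 𝓘(ℝ, E)) : S × M → Type _)) y (X y)) x)
    (hs : HalfForm.TwistedSmoothAt ES E s x) :
    HalfForm.curvature (𝓘(ℝ, ES).prod 𝓘(ℝ, E)) (HalfForm.referenceConn P Q hm k)
        (fun y => mfderiv 𝓘(ℝ, ES) (𝓘(ℝ, ES).prod 𝓘(ℝ, E)) (fun σ => (σ, y.2)) y.1 (V y.1))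
        X s x =
      (Complex.I / 4 * (F.traceTerm x (V x.1)
        (mfderiv (𝓘(ℝ, ES).prod 𝓘(ℝ, E)) 𝓘(ℝ, E) Prod.snd x (X x)) : ℂ)) • s x := by
  have hx := mem_extChartAt_source (I := 𝓘(ℝ, ES).prod 𝓘(ℝ, E)) x
  have hL := FiberBundle.mem_baseSet_trivializationAt' (F := ℂ) (E := L) x.2
  have hδ := FiberBundle.mem_baseSet_trivializationAt' (F := ℂ) (E := δ) x
  have h := HalfForm.twistedCoord_curvature hm P Q (k := k)
    (HalfForm.differentiableAt_chartField_prodMk_left (x := x) hV)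
    (HalfForm.differentiableAt_chartField hX) hs
  -- Tangency to `M` means that the chart representation of `X` at `x` has no component along `S`,
  -- so only the mixed part of `dΘ` is evaluated.
  have hXx : HalfForm.chartDiff (𝓘(ℝ, ES).prod 𝓘(ℝ, E)) x x (X x) =
      (0, HalfForm.chartDiff 𝓘(ℝ, E) x.2 x.2
        (mfderiv (𝓘(ℝ, ES).prod 𝓘(ℝ, E)) 𝓘(ℝ, E) Prod.snd x (X x))) := by
    rw [HalfForm.chartDiff_prod hx, hXM x]
    exact Prod.ext (map_zero (HalfForm.chartDiff 𝓘(ℝ, ES) x.1 x.1)) rfl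
  rw [HalfForm.chartDiff_mfderiv_prodMk_left hx, hXx, HalfForm.fderiv_chartReferenceForm hm P F Q,
    ← HalfForm.KahlerFamily.traceTerm_eq] at h
  -- A vector of the fibre at `x` is determined by its coordinate in the frame there.
  rw [← HalfForm.twistedCoord_smul_twistedFrame hL hδ (HalfForm.curvature _ _ _ X s x), h,
    mul_smul, HalfForm.twistedCoord_smul_twistedFrame hL hδ]
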